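/- Let $\mu$ be a measure on $\mathbb R$, and let $\{g_\theta:\theta\in\Theta\}$, $\{h_\gamma:\gamma\in\Gamma\}$, with $\Theta\subset\mathbb R^{d_g}$ and $\Gamma\subset\mathbb R^{d_h}$, be two families of probability densities with respect to $\mu$. All distributions of the two families are mutually absolutely continuous, and almost surely $\theta\mapsto\log g_\theta(X)$ and $\gamma\mapsto\log h_\gamma(X)$ are finite and differentiable on all of $\Theta$ and $\Gamma$. Let $X,X_1,X_2,\dots$ be independent and identically distributed real observations, and let $P_f$, $E_f$ denote probability and expectation when they have density $f$. Put $l_{\theta\gamma}=\log h_\gamma(X)-\log g_\theta(X)$. Assume: A1. $\inf_{\theta\in\Theta,\gamma\in\Gamma}E_{g_\theta}\{\log g_\theta(X)-\log h_\gamma(X)\}>0$, where the expectations may be $+\infty$. A2. $\Theta$ and $\Gamma$ are compact with continuously differentiable boundary: near each boundary point $p$ the set is $\{F\le 0\}$ for some $C^1$ function $F$ with $\nabla F(p)\ne0$. A3. With $S_1=\sup_{\theta,\gamma}|\nabla_\theta l_{\theta\gamma}|$ and $S_2=\sup_{\theta,\gamma}|\nabla_\gamma l_{\theta\gamma}|$,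 there are $\eta,x_0>0$ such that for all $x>x_0$ and $i=1,2$, $$\sup_{\theta\in\Theta,\gamma\in\Gamma}\max\{P_{g_\theta}(S_i>x),P_{h_\gamma}(S_i>x)\}\le e^{-(\log x)^{1+\eta}}.$$ Let $\phi$ on $\Theta$ and $\varphi$ on $\Gamma$ be prior probability densities with respect to Lebesgue measure that are positive and Lipschitz continuous, and let $$BF=\frac{\int_\Gamma\varphi(\gamma)\prod_{i=1}^n h_\gamma(X_i)\,d\gamma}{\int_\Theta\phi(\theta)\prod_{i=1}^n g_\theta(X_i)\,d\theta}.$$ Select the $h$-family if $BF>1$ and the $g$-family otherwise. For two densities $g,h$ let $l=\log h(X)-\log g(X)$, $m_g(t)=\sup_{z\in\mathbb R}\{zt-\log E_g e^{zl}\}$ and $m_h(t)=\sup_{z\in\mathbb R}\{zt-\log E_h e^{-zl}\}$. The Chernoff index between $g$ and $h$ is $\sup_{E_g l<t<E_h l}\min\{m_g(t),m_h(-t)\}$, where $E_g l$ and $E_h l$ may be infinite. Let $\rho_{\theta\gamma}$ be the Chernoff index between $g_\theta$ and $h_\gamma$. Then $\rho=\min_{\theta\in\Theta,\gamma\in\Gamma}\rho_{\theta\gamma}$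 is attained, $0<\rho<\infty$, and as $n\to\infty$ $$\log\int_\Theta P_{g_\theta}(BF>1)\,\phi(\theta)\,d\theta\sim\sup_{\theta\in\Theta}\log P_{g_\theta}(BF>1)\sim\log\int_\Gamma P_{h_\gamma}(BF\le1)\,\varphi(\gamma)\,d\gamma\sim\sup_{\gamma\in\Gamma}\log P_{h_\gamma}(BF\le1)\sim-n\rho,$$ where $a_n\sim b_n$ means $a_n/b_n\to1$. -/

import Mathlib

open MeasureTheory Filter Topology Asymptotics
open scoped ENNReal

noncomputable section

namespace SeparateFamilies

/-- The parameter space `ℝᵈ` with its Euclidean structure and Lebesgue measure. -/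
abbrev Param (d : ℕ) : Type := EuclideanSpace ℝ (Fin d)

/-- The distribution on `ℝ` with density `f` with respect to the baseline measure `μ`. -/
def law (μ : Measure ℝ) (f : ℝ → ℝ) : Measure ℝ :=
  μ.withDensity (fun x => ENNReal.ofReal (f x))

/-- The joint distribution of `n` independent observations with density `f`. -/
def sampleLaw (μ : Measure ℝ) (f : ℝ → ℝ) (n : ℕ) : Measure (Fin n → ℝ) :=
  Measure.pi (fun _ => law μ f)

/-- `{f_t : t ∈ T}` is a family of probability densities with respect to `μ`. -/
structure IsDensityFamily {d : ℕ} (μ : Measure ℝ) (T : Set (Param d))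
    (f : Param d → ℝ → ℝ) : Prop where
  measurable : ∀ t ∈ T, Measurable (f t)
  nonneg : ∀ t ∈ T, ∀ x, 0 ≤ f t x
  lintegral_eq_one : ∀ t ∈ T, ∫⁻ x, ENNReal.ofReal (f t x) ∂μ = 1

/-- The log-density `t ↦ log f_t(X)` is, almost surely, finite and differentiable on all
of `T`, so that its gradient in the parameter makes sense. -/
def HasScore {d : ℕ} (μ : Measure ℝ) (T : Set (Param d)) (f : Param d → ℝ → ℝ) : Prop :=
  ∀ t₀ ∈ T, ∀ᵐ x ∂(law μ (f t₀)),
    (∀ t ∈ T, 0 < f t x) ∧ DifferentiableOn ℝ (fun t => Real.log (f t x)) T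

/-- The boundary of `T` is continuously differentiable: near each boundary point `p`, the set
`T` is the sublevel set `{F ≤ 0}` of a `C¹` function `F` whose derivative at `p` is not zero. -/
def HasC1Boundary {d : ℕ} (T : Set (Param d)) : Prop :=
  ∀ p ∈ frontier T, ∃ F : Param d → ℝ,
    ContDiffAt ℝ 1 F p ∧ fderiv ℝ F p ≠ 0 ∧ ∀ᶠ x in 𝓝 p, (x ∈ T ↔ F x ≤ 0)

/-- The log-likelihood ratio `l(x) = log h(x) - log g(x)` of one observation. -/
def logLR (g h : ℝ → ℝ) (x : ℝ) : ℝ := Real.log (h x) - Real.log (g x)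

/-- The expectation `E_P(f) ∈ [-∞, ∞]` of a function for which one of the positive and
negative parts is integrable. -/
def extExpect (P : Measure ℝ) (f : ℝ → ℝ) : EReal :=
  ((∫⁻ x, ENNReal.ofReal (f x) ∂P : ℝ≥0∞) : EReal)
    - ((∫⁻ x, ENNReal.ofReal (-f x) ∂P : ℝ≥0∞) : EReal)

/-- The moment generating function `M_g(z) = E_g(exp(z l)) ∈ [0, ∞]` of
`l = log h - log g` under `g`. -/
def lrMgf (μ : Measure ℝ) (g h : ℝ → ℝ) (z : ℝ) : ℝ≥0∞ :=
  ∫⁻ x, ENNReal.ofReal (Real.exp (z * logLR g h x)) ∂(law μ g)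

/-- The rate function `m_g(t) = sup_z [z t - log M_g(z)]`. The rate function `m_h` is
`rate μ h g`, with the roles of the two densities switched. -/
def rate (μ : Measure ℝ) (g h : ℝ → ℝ) (t : ℝ) : EReal :=
  ⨆ z : ℝ, ((z * t : ℝ) : EReal) - ENNReal.log (lrMgf μ g h z)

/-- The Chernoff index between `g` and `h`:
`sup {min (m_g(t), m_h(-t)) : E_g(l) < t < E_h(l)}`. -/
def chernoffIndex (μ : Measure ℝ) (g h : ℝ → ℝ) : EReal :=
  ⨆ t ∈ {t : ℝ | extExpect (law μ g) (logLR g h) < (t : EReal) ∧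
      (t : EReal) < extExpect (law μ h) (logLR g h)},
    min (rate μ g h t) (rate μ h g (-t))

/-- `S₁(x) = sup_{θ,γ} |∇_θ l_{θγ}(x)|`. -/
def supGradNull {dg dh : ℕ} (Θ : Set (Param dg)) (Γ : Set (Param dh))
    (g : Param dg → ℝ → ℝ) (h : Param dh → ℝ → ℝ) (x : ℝ) : ℝ≥0∞ :=
  ⨆ θ ∈ Θ, ⨆ γ ∈ Γ, ‖gradientWithin (fun t => logLR (g t) (h γ) x) Θ θ‖ₑ

/-- `S₂(x) = sup_{θ,γ} |∇_γ l_{θγ}(x)|`. -/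
def supGradAlt {dg dh : ℕ} (Θ : Set (Param dg)) (Γ : Set (Param dh))
    (g : Param dg → ℝ → ℝ) (h : Param dh → ℝ → ℝ) (x : ℝ) : ℝ≥0∞ :=
  ⨆ θ ∈ Θ, ⨆ γ ∈ Γ, ‖gradientWithin (fun t => logLR (g θ) (h t) x) Γ γ‖ₑ

/-- All distributions of the two families are mutually absolutely continuous. -/
def MutuallyAC {dg dh : ℕ} (μ : Measure ℝ) (Θ : Set (Param dg)) (Γ : Set (Param dh))
    (g : Param dg → ℝ → ℝ) (h : Param dh → ℝ → ℝ) : Prop :=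
  ∀ θ ∈ Θ, ∀ γ ∈ Γ, law μ (g θ) ≪ law μ (h γ) ∧ law μ (h γ) ≪ law μ (g θ)

/-- Complete separation: the Kullback-Leibler divergences
`E_{g_θ}(log g_θ - log h_γ)` are bounded away from zero. -/
def CompletelySeparated {dg dh : ℕ} (μ : Measure ℝ) (Θ : Set (Param dg)) (Γ : Set (Param dh))
    (g : Param dg → ℝ → ℝ) (h : Param dh → ℝ → ℝ) : Prop :=
  0 < ⨅ θ ∈ Θ, ⨅ γ ∈ Γ,
    extExpect (law μ (g θ)) (fun x => Real.log (g θ x) - Real.log (h γ x))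

/-- The tail condition on the suprema `S₁`, `S₂` of the gradients of `l_{θγ}`. -/
def GradientTails {dg dh : ℕ} (μ : Measure ℝ) (Θ : Set (Param dg)) (Γ : Set (Param dh))
    (g : Param dg → ℝ → ℝ) (h : Param dh → ℝ → ℝ) : Prop :=
  ∃ η > (0 : ℝ), ∃ x₀ > (0 : ℝ), ∀ x > x₀, ∀ θ ∈ Θ, ∀ γ ∈ Γ,
    ∀ S ∈ ({supGradNull Θ Γ g h, supGradAlt Θ Γ g h} : Set (ℝ → ℝ≥0∞)),
      max (law μ (g θ) {y | ENNReal.ofReal x < S y})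
          (law μ (h γ) {y | ENNReal.ofReal x < S y})
        ≤ ENNReal.ofReal (Real.exp (-(Real.log x ^ (1 + η))))

/-- A prior density on `T` which is positive and Lipschitz continuous. -/
structure IsPositiveLipschitzPrior {d : ℕ} (T : Set (Param d)) (w : Param d → ℝ) : Prop where
  pos : ∀ t ∈ T, 0 < w t
  lipschitz : ∃ K, LipschitzOnWith K w T
  integral_eq_one : ∫ t in T, w t = 1

/-- The marginal likelihood `∫_T w(t) ∏ᵢ f_t(Xᵢ) dt` of the sample `X = (X₁, …, Xₙ)`. -/
def marginal {d : ℕ} (T : Set (Param d)) (w : Param d → ℝ) (f : Param d → ℝ → ℝ) {n : ℕ}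
    (X : Fin n → ℝ) : ℝ :=
  ∫ t in T, w t * ∏ i, f t (X i)

/-- The Bayes factor, with prior `φ` on the `g`-family and prior `ψ` on the `h`-family. -/
def bayesFactor {dg dh : ℕ} (Θ : Set (Param dg)) (Γ : Set (Param dh))
    (g : Param dg → ℝ → ℝ) (h : Param dh → ℝ → ℝ) (φ : Param dg → ℝ) (ψ : Param dh → ℝ)
    {n : ℕ} (X : Fin n → ℝ) : ℝ :=
  marginal Γ ψ h X / marginal Θ φ g X

/-- The probability `P_{g_θ}(BF > 1)` of wrongly selecting the `h`-family. -/
def errNull {dg dh : ℕ} (μ : Measure ℝ) (Θ : Set (Param dg)) (Γ : Set (Param dh))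
    (g : Param dg → ℝ → ℝ) (h : Param dh → ℝ → ℝ) (φ : Param dg → ℝ) (ψ : Param dh → ℝ)
    (n : ℕ) (θ : Param dg) : ℝ≥0∞ :=
  sampleLaw μ (g θ) n {X | 1 < bayesFactor Θ Γ g h φ ψ X}

/-- The probability `P_{h_γ}(BF ≤ 1)` of wrongly selecting the `g`-family. -/
def errAlt {dg dh : ℕ} (μ : Measure ℝ) (Θ : Set (Param dg)) (Γ : Set (Param dh))
    (g : Param dg → ℝ → ℝ) (h : Param dh → ℝ → ℝ) (φ : Param dg → ℝ) (ψ : Param dh → ℝ)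
    (n : ℕ) (γ : Param dh) : ℝ≥0∞ :=
  sampleLaw μ (h γ) n {X | bayesFactor Θ Γ g h φ ψ X ≤ 1}

/-- `log ∫_T e(t) w(t) dt`, the logarithm of a prior-averaged error probability. The logarithm
takes values in `[-∞, ∞]` and is then read as a real number. -/
def logAverage {d : ℕ} (T : Set (Param d)) (w : Param d → ℝ) (e : Param d → ℝ≥0∞) : ℝ :=
  (ENNReal.log (∫⁻ t in T, e t * ENNReal.ofReal (w t))).toReal

/-- `sup_{t ∈ T} log e(t)`, the logarithm of a worst-case error probability, with
`log 0 = -∞`. The supremum is taken in `[-∞, ∞]` and is then read as a real number. -/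
def logWorst {d : ℕ} (T : Set (Param d)) (e : Param d → ℝ≥0∞) : ℝ :=
  (⨆ t ∈ T, ENNReal.log (e t)).toReal

end SeparateFamilies

end

/-! Relative to one of the laws as reference measure, every density is the exponential of a
log-density, and by Hölder's inequality `log ∫ exp(a)` is convex in `a`. The central quantity is the
affinity `∫ g_θ^(1-z) h_γ^z`. Let `exp(-ρ)` be its maximum over `(θ, γ)` of the minimum over `z ∈
[0, 1]`. Compactness and continuity give an extremal triple `(θ₀, γ₀, z)`, and separation of the
families forces `ρ > 0` and `0 < z < 1` (`exists_leastFavourable`). The index of a pair is minus the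
logarithm of its least affinity: `t = 0` is admissible, and no other `t` does better
(`le_chernoffIndex`, `chernoffIndex_le`).

Upper bound. On samples whose gradients are at most `exp(ε₁ n)`, log-likelihoods vary by at most one
at an exponentially small scale. Hence a marginal likelihood equals the maximum likelihood up to
`exp(ε n)`, and the maximum may be taken over a net of `exp(ε n)` points chosen before the data
(`exists_laplace`). An error under `θ` then forces some `γ` in the net to have log-likelihood ratio
at least `-ε n`, and Chernoff's inequality with a union bound applies (`error_le`). The tail
condition makes the remaining samples negligible at every exponential rate.

Lower bound. Here `γ₀` must beat every `θ`, not only `θ₀`. Under the law proportional to `g_θ₀^(1-z)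
h_γ₀^z`, stationarity in `z` and minimality of `ρ` make the drift of `log g_θ - log h_γ₀`
nonpositive to first order for all `θ` (`expInt_tilt_le`). Drawing a small proportion of the sample
from a truncation of `h_γ₀` makes it strictly negative (`expInt_truncLaw_competitor_le`) at little
cost. Changing measure back to `θ₀` loses a factor `exp(n(ρ + τ))`
(`exists_error_ge_of_leastFavourable`). The Lipschitz control extends the bound to a ball of
subexponential prior mass (`exists_ball_error_ge`), so averaged and worst-case errors share one
rate. Exchanging the families and replacing `z` by `1 - z` treats the other error. -/

noncomputable section

namespace SeparateFamilies

/-! ### Geometry of compact sets with `C¹` boundary -/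

/-- A cone condition near `x`: a fixed open cone can be attached to every nearby point of `T`
without leaving `T`. -/
def HasConeAt {E : Type*} [NormedAddCommGroup E] [NormedSpace ℝ E] (T : Set E) (K δ : ℝ)
    (x : E) : Prop :=
  ∃ v : E, ‖v‖ ≤ K ∧ ∀ y ∈ T, dist y x < δ → ∀ s, 0 ≤ s → s ≤ δ → ∀ e : E, K * ‖e‖ ≤ s →
    y + s • v + e ∈ T

lemma HasConeAt.mono {E : Type*} [NormedAddCommGroup E] [NormedSpace ℝ E] {T : Set E}
    {K K' δ δ' : ℝ} {x : E} (h : HasConeAt T K δ x) (hK : K ≤ K') (hδ : δ' ≤ δ) :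
    HasConeAt T K' δ' x := by
  obtain ⟨v, hv, H⟩ := h
  refine ⟨v, hv.trans hK, fun y hy hyx s hs hs' e he => ?_⟩
  refine H y hy (hyx.trans_le hδ) s hs (hs'.trans hδ) e (le_trans ?_ he)
  gcongr

/-- Along a direction `v` with `F' v = -1` the constraint decreases at unit rate. Strict
differentiability makes this uniform over nearby base points. -/
lemma exists_cone_of_hasStrictFDerivAt {E : Type*} [NormedAddCommGroup E] [NormedSpace ℝ E]
    {T : Set E} {p : E} {F : E → ℝ} {F' : E →L[ℝ] ℝ} (hF : HasStrictFDerivAt F F' p)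
    (hF' : F' ≠ 0) (hT : ∀ᶠ x in 𝓝 p, (x ∈ T ↔ F x ≤ 0)) :
    ∃ K > 0, ∃ δ > 0, HasConeAt T K δ p := by
  obtain ⟨w, hw⟩ : ∃ w, F' w ≠ 0 := by
    by_contra! hcon
    exact hF' (ContinuousLinearMap.ext hcon)
  set v : E := (-(F' w)⁻¹) • w with hv
  have hFv : F' v = -1 := by
    simp [hv, hw]
  have hvpos : 0 < ‖v‖ := by
    rw [norm_pos_iff]; rintro h0; rw [h0] at hFv; simp at hFv
  -- With this `κ` the remainder along `v` eats at most half of the decrease `s`; the other half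
  -- pays for `e`, thanks to `K ≥ 2 (‖F'‖ + κ)`.
  set κ : ℝ := 1 / (2 * ‖v‖) with hκ
  have hκpos : 0 < κ := by positivity
  have hκv : κ * ‖v‖ = 1 / 2 := by rw [hκ]; field_simp
  have h1 := hF.isLittleO.bound hκpos
  rw [nhds_prod_eq, (Metric.nhds_basis_ball.prod_self).eventually_iff] at h1
  obtain ⟨ε₁, hε₁, h1⟩ := h1
  obtain ⟨ε₂, hε₂, h2⟩ := Metric.eventually_nhds_iff.1 hT
  set ε := min ε₁ ε₂ with hε
  have hεpos : 0 < ε := lt_min hε₁ hε₂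
  set K : ℝ := max ‖v‖ (2 * (‖F'‖ + κ)) with hK
  have hKv : ‖v‖ ≤ K := le_max_left _ _
  have hKpos : 0 < K := hvpos.trans_le hKv
  set δ : ℝ := ε / (2 * (1 + ‖v‖ + 1 / K)) with hδ
  have hδpos : 0 < δ := by positivity
  have hδε : δ + δ * ‖v‖ + δ / K ≤ ε / 2 := by
    have : δ + δ * ‖v‖ + δ / K = δ * (1 + ‖v‖ + 1 / K) := by ring
    rw [this, hδ]
    apply le_of_eq
    field_simp
  refine ⟨K, hKpos, δ, hδpos, v, hKv, fun y hy hyp s hs hsδ e he => ?_⟩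
  have hen : ‖e‖ ≤ s / K := by rw [le_div_iff₀ hKpos]; linarith
  have hsK : s / K ≤ δ / K := by gcongr
  have hsv : s * ‖v‖ ≤ δ * ‖v‖ := by gcongr
  have hnorm : ‖s • v + e‖ ≤ s * ‖v‖ + ‖e‖ := by
    refine (norm_add_le _ _).trans ?_
    rw [norm_smul, Real.norm_of_nonneg hs]
  have hdist : dist (y + s • v + e) p < ε := by
    have : dist (y + s • v + e) y = ‖s • v + e‖ := by
      rw [dist_eq_norm]; congr 1; abel
    calc dist (y + s • v + e) p ≤ dist (y + s • v + e) y + dist y p := dist_triangle _ _ _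
      _ < ε := by rw [this]; linarith
  have hyε : dist y p < ε := by
    have : 0 ≤ δ * ‖v‖ := by positivity
    have : 0 ≤ δ / K := by positivity
    linarith
  have hFy : F y ≤ 0 := (h2 (hyε.trans_le (min_le_right _ _))).1 hy
  rw [h2 (hdist.trans_le (min_le_right _ _))]
  have key := h1 (x := (y + s • v + e, y)) ⟨hdist.trans_le (min_le_left _ _),
    hyε.trans_le (min_le_left _ _)⟩
  have hsub : y + s • v + e - y = s • v + e := by abel
  simp only [hsub, map_add, map_smul, hFv, smul_eq_mul] at key
  have habs := (abs_le.1 (Real.norm_eq_abs _ ▸ key)).2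
  have hFe : F' e ≤ ‖F'‖ * ‖e‖ := (le_abs_self _).trans (F'.le_opNorm e)
  have h3 : κ * ‖s • v + e‖ ≤ κ * (s * ‖v‖ + ‖e‖) := by gcongr
  have h4 : κ * (s * ‖v‖ + ‖e‖) = s / 2 + κ * ‖e‖ := by
    rw [mul_add, mul_left_comm, hκv]; ring
  have h5 : 2 * (‖F'‖ + κ) * ‖e‖ ≤ K * ‖e‖ := by
    gcongr; exact le_max_right _ _
  nlinarith

lemma exists_cone_of_mem_interior {E : Type*} [NormedAddCommGroup E] [NormedSpace ℝ E]
    {T : Set E} {p : E} (hp : p ∈ interior T) : ∃ K > 0, ∃ δ > 0, HasConeAt T K δ p := by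
  obtain ⟨ε, hε, hT⟩ := Metric.isOpen_iff.1 isOpen_interior p hp
  refine ⟨1, one_pos, ε / 2, half_pos hε, 0, by simp, fun y _ hyp s _ hs e he => ?_⟩
  apply interior_subset
  apply hT
  rw [Metric.mem_ball]
  have : dist (y + s • (0 : E) + e) y = ‖e‖ := by rw [dist_eq_norm]; congr 1; simp
  calc dist (y + s • (0 : E) + e) p ≤ dist (y + s • (0 : E) + e) y + dist y p :=
        dist_triangle _ _ _
    _ < ε := by rw [this]; linarith

lemma HasC1Boundary.exists_cone {d : ℕ} {T : Set (Param d)} (hb : HasC1Boundary T)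
    {p : Param d} (hp : p ∈ T) : ∃ K > 0, ∃ δ > 0, HasConeAt T K δ p := by
  by_cases hi : p ∈ interior T
  · exact exists_cone_of_mem_interior hi
  · obtain ⟨F, hF, hF', hT⟩ := hb p ⟨subset_closure hp, hi⟩
    exact exists_cone_of_hasStrictFDerivAt (hF.hasStrictFDerivAt one_ne_zero) hF' hT

/-- The cone at a point serves a whole neighbourhood with the same axis, so compactness makes `K`
and `δ` uniform; the axis may still vary. -/
lemma HasC1Boundary.exists_uniform_cone {d : ℕ} {T : Set (Param d)} (hT : IsCompact T)
    (hb : HasC1Boundary T) : ∃ K > 0, ∃ δ > 0, ∀ x ∈ T, HasConeAt T K δ x := by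
  refine hT.induction_on (p := fun s => ∃ K > 0, ∃ δ > 0, ∀ x ∈ s, HasConeAt T K δ x)
    ⟨1, one_pos, 1, one_pos, by simp⟩ ?_ ?_ ?_
  · rintro s t hst ⟨K, hK, δ, hδ, h⟩
    exact ⟨K, hK, δ, hδ, fun x hx => h x (hst hx)⟩
  · rintro s t ⟨K, hK, δ, hδ, h⟩ ⟨K', hK', δ', hδ', h'⟩
    refine ⟨max K K', lt_max_of_lt_left hK, min δ δ', lt_min hδ hδ', ?_⟩
    rintro x (hx | hx)
    · exact (h x hx).mono (le_max_left _ _) (min_le_left _ _)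
    · exact (h' x hx).mono (le_max_right _ _) (min_le_right _ _)
  · intro x hx
    obtain ⟨K, hK, δ, hδ, v, hv, H⟩ := hb.exists_cone hx
    refine ⟨Metric.ball x (δ / 2), mem_nhdsWithin_of_mem_nhds (Metric.ball_mem_nhds _ (half_pos hδ)),
      K, hK, δ / 2, half_pos hδ, fun y hy => ⟨v, hv, fun z hz hzy s hs hsδ e he => ?_⟩⟩
    refine H z hz ?_ s hs (by linarith) e he
    rw [Metric.mem_ball] at hy
    linarith [dist_triangle z y x]

/-- On a set with the uniform cone property, a bound on the derivative within the set is a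
Lipschitz constant at small scales. -/
lemma abs_sub_le_of_cone {d : ℕ} {T : Set (Param d)} {K δ : ℝ} (hK : 0 < K) (hδ : 0 < δ)
    (hcone : ∀ x ∈ T, HasConeAt T K δ x) {f : Param d → ℝ} (hf : DifferentiableOn ℝ f T) {B : ℝ}
    (hB0 : 0 ≤ B) (hB : ∀ x ∈ T, ‖gradientWithin f T x‖ ≤ B) {x y : Param d} (hx : x ∈ T)
    (hy : y ∈ T) (hxy : dist x y < δ / (1 + K)) :
    |f x - f y| ≤ (1 + 2 * K ^ 2) * B * dist x y := by
  have hseg : ∀ a b : Param d, segment ℝ a b ⊆ T → |f b - f a| ≤ B * dist a b := by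
    intro a b hab
    have := (convex_segment a b).norm_image_sub_le_of_norm_hasFDerivWithin_le (f := f)
      (f' := fderivWithin ℝ f T) (C := B) (x := a) (y := b)
      (fun z hz => ((hf z (hab hz)).hasFDerivWithinAt).mono hab)
      (fun z hz => by
        have h := hB z (hab hz)
        rwa [gradientWithin, LinearIsometryEquiv.norm_map] at h)
      (left_mem_segment ..) (right_mem_segment ..)
    rwa [Real.norm_eq_abs, ← dist_eq_norm, dist_comm] at this
  -- The segment from `x` to `y` may leave `T`, so travel `x → x + s v → y + s v → y`. With `s = K *
  -- dist x y` the displacement `y - x` is an admissible perturbation, which keeps the middle leg in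
  -- `T`; each outer leg has length at most `K² * dist x y`.
  obtain ⟨v, hv, H⟩ := hcone x hx
  set s := K * dist x y with hs
  have hs0 : 0 ≤ s := by positivity
  have hd : dist x y * (1 + K) < δ := by rwa [lt_div_iff₀ (by positivity)] at hxy
  have hd0 : 0 ≤ dist x y := dist_nonneg
  have hsδ : s ≤ δ := by nlinarith
  have hyx : dist y x < δ := by rw [dist_comm]; nlinarith
  have hxx : dist x x < δ := by simpa using hδ
  have h1 : ∀ z ∈ T, dist z x < δ → segment ℝ z (z + s • v) ⊆ T := by
    intro z hz hzx u hu
    rw [segment_eq_image'] at hu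
    obtain ⟨c, ⟨hc0, hc1⟩, rfl⟩ := hu
    have := H z hz hzx (c * s) (by positivity) (by nlinarith) 0 (by simpa using by positivity)
    simpa [mul_smul] using this
  have h2 : segment ℝ (x + s • v) (y + s • v) ⊆ T := by
    intro u hu
    rw [segment_eq_image'] at hu
    obtain ⟨c, ⟨hc0, hc1⟩, rfl⟩ := hu
    have := H x hx hxx s hs0 hsδ (c • (y - x)) (by
      rw [norm_smul, Real.norm_of_nonneg hc0, ← dist_eq_norm, dist_comm, hs]
      have : c * dist x y ≤ dist x y := by nlinarith
      gcongr)
    convert this using 1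
    simp
  have hsv : ∀ z : Param d, dist z (z + s • v) ≤ K ^ 2 * dist x y := by
    intro z
    rw [dist_self_add_right, norm_smul, Real.norm_of_nonneg hs0, hs]
    have : K * dist x y * ‖v‖ ≤ K * dist x y * K := by gcongr
    linarith [this]
  have e1 := hseg _ _ (h1 x hx hxx)
  have e2 := hseg _ _ h2
  have e3 := hseg _ _ (h1 y hy hyx)
  rw [dist_add_right] at e2
  have b1 : B * dist x (x + s • v) ≤ B * (K ^ 2 * dist x y) := by gcongr; exact hsv x
  have b3 : B * dist y (y + s • v) ≤ B * (K ^ 2 * dist x y) := by gcongr; exact hsv y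
  rw [abs_le] at e1 e2 e3 ⊢
  constructor <;> linarith [e1.1, e1.2, e2.1, e2.2, e3.1, e3.2]

/-- A compact set with the uniform cone property occupies a fixed proportion of every small
ball centred in it. -/
lemma exists_volume_ge_of_cone {d : ℕ} {T : Set (Param d)} (hT : IsCompact T) {K δ : ℝ}
    (hK : 0 < K) (hδ : 0 < δ) (hcone : ∀ x ∈ T, HasConeAt T K δ x) :
    ∃ c > 0, ∃ δ' > 0, ∀ t ∈ T, ∀ r, 0 < r → r < δ' →
      c * r ^ d ≤ volume.real (T ∩ Metric.closedBall t r) := by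
  -- Chosen so that the ball inscribed in the cone at height `a r`, of radius `a r / K`, lies within
  -- distance `r` of the apex.
  set a : ℝ := 1 / (K + 1 / K) with ha
  have hapos : 0 < a := by positivity
  refine ⟨(a / K) ^ d * volume.real (Metric.ball (0 : Param d) 1), ?_, δ / a, by positivity,
    fun t ht r hr hrδ => ?_⟩
  · have : 0 < volume.real (Metric.ball (0 : Param d) 1) :=
      ENNReal.toReal_pos (Metric.measure_ball_pos _ _ one_pos).ne' measure_ball_lt_top.ne
    positivity
  · obtain ⟨v, hv, H⟩ := hcone t ht
    have hs : a * r ≤ δ := by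
      rw [lt_div_iff₀ hapos] at hrδ; linarith
    have hsub : Metric.ball (t + (a * r) • v) (a * r / K) ⊆ T ∩ Metric.closedBall t r := by
      intro u hu
      rw [Metric.mem_ball, dist_eq_norm] at hu
      set e := u - (t + (a * r) • v) with he
      have hu' : u = t + (a * r) • v + e := by rw [he]; abel
      have hle : K * ‖e‖ ≤ a * r := by
        rw [lt_div_iff₀ hK] at hu; linarith
      refine ⟨?_, ?_⟩
      · rw [hu']
        exact H t ht (by simpa using hδ) _ (by positivity) hs e hle
      · rw [Metric.mem_closedBall, hu', add_assoc, dist_self_add_left]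
        calc ‖(a * r) • v + e‖ ≤ (a * r) * ‖v‖ + ‖e‖ := by
              refine (norm_add_le _ _).trans ?_
              rw [norm_smul, Real.norm_of_nonneg (by positivity)]
          _ ≤ (a * r) * K + a * r / K := by gcongr
          _ = r * (a * (K + 1 / K)) := by ring
          _ = r := by rw [ha]; field_simp
    have hvol : volume.real (Metric.ball (t + (a * r) • v) (a * r / K))
        = (a / K) ^ d * volume.real (Metric.ball (0 : Param d) 1) * r ^ d := by
      rw [measureReal_def, Measure.addHaar_ball_of_pos _ _ (by positivity), ENNReal.toReal_mul,
        ENNReal.toReal_ofReal (by positivity), measureReal_def, finrank_euclideanSpace,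
        Fintype.card_fin]
      ring
    rw [← hvol]
    exact measureReal_mono hsub (ne_top_of_le_ne_top hT.measure_lt_top.ne
      (measure_mono Set.inter_subset_left))

/-- A bounded set in `ℝᵈ` has a net of mesh `r` with `O(r⁻ᵈ)` points. -/
lemma exists_finset_net {d : ℕ} {T : Set (Param d)} (hT : Bornology.IsBounded T) :
    ∃ C > 0, ∀ r, 0 < r → r ≤ 1 → ∃ N : Finset (Param d), ↑N ⊆ T ∧ (N.card : ℝ) ≤ C * r⁻¹ ^ d ∧
      ∀ t ∈ T, ∃ s ∈ N, dist t s ≤ r := by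
  classical
  obtain ⟨R, hR0, hR⟩ : ∃ R > 0, ∀ t ∈ T, ‖t‖ ≤ R := hT.exists_pos_norm_le
  -- Any `D ≥ √d` would do for the diameter of a cell; `d + 1` is also positive when `d = 0`.
  set D : ℝ := (d : ℝ) + 1 with hD
  have hDpos : 0 < D := by positivity
  refine ⟨(2 * (R * D + 1) + 1) ^ d, by positivity, fun r hr hr1 => ?_⟩
  set m : ℝ := r / D with hm
  have hmpos : 0 < m := by positivity
  set cell : Param d → (Fin d → ℤ) := fun t i => ⌊t i / m⌋ with hcell
  set K : ℤ := ⌈R / m⌉ with hK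
  set box : Finset (Fin d → ℤ) := Fintype.piFinset fun _ => Finset.Icc (-K) K with hbox
  have hmem : ∀ t ∈ T, cell t ∈ box := by
    intro t ht
    rw [hbox, Fintype.mem_piFinset]
    intro i
    have h1 : |t i| ≤ R := (PiLp.norm_apply_le t i).trans (hR t ht)
    rw [abs_le] at h1
    have hRm : R / m ≤ K := Int.le_ceil _
    rw [Finset.mem_Icc]
    constructor
    · rw [hcell, Int.le_floor]
      have : -(R / m) ≤ t i / m := by rw [← neg_div]; gcongr; exact h1.1
      push_cast; linarith
    · rw [hcell]
      have h2 : t i / m ≤ K := le_trans (by gcongr; exact h1.2) hRm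
      have h3 : ((⌊t i / m⌋ : ℤ) : ℝ) ≤ K := (Int.floor_le _).trans h2
      change ⌊t i / m⌋ ≤ K
      exact_mod_cast h3
  -- One representative per occupied cell keeps the net inside `T`.
  set used := box.filter fun b => ∃ t ∈ T, cell t = b with hused
  have hch : ∀ b ∈ used, ∃ t, t ∈ T ∧ cell t = b := fun b hb => by
    simpa using (Finset.mem_filter.1 hb).2
  choose! pick hpick using hch
  refine ⟨used.image pick, ?_, ?_, ?_⟩
  · intro t ht
    obtain ⟨b, hb, rfl⟩ := Finset.mem_image.1 (Finset.mem_coe.1 ht)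
    exact (hpick b hb).1
  · have hKnn : 0 ≤ K := by rw [hK]; positivity
    have h1 : (used.image pick).card ≤ box.card :=
      Finset.card_image_le.trans (Finset.card_filter_le _ _)
    have h2 : (box.card : ℝ) = (2 * (K : ℝ) + 1) ^ d := by
      rw [hbox, Fintype.card_piFinset]
      simp only [Int.card_Icc, Finset.prod_const, Finset.card_univ, Fintype.card_fin]
      push_cast
      congr 1
      have : ((K + 1 - -K).toNat : ℤ) = 2 * K + 1 := by
        rw [Int.toNat_of_nonneg (by linarith)]; ring
      exact_mod_cast this
    have h3 : (K : ℝ) ≤ R * D * r⁻¹ + 1 := by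
      have := (Int.ceil_lt_add_one (R / m)).le
      rw [hK]
      refine this.trans (le_of_eq ?_)
      rw [hm]; field_simp
    have h4 : (1 : ℝ) ≤ r⁻¹ := (one_le_inv₀ hr).2 hr1
    have hKr : (0 : ℝ) ≤ K := by exact_mod_cast hKnn
    calc ((used.image pick).card : ℝ) ≤ (2 * (K : ℝ) + 1) ^ d := by
          rw [← h2]; exact_mod_cast h1
      _ ≤ ((2 * (R * D + 1) + 1) * r⁻¹) ^ d := by
          gcongr
          nlinarith [mul_pos hR0 hDpos]
      _ = _ := by rw [mul_pow]
  · intro t ht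
    have hb : cell t ∈ used := Finset.mem_filter.2 ⟨hmem t ht, t, ht, rfl⟩
    refine ⟨pick (cell t), Finset.mem_image_of_mem _ hb, ?_⟩
    have hcoord : ∀ i, |t i - pick (cell t) i| ≤ m := by
      intro i
      have h1 := congrFun (hpick _ hb).2 i
      have h2 := Int.abs_sub_lt_one_of_floor_eq_floor h1
      rw [← sub_div, abs_div, abs_of_pos hmpos, div_lt_one hmpos, abs_sub_comm] at h2
      exact h2.le
    rw [EuclideanSpace.dist_eq]
    apply Real.sqrt_le_iff.2 ⟨hr.le, ?_⟩
    calc ∑ i, dist (t i) (pick (cell t) i) ^ 2 ≤ ∑ _i : Fin d, m ^ 2 := by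
          gcongr with i
          exact hcoord i
      _ = d * m ^ 2 := by simp
      _ ≤ r ^ 2 := by
          rw [hm, div_pow, ← mul_div_assoc, div_le_iff₀ (by positivity), mul_comm]
          gcongr
          rw [hD]; nlinarith [(Nat.cast_nonneg d : (0:ℝ) ≤ d)]

/-! ### Product measures and changes of measure -/

section ProductMeasure

variable {ι : Type*} [Fintype ι] {Ω : Type*} [MeasurableSpace Ω]

lemma lintegral_pi_prod (ν : ι → Measure Ω) [∀ i, IsProbabilityMeasure (ν i)]
    {F : ι → Ω → ℝ≥0∞} (hF : ∀ i, Measurable (F i)) :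
    ∫⁻ X, ∏ i, F i (X i) ∂Measure.pi ν = ∏ i, ∫⁻ x, F i x ∂ν i := by
  have hind := ProbabilityTheory.iIndepFun_pi (μ := ν) (X := F) fun i => (hF i).aemeasurable
  rw [ProbabilityTheory.lintegral_prod_eq_prod_lintegral_of_indepFun Finset.univ _ hind
    fun i => (hF i).comp (measurable_pi_apply i)]
  refine Finset.prod_congr rfl fun i _ => ?_
  exact (measurePreserving_eval ν i).lintegral_comp (hF i)

lemma pi_withDensity (lam : ι → Measure Ω) [∀ i, IsProbabilityMeasure (lam i)]
    {F : ι → Ω → ℝ≥0∞} (hF : ∀ i, Measurable (F i))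
    [∀ i, IsProbabilityMeasure ((lam i).withDensity (F i))] :
    Measure.pi (fun i => (lam i).withDensity (F i))
      = (Measure.pi lam).withDensity fun X => ∏ i, F i (X i) := by
  refine Measure.pi_eq fun s hs => ?_
  rw [withDensity_apply _ (MeasurableSet.univ_pi hs), ← lintegral_indicator
    (MeasurableSet.univ_pi hs)]
  have : ∀ X : ι → Ω, (Set.univ.pi s).indicator (fun X => ∏ i, F i (X i)) X
      = ∏ i, (s i).indicator (F i) (X i) := by
    intro X
    by_cases hX : X ∈ Set.univ.pi s
    · rw [Set.indicator_of_mem hX]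
      exact Finset.prod_congr rfl fun i _ => (Set.indicator_of_mem (hX i trivial) _).symm
    · rw [Set.indicator_of_notMem hX]
      simp only [Set.mem_pi, Set.mem_univ, true_imp_iff, not_forall] at hX
      obtain ⟨i, hi⟩ := hX
      exact (Finset.prod_eq_zero (Finset.mem_univ i) (Set.indicator_of_notMem hi _)).symm
  simp_rw [this]
  rw [lintegral_pi_prod lam fun i => (hF i).indicator (hs i)]
  refine Finset.prod_congr rfl fun i _ => ?_
  rw [lintegral_indicator (hs i), withDensity_apply _ (hs i)]

/-- Change of measure on an event where the likelihood ratio is bounded; the event need not be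
measurable. -/
lemma pi_withDensity_inter_le (lam : ι → Measure Ω) [∀ i, IsProbabilityMeasure (lam i)]
    {F : ι → Ω → ℝ≥0∞} (hF : ∀ i, Measurable (F i))
    [∀ i, IsProbabilityMeasure ((lam i).withDensity (F i))] (E : Set (ι → Ω)) (D : ℝ≥0∞) :
    Measure.pi (fun i => (lam i).withDensity (F i)) (E ∩ {X | ∏ i, F i (X i) ≤ D})
      ≤ D * Measure.pi lam E := by
  rw [pi_withDensity lam hF]
  -- The hull is taken for the measure on the right-hand side, where it costs nothing.
  set E' := toMeasurable (Measure.pi lam) E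
  have hm : Measurable fun X : ι → Ω => ∏ i, F i (X i) :=
    Finset.measurable_prod _ fun i _ => (hF i).comp (measurable_pi_apply i)
  have hG : MeasurableSet {X : ι → Ω | ∏ i, F i (X i) ≤ D} := measurableSet_le hm measurable_const
  have hE' : MeasurableSet E' := measurableSet_toMeasurable _ _
  calc _ ≤ ((Measure.pi lam).withDensity fun X => ∏ i, F i (X i))
        (E' ∩ {X | ∏ i, F i (X i) ≤ D}) :=
        measure_mono (Set.inter_subset_inter_left _ (subset_toMeasurable _ _))
    _ = ∫⁻ X in E' ∩ {X | ∏ i, F i (X i) ≤ D}, ∏ i, F i (X i) ∂Measure.pi lam :=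
        withDensity_apply _ (hE'.inter hG)
    _ ≤ ∫⁻ _ in E' ∩ {X | ∏ i, F i (X i) ≤ D}, D ∂Measure.pi lam :=
        setLIntegral_mono' (hE'.inter hG) fun X hX => hX.2
    _ ≤ D * Measure.pi lam E' := by
        rw [setLIntegral_const]
        gcongr
        exact Set.inter_subset_left
    _ = D * Measure.pi lam E := by rw [measure_toMeasurable]

/-- Exponential Markov inequality for a sum of independent terms. -/
lemma pi_sum_ge_le (ν : ι → Measure Ω) [∀ i, IsProbabilityMeasure (ν i)] {b : ι → Ω → ℝ}
    (hb : ∀ i, Measurable (b i)) (c : ℝ) :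
    Measure.pi ν {X | c ≤ ∑ i, b i (X i)}
      ≤ ENNReal.ofReal (Real.exp (-c)) * ∏ i, ∫⁻ x, ENNReal.ofReal (Real.exp (b i x)) ∂ν i := by
  have hm : ∀ i, Measurable fun x => ENNReal.ofReal (Real.exp (b i x)) := fun i =>
    (Real.measurable_exp.comp (hb i)).ennreal_ofReal
  rw [← lintegral_pi_prod ν hm]
  have h1 := mul_meas_ge_le_lintegral₀ (μ := Measure.pi ν)
    (f := fun X => ∏ i, ENNReal.ofReal (Real.exp (b i (X i))))
    (Finset.measurable_prod _ fun i _ => (hm i).comp (measurable_pi_apply i)).aemeasurable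
    (ENNReal.ofReal (Real.exp c))
  have h2 : {X : ι → Ω | c ≤ ∑ i, b i (X i)} ⊆
      {X | ENNReal.ofReal (Real.exp c) ≤ ∏ i, ENNReal.ofReal (Real.exp (b i (X i)))} := by
    intro X hX
    rw [Set.mem_ofPred_eq, ← ENNReal.ofReal_prod_of_nonneg fun i _ => (Real.exp_pos _).le,
      ← Real.exp_sum]
    exact ENNReal.ofReal_le_ofReal (Real.exp_le_exp.2 hX)
  calc _ = ENNReal.ofReal (Real.exp (-c)) * (ENNReal.ofReal (Real.exp c) *
        Measure.pi ν {X | c ≤ ∑ i, b i (X i)}) := by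
        rw [← mul_assoc, ← ENNReal.ofReal_mul (Real.exp_pos _).le, ← Real.exp_add]
        simp
    _ ≤ _ := by
        gcongr
        exact (mul_le_mul_right (measure_mono h2) _).trans h1

lemma pi_exists_mem_le (ν : ι → Measure Ω) [∀ i, IsProbabilityMeasure (ν i)] (U : Set Ω) :
    Measure.pi ν {X | ∃ i, X i ∈ U} ≤ ∑ i, ν i U := by
  have : {X : ι → Ω | ∃ i, X i ∈ U} ⊆ ⋃ i, Function.eval i ⁻¹' toMeasurable (ν i) U := by
    rintro X ⟨i, hi⟩
    exact Set.mem_iUnion.2 ⟨i, subset_toMeasurable _ _ hi⟩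
  refine (measure_mono this).trans ((measure_iUnion_fintype_le _ _).trans ?_)
  gcongr with i
  rw [(measurePreserving_eval ν i).measure_preimage (measurableSet_toMeasurable _ _).nullMeasurableSet,
    measure_toMeasurable]

end ProductMeasure

/-! ### Exponential integrals and their log-convexity -/

section ExpInt

variable {Ω : Type*} [MeasurableSpace Ω]

/-- `∫ exp(a) dν`, as an extended nonnegative real. -/
def expInt (ν : Measure Ω) (a : Ω → ℝ) : ℝ≥0∞ := ∫⁻ x, ENNReal.ofReal (Real.exp (a x)) ∂ν

/-- The measure with log-density `a` with respect to `ν`. -/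
def expLaw (ν : Measure Ω) (a : Ω → ℝ) : Measure Ω :=
  ν.withDensity fun x => ENNReal.ofReal (Real.exp (a x))

variable {ν : Measure Ω} {a b : Ω → ℝ}

lemma measurable_ofReal_exp (ha : Measurable a) :
    Measurable fun x => ENNReal.ofReal (Real.exp (a x)) :=
  (Real.measurable_exp.comp ha).ennreal_ofReal

lemma isProbabilityMeasure_expLaw (h : expInt ν a = 1) : IsProbabilityMeasure (expLaw ν a) :=
  ⟨by rw [expLaw, withDensity_apply _ MeasurableSet.univ, Measure.restrict_univ]; exact h⟩

lemma expLaw_absolutelyContinuous : expLaw ν a ≪ ν := withDensity_absolutelyContinuous _ _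

lemma lintegral_expLaw (ha : Measurable a) (hb : Measurable b) :
    ∫⁻ x, ENNReal.ofReal (Real.exp (b x)) ∂expLaw ν a = expInt ν (fun x => a x + b x) := by
  rw [expLaw, lintegral_withDensity_eq_lintegral_mul _ (measurable_ofReal_exp ha)
    (measurable_ofReal_exp hb), expInt]
  refine lintegral_congr fun x => ?_
  rw [Pi.mul_apply, ← ENNReal.ofReal_mul (Real.exp_pos _).le, ← Real.exp_add]

lemma expLaw_eq_withDensity_expLaw (ha : Measurable a) (hb : Measurable b) :
    expLaw ν b = (expLaw ν a).withDensity fun x => ENNReal.ofReal (Real.exp (b x - a x)) := by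
  refine Eq.trans ?_ (withDensity_mul ν (measurable_ofReal_exp ha)
    (measurable_ofReal_exp (a := fun x => b x - a x) (hb.sub ha)))
  rw [expLaw]
  congr 1
  funext x
  rw [Pi.mul_apply, ← ENNReal.ofReal_mul (Real.exp_pos _).le, ← Real.exp_add]
  congr 2; ring

lemma expInt_add_const (c : ℝ) :
    expInt ν (fun x => a x + c) = ENNReal.ofReal (Real.exp c) * expInt ν a := by
  rw [expInt, expInt, ← lintegral_const_mul' _ _ ENNReal.ofReal_ne_top]
  refine lintegral_congr fun x => ?_
  rw [← ENNReal.ofReal_mul (Real.exp_pos _).le, ← Real.exp_add, add_comm]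

/-- Hölder's inequality: `a ↦ log ∫ exp(a)` is convex. -/
lemma expInt_convex (ha : Measurable a) (hb : Measurable b) {w v : ℝ} (hw : 0 ≤ w) (hv : 0 ≤ v)
    (hwv : w + v = 1) :
    expInt ν (fun x => w * a x + v * b x) ≤ expInt ν a ^ w * expInt ν b ^ v := by
  refine le_trans (le_of_eq ?_) (ENNReal.lintegral_mul_norm_pow_le
    (measurable_ofReal_exp ha).aemeasurable (measurable_ofReal_exp hb).aemeasurable hw hv hwv)
  refine lintegral_congr fun x => ?_
  rw [ENNReal.ofReal_rpow_of_pos (Real.exp_pos _), ENNReal.ofReal_rpow_of_pos (Real.exp_pos _),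
    ← ENNReal.ofReal_mul (by positivity), ← Real.exp_mul, ← Real.exp_mul, ← Real.exp_add]
  congr 2; ring

/-- Hölder against the zero log-density, whose integral is the total mass one. -/
lemma lintegral_exp_mul_le {P : Measure Ω} [IsProbabilityMeasure P] (hb : Measurable b) {t : ℝ}
    (ht : 0 ≤ t) (ht1 : t ≤ 1) : expInt P (fun x => t * b x) ≤ expInt P b ^ t := by
  have := expInt_convex (ν := P) hb (measurable_const (a := (0 : ℝ))) ht
    (sub_nonneg.2 ht1) (by ring)
  simpa [expInt] using this

end ExpInt

/-! ### Smooth families and Laplace bounds for marginal likelihoods -/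

/-- A compactly parametrised family of log-densities `p t` with respect to a reference
measure `ν`, with a prior density `w`. On the set `G` of full measure the log-densities are
continuous in the parameter, and Lipschitz at small scales with a constant proportional to `S`,
whose tails are negligible at exponential scales. -/
structure SmoothFamily {d : ℕ} (ν : Measure ℝ) (G : Set ℝ) (S : ℝ → ℝ≥0∞) (T : Set (Param d))
    (p : Param d → ℝ → ℝ) (w : Param d → ℝ) : Prop where
  isCompact : IsCompact T
  measurable : ∀ t ∈ T, Measurable (p t)
  expInt_eq_one : ∀ t ∈ T, expInt ν (p t) = 1
  ae_good : ∀ᵐ x ∂ν, x ∈ G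
  continuousOn : ∀ x ∈ G, ContinuousOn (fun t => p t x) T
  lipschitz : ∃ C > 0, ∃ δ > 0, ∀ x ∈ G, ∀ B : ℝ, 0 ≤ B → S x ≤ ENNReal.ofReal B →
    ∀ s ∈ T, ∀ t ∈ T, dist s t < δ → |p s x - p t x| ≤ C * B * dist s t
  volume_ball : ∃ c > 0, ∃ δ > 0, ∀ t ∈ T, ∀ r, 0 < r → r < δ →
    c * r ^ d ≤ volume.real (T ∩ Metric.closedBall t r)
  tail : ∀ ε > 0, ∀ L : ℝ, ∀ᶠ n : ℕ in atTop, ∀ t ∈ T,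
    expLaw ν (p t) {y | ENNReal.ofReal (Real.exp (ε * n)) < S y}
      ≤ ENNReal.ofReal (Real.exp (-(L * n)))
  prior_pos : ∀ t ∈ T, 0 < w t
  prior_continuousOn : ContinuousOn w T
  prior_integral : ∫ t in T, w t = 1

/-- All observations lie in `G`, and `S` is at most `K` at each of them. -/
def GoodSample (G : Set ℝ) (S : ℝ → ℝ≥0∞) (K : ℝ) {n : ℕ} (X : Fin n → ℝ) : Prop :=
  ∀ i, X i ∈ G ∧ S (X i) ≤ ENNReal.ofReal K

lemma GoodSample.mono {G : Set ℝ} {S : ℝ → ℝ≥0∞} {K K' : ℝ} {n : ℕ} {X : Fin n → ℝ}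
    (h : GoodSample G S K X) (hK : K ≤ K') : GoodSample G S K' X :=
  fun i => ⟨(h i).1, (h i).2.trans (ENNReal.ofReal_le_ofReal hK)⟩

/-- The log-likelihood of a sample. -/
def logLik {d : ℕ} (p : Param d → ℝ → ℝ) {n : ℕ} (X : Fin n → ℝ) (t : Param d) : ℝ :=
  ∑ i, p t (X i)

/-- The marginal likelihood in terms of log-densities. -/
def logMarginal {d : ℕ} (T : Set (Param d)) (w : Param d → ℝ) (p : Param d → ℝ → ℝ) {n : ℕ}
    (X : Fin n → ℝ) : ℝ :=
  ∫ t in T, w t * Real.exp (logLik p X t)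

lemma eventually_le_exp {C ε : ℝ} (hε : 0 < ε) : ∀ᶠ n : ℕ in atTop, C ≤ Real.exp (ε * n) := by
  have : Tendsto (fun n : ℕ => Real.exp (ε * n)) atTop atTop :=
    Real.tendsto_exp_atTop.comp (tendsto_natCast_atTop_atTop.const_mul_atTop hε)
  exact this.eventually_ge_atTop C

lemma eventually_mul_le_exp {C ε : ℝ} (hε : 0 < ε) :
    ∀ᶠ n : ℕ in atTop, C * n ≤ Real.exp (ε * n) := by
  filter_upwards [eventually_le_exp (C := |C| / (ε / 2)) (half_pos hε)] with n hn
  have h1 : ε / 2 * n ≤ Real.exp (ε / 2 * n) := by linarith [Real.add_one_le_exp (ε / 2 * n)]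
  have h2 : Real.exp (ε * n) = Real.exp (ε / 2 * n) * Real.exp (ε / 2 * n) := by
    rw [← Real.exp_add]; congr 1; ring
  rw [h2]
  rw [div_le_iff₀ (half_pos hε)] at hn
  calc C * n ≤ |C| * n := by gcongr; exact le_abs_self C
    _ ≤ Real.exp (ε / 2 * n) * (ε / 2) * n := by gcongr
    _ = Real.exp (ε / 2 * n) * (ε / 2 * n) := by ring
    _ ≤ _ := by gcongr

namespace SmoothFamily

variable {d : ℕ} {ν : Measure ℝ} {G : Set ℝ} {S : ℝ → ℝ≥0∞} {T : Set (Param d)}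
  {p : Param d → ℝ → ℝ} {w : Param d → ℝ}

lemma nonempty (hF : SmoothFamily ν G S T p w) : T.Nonempty := by
  by_contra h
  rw [Set.not_nonempty_iff_eq_empty] at h
  have := hF.prior_integral
  simp [h] at this

lemma prior_integrableOn (hF : SmoothFamily ν G S T p w) : IntegrableOn w T :=
  hF.prior_continuousOn.integrableOn_compact hF.isCompact

lemma isProbabilityMeasure (hF : SmoothFamily ν G S T p w) {t : Param d} (ht : t ∈ T) :
    IsProbabilityMeasure (expLaw ν (p t)) :=
  isProbabilityMeasure_expLaw (hF.expInt_eq_one t ht)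

lemma exists_prior_ge (hF : SmoothFamily ν G S T p w) : ∃ m > 0, ∀ t ∈ T, m ≤ w t := by
  obtain ⟨t, ht, hmin⟩ := hF.isCompact.exists_isMinOn hF.nonempty hF.prior_continuousOn
  exact ⟨w t, hF.prior_pos t ht, fun s hs => hmin hs⟩

lemma continuousOn_logLik (hF : SmoothFamily ν G S T p w) {n : ℕ} {X : Fin n → ℝ}
    (hX : ∀ i, X i ∈ G) : ContinuousOn (logLik p X) T :=
  continuousOn_finsetSum _ fun i _ => hF.continuousOn _ (hX i)

lemma integrableOn_likelihood (hF : SmoothFamily ν G S T p w) {n : ℕ} {X : Fin n → ℝ}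
    (hX : ∀ i, X i ∈ G) : IntegrableOn (fun t => w t * Real.exp (logLik p X t)) T :=
  (hF.prior_continuousOn.mul (hF.continuousOn_logLik hX).rexp).integrableOn_compact hF.isCompact

/-- At scale `r`, log-likelihoods of good samples vary by at most one, while small balls and nets
have subexponential prior mass and size. -/
lemma exists_scale (hF : SmoothFamily ν G S T p w) {ε : ℝ} (hε : 0 < ε) :
    ∃ ε₁ > 0, ∀ᶠ n : ℕ in atTop, ∃ r > 0,
      (∀ X : Fin n → ℝ, GoodSample G S (Real.exp (ε₁ * n)) X → ∀ s ∈ T, ∀ t ∈ T, dist s t ≤ r →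
        |logLik p X s - logLik p X t| ≤ 1) ∧
      (∀ t ∈ T, Real.exp (-(ε * n)) ≤ ∫ s in T ∩ Metric.closedBall t r, w s) ∧
      ∃ N : Finset (Param d), ↑N ⊆ T ∧ (N.card : ℝ) ≤ Real.exp (ε * n) ∧
        ∀ t ∈ T, ∃ s ∈ N, dist t s ≤ r := by
  obtain ⟨C, hC, δ, hδ, hlip⟩ := hF.lipschitz
  obtain ⟨c, hc, δ', hδ', hvol⟩ := hF.volume_ball
  obtain ⟨C', hC', hnet⟩ := exists_finset_net hF.isCompact.isBounded
  obtain ⟨m, hm, hw⟩ := hF.exists_prior_ge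
  -- At scale `r = exp(-2κn)` a net has order `exp(2dκn)` points, and since `ε = 2dκ + 2κ` a factor
  -- `exp(2κn)` is left to absorb constants. Gradients up to `exp(κn)` times `r` leave `exp(-κn)`,
  -- which absorbs `C n`.
  set κ : ℝ := ε / (2 * (d + 1)) with hκ
  have hκpos : 0 < κ := by positivity
  have hεκ : ε = 2 * d * κ + 2 * κ := by rw [hκ]; field_simp
  refine ⟨κ, hκpos, ?_⟩
  have h2κ : 0 < 2 * κ := by positivity
  filter_upwards [eventually_le_exp (C := 2 / δ) h2κ, eventually_le_exp (C := 2 / δ') h2κ,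
    eventually_le_exp (C := C') h2κ, eventually_le_exp (C := (m * c)⁻¹) h2κ,
    eventually_mul_le_exp (C := C) hκpos, eventually_le_exp (C := 1) h2κ]
    with n hn1 hn2 hn3 hn4 hn5 hn6
  set r : ℝ := Real.exp (-(2 * κ * n)) with hr
  have hrinv : r⁻¹ = Real.exp (2 * κ * n) := by rw [hr, Real.exp_neg, inv_inv]
  have hrpos : 0 < r := Real.exp_pos _
  have hrlt : ∀ η > 0, 2 / η ≤ Real.exp (2 * κ * n) → r < η := by
    intro η hη h
    rw [← hrinv, div_le_iff₀ hη] at h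
    have : r⁻¹ * r = 1 := inv_mul_cancel₀ hrpos.ne'
    nlinarith [inv_pos.2 hrpos]
  have hpow : Real.exp (ε * n) = r⁻¹ ^ d * Real.exp (2 * κ * n) := by
    rw [hrinv, ← Real.exp_nat_mul, ← Real.exp_add, hεκ]; congr 1; ring
  refine ⟨r, hrpos, ?_, ?_, ?_⟩
  · intro X hX s hs t ht hst
    have hi : ∀ i, |p s (X i) - p t (X i)| ≤ C * Real.exp (κ * n) * r := fun i =>
      (hlip _ (hX i).1 _ (Real.exp_pos _).le (hX i).2 s hs t ht
        (hst.trans_lt (hrlt δ hδ hn1))).trans (by gcongr)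
    calc |logLik p X s - logLik p X t| = |∑ i, (p s (X i) - p t (X i))| := by
          rw [logLik, logLik, Finset.sum_sub_distrib]
      _ ≤ ∑ i : Fin n, C * Real.exp (κ * n) * r :=
          (Finset.abs_sum_le_sum_abs _ _).trans (Finset.sum_le_sum fun i _ => hi i)
      _ = C * n * (Real.exp (κ * n) * r) := by simp; ring
      _ ≤ Real.exp (κ * n) * (Real.exp (κ * n) * r) := by gcongr
      _ = 1 := by
          rw [hr, ← Real.exp_add, ← Real.exp_add, ← Real.exp_zero]; congr 1; ring
  · intro t ht
    have hmeas : MeasurableSet (T ∩ Metric.closedBall t r) :=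
      hF.isCompact.measurableSet.inter Metric.isClosed_closedBall.measurableSet
    have hfin : volume (T ∩ Metric.closedBall t r) ≠ ∞ :=
      ne_top_of_le_ne_top hF.isCompact.measure_lt_top.ne (measure_mono Set.inter_subset_left)
    have h1 : m * volume.real (T ∩ Metric.closedBall t r)
        ≤ ∫ s in T ∩ Metric.closedBall t r, w s := by
      have := setIntegral_mono_on (μ := volume) (integrableOn_const (C := m) hfin)
        (hF.prior_integrableOn.mono_set Set.inter_subset_left) hmeas fun s hs => hw s hs.1
      rwa [setIntegral_const, smul_eq_mul, mul_comm] at this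
    refine le_trans ?_ (le_trans (mul_le_mul_of_nonneg_left
      (hvol t ht r hrpos (hrlt δ' hδ' hn2)) hm.le) h1)
    rw [Real.exp_neg, hpow, mul_inv, inv_pow, inv_inv, ← mul_assoc, mul_comm (m * c)]
    gcongr
    rw [inv_le_comm₀ (Real.exp_pos _) (by positivity)]
    exact hn4
  · obtain ⟨N, hNT, hNc, hN⟩ := hnet r hrpos (by
      rw [← inv_inv r]; exact inv_le_one_of_one_le₀ (hrinv ▸ hn6))
    refine ⟨N, hNT, hNc.trans ?_, hN⟩
    rw [hpow, mul_comm]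
    gcongr

/-- Laplace-type bounds for the marginal likelihood of good samples. -/
lemma exists_laplace (hF : SmoothFamily ν G S T p w) {ε : ℝ} (hε : 0 < ε) :
    ∃ ε₁ > 0, ∀ᶠ n : ℕ in atTop, ∃ N : Finset (Param d), ↑N ⊆ T ∧
      (N.card : ℝ) ≤ Real.exp (ε * n) ∧
      ∀ X : Fin n → ℝ, GoodSample G S (Real.exp (ε₁ * n)) X →
        (∀ t ∈ T, Real.exp (logLik p X t - ε * n) ≤ logMarginal T w p X) ∧
        ∃ t ∈ N, logMarginal T w p X ≤ Real.exp (logLik p X t + ε * n) := by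
  obtain ⟨ε₁, hε₁, h⟩ := hF.exists_scale (half_pos hε)
  refine ⟨ε₁, hε₁, ?_⟩
  have hlarge : ∀ᶠ n : ℕ in atTop, 1 ≤ ε / 2 * n :=
    (tendsto_natCast_atTop_atTop.const_mul_atTop (half_pos hε)).eventually_ge_atTop 1
  filter_upwards [h, hlarge] with n ⟨r, hr, hclose, hmass, N, hNT, hNc, hN⟩ hn
  refine ⟨N, hNT, hNc.trans (Real.exp_le_exp.2 ?_), fun X hX => ⟨fun t ht => ?_, ?_⟩⟩
  · nlinarith
  · have hinteg := hF.integrableOn_likelihood fun i => (hX i).1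
    set V := T ∩ Metric.closedBall t r with hV
    have hVm : MeasurableSet V :=
      hF.isCompact.measurableSet.inter Metric.isClosed_closedBall.measurableSet
    calc Real.exp (logLik p X t - ε * n)
        ≤ Real.exp (-(ε / 2 * n)) * Real.exp (logLik p X t - 1) := by
          rw [← Real.exp_add]; apply Real.exp_le_exp.2; linarith
      _ ≤ (∫ s in V, w s) * Real.exp (logLik p X t - 1) := by gcongr; exact hmass t ht
      _ = ∫ s in V, w s * Real.exp (logLik p X t - 1) := (integral_mul_const _ _).symm
      _ ≤ ∫ s in V, w s * Real.exp (logLik p X s) := by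
          refine setIntegral_mono_on ((hF.prior_integrableOn.mono_set
            Set.inter_subset_left).mul_const _) (hinteg.mono_set Set.inter_subset_left) hVm
            fun s hs => ?_
          have := (abs_le.1 (hclose X hX s hs.1 t ht hs.2)).1
          have h0 := (hF.prior_pos s hs.1).le
          gcongr
          linarith
      _ ≤ logMarginal T w p X := by
          refine setIntegral_mono_set hinteg ?_ Set.inter_subset_left.eventuallyLE
          filter_upwards [ae_restrict_mem hF.isCompact.measurableSet] with s hs
          have := (hF.prior_pos s hs).le
          simp only [Pi.zero_apply]
          positivity
  -- The maximiser depends on the sample; its neighbour lies in a net fixed before the sample, over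
  -- which union bounds are possible, and costs at most one.
  · obtain ⟨t₁, ht₁, hmax⟩ := hF.isCompact.exists_isMaxOn hF.nonempty
      (hF.continuousOn_logLik fun i => (hX i).1)
    obtain ⟨t, htN, htd⟩ := hN t₁ ht₁
    refine ⟨t, htN, ?_⟩
    have hc := (abs_le.1 (hclose X hX t₁ ht₁ t (hNT htN) htd)).2
    calc logMarginal T w p X ≤ ∫ s in T, w s * Real.exp (logLik p X t + ε * n) := by
          refine setIntegral_mono_on (hF.integrableOn_likelihood fun i => (hX i).1)
            (hF.prior_integrableOn.mul_const _) hF.isCompact.measurableSet fun s hs => ?_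
          have h0 := (hF.prior_pos s hs).le
          have : logLik p X s ≤ logLik p X t₁ := hmax hs
          gcongr
          nlinarith
      _ = Real.exp (logLik p X t + ε * n) := by
          rw [integral_mul_const, hF.prior_integral, one_mul]

end SmoothFamily

/-! ### Upper bounds by nets and Chernoff's inequality -/

/-- On good samples, if the marginal likelihood of the second family is at least that of the
first, then the likelihood at some point of a small net nearly dominates the first family. -/
lemma SmoothFamily.exists_net_dominating {dg dh : ℕ} {ν : Measure ℝ} {G : Set ℝ} {S : ℝ → ℝ≥0∞}
    {Θ : Set (Param dg)} {p : Param dg → ℝ → ℝ} {φ : Param dg → ℝ}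
    {Γ : Set (Param dh)} {q : Param dh → ℝ → ℝ} {ψ : Param dh → ℝ}
    (hg : SmoothFamily ν G S Θ p φ) (hh : SmoothFamily ν G S Γ q ψ) {ε : ℝ} (hε : 0 < ε) :
    ∃ ε₁ > 0, ∀ᶠ n : ℕ in atTop, ∃ N : Finset (Param dh), ↑N ⊆ Γ ∧
      (N.card : ℝ) ≤ Real.exp (ε * n) ∧
      ∀ X : Fin n → ℝ, GoodSample G S (Real.exp (ε₁ * n)) X →
        logMarginal Θ φ p X ≤ logMarginal Γ ψ q X → ∀ θ ∈ Θ, ∃ γ ∈ N,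
          -(ε * n) ≤ ∑ i, (q γ (X i) - p θ (X i)) := by
  obtain ⟨ε₁, hε₁, h1⟩ := hg.exists_laplace (half_pos hε)
  obtain ⟨ε₂, hε₂, h2⟩ := hh.exists_laplace (half_pos hε)
  refine ⟨min ε₁ ε₂, lt_min hε₁ hε₂, ?_⟩
  filter_upwards [h1, h2] with n ⟨_, _, _, h1⟩ ⟨N, hN, hNc, h2⟩
  have hn : (0 : ℝ) ≤ n := n.cast_nonneg
  refine ⟨N, hN, hNc.trans (Real.exp_le_exp.2 (by nlinarith)), fun X hX hle θ hθ => ?_⟩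
  have g1 := (h1 X (hX.mono (Real.exp_le_exp.2 (by gcongr; exact min_le_left _ _)))).1 θ hθ
  obtain ⟨γ, hγ, g2⟩ := (h2 X (hX.mono (Real.exp_le_exp.2 (by gcongr; exact min_le_right _ _)))).2
  refine ⟨γ, hγ, ?_⟩
  have := Real.exp_le_exp.1 ((g1.trans hle).trans g2)
  rw [Finset.sum_sub_distrib]
  simp only [logLik] at this
  linarith

lemma pi_not_goodSample_le {ν : Measure ℝ} {G : Set ℝ} {S : ℝ → ℝ≥0∞} (hG : ∀ᵐ x ∂ν, x ∈ G)
    {n : ℕ} (P : Fin n → Measure ℝ) [∀ i, IsProbabilityMeasure (P i)] (hP : ∀ i, P i ≪ ν) {K : ℝ}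
    {b : ℝ≥0∞} (hb : ∀ i, P i {y | ENNReal.ofReal K < S y} ≤ b) :
    Measure.pi P {X | ¬ GoodSample G S K X} ≤ n * b := by
  have h1 : {X : Fin n → ℝ | ¬ GoodSample G S K X}
      ⊆ {X | ∃ i, X i ∈ Gᶜ ∪ {y | ENNReal.ofReal K < S y}} := by
    intro X hX
    simp only [GoodSample, Set.mem_ofPred_eq, not_forall, not_and_or, not_le] at hX
    exact hX
  refine (measure_mono h1).trans ((pi_exists_mem_le P _).trans ?_)
  calc _ ≤ ∑ _i : Fin n, b := by
        gcongr with i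
        refine (measure_union_le _ _).trans ?_
        have : P i Gᶜ = 0 := hP i (mem_ae_iff.1 hG)
        rw [this, zero_add]
        exact hb i
    _ = n * b := by simp

section PairOfFamilies

variable {dg dh : ℕ} {ν : Measure ℝ} {G : Set ℝ} {S : ℝ → ℝ≥0∞}
  {Θ : Set (Param dg)} {p : Param dg → ℝ → ℝ} {φ : Param dg → ℝ}
  {Γ : Set (Param dh)} {q : Param dh → ℝ → ℝ} {ψ : Param dh → ℝ}

/-- The factors of the product are arbitrary because this serves both bounds: the upper one with
identical factors, the lower one with a sample mixed from two laws. Bad samples belong to the event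
so that its complement is both good and decisive. -/
lemma SmoothFamily.exists_net_prob_le (hg : SmoothFamily ν G S Θ p φ)
    (hh : SmoothFamily ν G S Γ q ψ) {ε : ℝ} (hε : 0 < ε) :
    ∃ ε₀ > 0, ∀ ε₁, ε₁ ≤ ε₀ → ∀ᶠ n : ℕ in atTop, ∃ N : Finset (Param dh),
      ↑N ⊆ Γ ∧ (N.card : ℝ) ≤ Real.exp (ε * n) ∧
      ∀ P : Fin n → Measure ℝ, (∀ i, IsProbabilityMeasure (P i)) → (∀ i, P i ≪ ν) → ∀ b : ℝ≥0∞,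
        (∀ i, P i {y | ENNReal.ofReal (Real.exp (ε₁ * n)) < S y} ≤ b) → ∀ θ ∈ Θ,
        Measure.pi P {X | ¬ GoodSample G S (Real.exp (ε₁ * n)) X ∨
            logMarginal Θ φ p X ≤ logMarginal Γ ψ q X}
          ≤ n * b + ∑ γ ∈ N, Measure.pi P {X | -(ε * n) ≤ ∑ i, (q γ (X i) - p θ (X i))} := by
  obtain ⟨ε₀, hε₀, h⟩ := hg.exists_net_dominating hh hε
  refine ⟨ε₀, hε₀, fun ε₁ hε₁ => ?_⟩
  filter_upwards [h] with n ⟨N, hN, hNc, hdom⟩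
  refine ⟨N, hN, hNc, fun P _ hP b hb θ hθ => ?_⟩
  have hsub : {X : Fin n → ℝ | ¬ GoodSample G S (Real.exp (ε₁ * n)) X ∨
      logMarginal Θ φ p X ≤ logMarginal Γ ψ q X}
      ⊆ {X | ¬ GoodSample G S (Real.exp (ε₁ * n)) X}
        ∪ ⋃ γ ∈ N, {X | -(ε * n) ≤ ∑ i, (q γ (X i) - p θ (X i))} := by
    intro X hX
    by_cases hgood : GoodSample G S (Real.exp (ε₁ * n)) X
    · obtain ⟨γ, hγ, hle⟩ := hdom X
        (hgood.mono (Real.exp_le_exp.2 (by gcongr))) (hX.resolve_left (not_not.2 hgood)) θ hθ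
      exact Or.inr (Set.mem_biUnion (Finset.mem_coe.2 hγ) hle)
    · exact Or.inl hgood
  refine (measure_mono hsub).trans ((measure_union_le _ _).trans (add_le_add ?_ ?_))
  · exact pi_not_goodSample_le hg.ae_good P hP hb
  · exact measure_biUnion_finset_le _ _

/-- The error probabilities of the Bayes factor decay at least at the Chernoff rate. -/
theorem SmoothFamily.error_le (hg : SmoothFamily ν G S Θ p φ) (hh : SmoothFamily ν G S Γ q ψ)
    {ρ : ℝ} (hρ : ∀ θ ∈ Θ, ∀ γ ∈ Γ, ∃ z, 0 ≤ z ∧ z ≤ 1 ∧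
      expInt ν (fun x => (1 - z) * p θ x + z * q γ x) ≤ ENNReal.ofReal (Real.exp (-ρ)))
    {ε : ℝ} (hε : 0 < ε) :
    ∀ᶠ n : ℕ in atTop, ∀ θ ∈ Θ, Measure.pi (fun _ : Fin n => expLaw ν (p θ))
      {X | logMarginal Θ φ p X ≤ logMarginal Γ ψ q X}
        ≤ ENNReal.ofReal (Real.exp (-(n * (ρ - ε)))) := by
  have hε4 : 0 < ε / 4 := by positivity
  obtain ⟨ε₁, hε₁, h⟩ := hg.exists_net_prob_le hh hε4
  -- Tails at rate `ρ` suffice: bad samples then contribute no more than the Chernoff bound does.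
  filter_upwards [h ε₁ le_rfl, hg.tail ε₁ hε₁ ρ, eventually_mul_le_exp (C := 1) (half_pos hε),
    eventually_le_exp (C := 2) (half_pos hε)] with n ⟨N, hN, hNc, hbd⟩ htail hn1 hn2 θ hθ
  have hpr := hg.isProbabilityMeasure hθ
  refine (measure_mono fun X hX => Or.inr hX).trans
    ((hbd (fun _ => expLaw ν (p θ)) (fun _ => hpr) (fun _ => expLaw_absolutelyContinuous) _
      (fun _ => htail θ hθ) θ hθ).trans ?_)
  have hterm : ∀ γ ∈ N, Measure.pi (fun _ : Fin n => expLaw ν (p θ))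
      {X | -(ε / 4 * n) ≤ ∑ i, (q γ (X i) - p θ (X i))}
        ≤ ENNReal.ofReal (Real.exp (ε / 4 * n - ρ * n)) := by
    intro γ hγ
    obtain ⟨z, hz0, hz1, hz⟩ := hρ θ hθ γ (hN hγ)
    have hpm := hg.measurable θ hθ
    have hqm := hh.measurable γ (hN hγ)
    have hbm : Measurable fun x => z * (q γ x - p θ x) := (hqm.sub hpm).const_mul z
    have hinteg : ∫⁻ x, ENNReal.ofReal (Real.exp (z * (q γ x - p θ x))) ∂expLaw ν (p θ)
        ≤ ENNReal.ofReal (Real.exp (-ρ)) := by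
      rw [lintegral_expLaw hpm hbm]
      refine le_trans (le_of_eq ?_) hz
      congr 1; funext x; ring
    -- As `0 ≤ z ≤ 1`, the negative threshold remains valid after multiplying the sum by `z`.
    calc _ ≤ Measure.pi (fun _ : Fin n => expLaw ν (p θ))
          {X | -(ε / 4 * n) ≤ ∑ i, z * (q γ (X i) - p θ (X i))} := by
          refine measure_mono fun X hX => ?_
          rw [Set.mem_ofPred_eq] at hX ⊢
          rw [← Finset.mul_sum]
          have : 0 ≤ ε / 4 * n := by positivity
          nlinarith
      _ ≤ ENNReal.ofReal (Real.exp (ε / 4 * n)) * ENNReal.ofReal (Real.exp (-ρ)) ^ n := by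
          refine (pi_sum_ge_le _ (fun _ => hbm) _).trans ?_
          rw [neg_neg, Finset.prod_const, Finset.card_univ, Fintype.card_fin]
          gcongr
      _ = _ := by
          rw [← ENNReal.ofReal_pow (Real.exp_pos _).le, ← ENNReal.ofReal_mul (Real.exp_pos _).le,
            ← Real.exp_nat_mul, ← Real.exp_add]
          congr 2; ring
  calc _ ≤ n * ENNReal.ofReal (Real.exp (-(ρ * n)))
        + N.card * ENNReal.ofReal (Real.exp (ε / 4 * n - ρ * n)) := by
        gcongr
        rw [← nsmul_eq_mul]
        exact Finset.sum_le_card_nsmul _ _ _ hterm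
    _ = ENNReal.ofReal (n * Real.exp (-(ρ * n)) + N.card * Real.exp (ε / 4 * n - ρ * n)) := by
        rw [ENNReal.ofReal_add (by positivity) (by positivity), ENNReal.ofReal_mul (by positivity),
          ENNReal.ofReal_mul (by positivity), ENNReal.ofReal_natCast, ENNReal.ofReal_natCast]
    _ ≤ _ := by
        apply ENNReal.ofReal_le_ofReal
        have e1 : Real.exp (-(n * (ρ - ε)))
            = Real.exp (ε / 2 * n) * Real.exp (ε / 2 * n) * Real.exp (-(ρ * n)) := by
          rw [← Real.exp_add, ← Real.exp_add]; congr 1; ring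
        have e2 : Real.exp (ε / 4 * n) * Real.exp (ε / 4 * n - ρ * n)
            = Real.exp (ε / 2 * n) * Real.exp (-(ρ * n)) := by
          rw [← Real.exp_add, ← Real.exp_add]; congr 1; ring
        calc _ ≤ Real.exp (ε / 2 * n) * Real.exp (-(ρ * n))
              + Real.exp (ε / 4 * n) * Real.exp (ε / 4 * n - ρ * n) := by
              gcongr; linarith
          _ = 2 * Real.exp (ε / 2 * n) * Real.exp (-(ρ * n)) := by rw [e2]; ring
          _ ≤ _ := by rw [e1]; gcongr

end PairOfFamilies

lemma ofReal_exp_mul (a b : ℝ) : ENNReal.ofReal (Real.exp a) * ENNReal.ofReal (Real.exp b)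
    = ENNReal.ofReal (Real.exp (a + b)) := by
  rw [← ENNReal.ofReal_mul (Real.exp_pos _).le, Real.exp_add]

lemma ofReal_exp_rpow (a t : ℝ) :
    ENNReal.ofReal (Real.exp a) ^ t = ENNReal.ofReal (Real.exp (a * t)) := by
  rw [ENNReal.ofReal_rpow_of_pos (Real.exp_pos _), Real.exp_mul]

/-! ### Tilted and truncated laws for the lower bound -/

section Tilting

variable {Ω : Type*} [MeasurableSpace Ω] {ν : Measure Ω} {p₀ q₀ pθ : Ω → ℝ}

/-- Under the tilted law `exp((1-z) p₀ + z q₀ + ρ)`, the likelihood ratio of any competitor whose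
affinity with `q₀` is at most `exp(-ρ)` has small moments growing slower than linearly. -/
lemma expInt_tilt_le (hp : Measurable p₀) (hq : Measurable q₀) (hθ : Measurable pθ)
    {ρ z y s κ κ' u₀ : ℝ} (hz0 : 0 ≤ z) (hz1 : z ≤ 1) (hκ : 0 < κ) (hy : y ≤ 1 - κ)
    (hs0 : 0 ≤ s) (hs : s ≤ κ / 2) (hsu : 2 * s ≤ κ * u₀) (hκ' : 0 ≤ κ')
    (hM : ∀ u, |u - z| ≤ u₀ → expInt ν (fun x => (1 - u) * p₀ x + u * q₀ x)
      ≤ ENNReal.ofReal (Real.exp (-ρ + κ' * |u - z|)))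
    (hyM : expInt ν (fun x => (1 - y) * pθ x + y * q₀ x) ≤ ENNReal.ofReal (Real.exp (-ρ))) :
    expInt ν (fun x => (1 - z) * p₀ x + z * q₀ x + ρ + s * (pθ x - q₀ x))
      ≤ ENNReal.ofReal (Real.exp (κ' * (s / κ))) := by
  have hy1 : 0 < 1 - y := by linarith
  -- The integrand's exponent, less `ρ`, is a convex combination with weights `v` and `w = 1 - v` of
  -- a `(pθ, q₀)` exponent at `y` and a `(p₀, q₀)` exponent at some `u` near `z`; matching
  -- coefficients determines `v` and `u`. In Hölder's inequality the factors `exp(±ρ)` cancel,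
  -- leaving `κ' w |u - z| = κ' (1 - z) v ≤ κ' s / κ`, where stationarity permits arbitrarily small
  -- `κ'`.
  set v := s / (1 - y) with hv
  have hvy : v * (1 - y) = s := by rw [hv]; field_simp
  have hv0 : 0 ≤ v := by positivity
  have hvκ : v ≤ s / κ := by rw [hv]; gcongr; linarith
  have hsκ : s / κ ≤ 1 / 2 := by rw [div_le_iff₀ hκ]; linarith
  have hsκu : 2 * (s / κ) ≤ u₀ := by
    rw [← mul_div_assoc, div_le_iff₀ hκ]; linarith
  set w := 1 - v with hw
  have hwhalf : 1 / 2 ≤ w := by linarith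
  have hwpos : 0 < w := by linarith
  set u := 1 - (1 - z) / w with hu
  have hwu : w * (1 - u) = 1 - z := by rw [hu]; field_simp; ring
  have hzu : w * (z - u) = (1 - z) * v := by
    have : w * (z - u) = w * (1 - u) - w * (1 - z) := by ring
    rw [this, hwu, hw]; ring
  have habs : w * |u - z| = (1 - z) * v := by
    have : w * |u - z| = |w * (z - u)| := by rw [abs_mul, abs_of_pos hwpos, abs_sub_comm]
    rw [this, hzu, abs_of_nonneg (mul_nonneg (by linarith) hv0)]
  have hzv : (1 - z) * v ≤ s / κ := by nlinarith
  have hux : |u - z| ≤ u₀ := by nlinarith [abs_nonneg (u - z)]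
  have hfun : (fun x => (1 - z) * p₀ x + z * q₀ x + ρ + s * (pθ x - q₀ x))
      = fun x => (v * ((1 - y) * pθ x + y * q₀ x) + w * ((1 - u) * p₀ x + u * q₀ x)) + ρ := by
    funext x
    have h1 : v * ((1 - y) * pθ x + y * q₀ x) = s * pθ x + (v - s) * q₀ x := by
      linear_combination (pθ x - q₀ x) * hvy
    have h2 : w * ((1 - u) * p₀ x + u * q₀ x) = (1 - z) * p₀ x + (w - (1 - z)) * q₀ x := by
      linear_combination (p₀ x - q₀ x) * hwu
    rw [h1, h2, hw]; ring
  rw [hfun, expInt_add_const]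
  have hconv := expInt_convex (ν := ν) (a := fun x => (1 - y) * pθ x + y * q₀ x)
    (b := fun x => (1 - u) * p₀ x + u * q₀ x) ((hθ.const_mul _).add (hq.const_mul _))
    ((hp.const_mul _).add (hq.const_mul _)) hv0 hwpos.le (by rw [hw]; ring)
  calc _ ≤ ENNReal.ofReal (Real.exp ρ) * (ENNReal.ofReal (Real.exp (-ρ)) ^ v
        * ENNReal.ofReal (Real.exp (-ρ + κ' * |u - z|)) ^ w) := by
        refine mul_le_mul_right (hconv.trans ?_) _
        gcongr
        exact hM u hux
    _ = ENNReal.ofReal (Real.exp (κ' * (w * |u - z|))) := by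
        rw [ofReal_exp_rpow, ofReal_exp_rpow, ofReal_exp_mul, ofReal_exp_mul]
        congr 2; rw [hw]; ring
    _ ≤ _ := by
        apply ENNReal.ofReal_le_ofReal
        apply Real.exp_le_exp.2
        gcongr
        rw [habs]; exact hzv

/-- The law with log-density `q₀` conditioned on the likelihood ratio being at most `exp K`. -/
def truncLaw (ν : Measure Ω) (p₀ q₀ : Ω → ℝ) (K : ℝ) : Measure Ω :=
  ProbabilityTheory.cond (expLaw ν q₀) {x | q₀ x - p₀ x ≤ K}

/-- Finite log-ratios make the truncation sets exhaust the space. Retaining mass `exp(-ρ/2)` means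
that conditioning costs only half of the exponent `ρ`. -/
lemma exists_truncation (h1 : expInt ν q₀ = 1) {ρ : ℝ}
    (hρ : 0 < ρ) : ∃ K > 0, ENNReal.ofReal (Real.exp (-(ρ / 2)))
      ≤ expLaw ν q₀ {x | q₀ x - p₀ x ≤ K} := by
  have hpr := isProbabilityMeasure_expLaw h1
  have hlim := tendsto_measure_iUnion_atTop (μ := expLaw ν q₀)
    (s := fun k : ℕ => {x | q₀ x - p₀ x ≤ k}) (by
      intro k l hkl x hx
      exact le_trans (b := (k : ℝ)) hx (by exact_mod_cast hkl))
  have huniv : (⋃ k : ℕ, {x | q₀ x - p₀ x ≤ k}) = Set.univ := by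
    refine Set.eq_univ_of_forall fun x => Set.mem_iUnion.2 ?_
    exact exists_nat_ge (q₀ x - p₀ x)
  rw [huniv, measure_univ] at hlim
  have hlt : ENNReal.ofReal (Real.exp (-(ρ / 2))) < 1 := by
    rw [ENNReal.ofReal_lt_one, Real.exp_lt_one_iff]; linarith
  obtain ⟨k, hk, hk1⟩ := ((hlim.eventually_const_lt hlt).and (eventually_gt_atTop 0)).exists
  exact ⟨k, by exact_mod_cast hk1, hk.le⟩

section TruncLaw

variable {K ρ : ℝ}

lemma inv_truncation_le
    (hK : ENNReal.ofReal (Real.exp (-(ρ / 2)))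
      ≤ expLaw ν q₀ {x | q₀ x - p₀ x ≤ K}) :
    (expLaw ν q₀ {x | q₀ x - p₀ x ≤ K})⁻¹ ≤ ENNReal.ofReal (Real.exp (ρ / 2)) := by
  rw [ENNReal.inv_le_iff_inv_le, ← ENNReal.ofReal_inv_of_pos (Real.exp_pos _), ← Real.exp_neg]
  exact hK

lemma isProbabilityMeasure_truncLaw
    (hK : ENNReal.ofReal (Real.exp (-(ρ / 2)))
      ≤ expLaw ν q₀ {x | q₀ x - p₀ x ≤ K}) (h1 : expInt ν q₀ = 1) :
    IsProbabilityMeasure (truncLaw ν p₀ q₀ K) := by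
  have hpr := isProbabilityMeasure_expLaw h1
  refine ProbabilityTheory.cond_isProbabilityMeasure fun h0 => ?_
  rw [h0] at hK
  simp only [nonpos_iff_eq_zero, ENNReal.ofReal_eq_zero] at hK
  exact absurd hK (not_le.2 (Real.exp_pos _))

lemma truncLaw_le
    (hK : ENNReal.ofReal (Real.exp (-(ρ / 2)))
      ≤ expLaw ν q₀ {x | q₀ x - p₀ x ≤ K}) : truncLaw ν p₀ q₀ K ≤ ENNReal.ofReal (Real.exp (ρ / 2)) • expLaw ν q₀ := by
  refine Measure.le_iff.2 fun s _ => ?_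
  rw [truncLaw, ProbabilityTheory.cond, Measure.smul_apply, Measure.smul_apply, smul_eq_mul,
    smul_eq_mul]
  exact mul_le_mul' (inv_truncation_le hK) (Measure.restrict_apply_le _ _)

lemma truncLaw_absolutelyContinuous
    (hK : ENNReal.ofReal (Real.exp (-(ρ / 2)))
      ≤ expLaw ν q₀ {x | q₀ x - p₀ x ≤ K}) : truncLaw ν p₀ q₀ K ≪ ν :=
  (Measure.absolutelyContinuous_of_le_smul (truncLaw_le hK)).trans expLaw_absolutelyContinuous

/-- The purpose of truncating: the likelihood ratio of an observation from this law is bounded, with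
no moment condition on `q₀ - p₀` under `q₀`. -/
lemma truncLaw_eq_withDensity
    (hK : ENNReal.ofReal (Real.exp (-(ρ / 2)))
      ≤ expLaw ν q₀ {x | q₀ x - p₀ x ≤ K}) (hp : Measurable p₀) (hq : Measurable q₀) :
    ∃ F : Ω → ℝ≥0∞, Measurable F ∧ (∀ x, F x ≤ ENNReal.ofReal (Real.exp (K + ρ / 2))) ∧
      truncLaw ν p₀ q₀ K = (expLaw ν p₀).withDensity F := by
  have hB : MeasurableSet {x | q₀ x - p₀ x ≤ K} := measurableSet_le (hq.sub hp) measurable_const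
  set c := (expLaw ν q₀ {x | q₀ x - p₀ x ≤ K})⁻¹ with hc
  have hm := measurable_ofReal_exp (a := fun x => q₀ x - p₀ x) (hq.sub hp)
  refine ⟨c • {x | q₀ x - p₀ x ≤ K}.indicator
    fun x => ENNReal.ofReal (Real.exp (q₀ x - p₀ x)), (hm.indicator hB).const_smul c, ?_, ?_⟩
  · intro x
    rw [Pi.smul_apply, smul_eq_mul, add_comm, ← ofReal_exp_mul]
    refine mul_le_mul' (inv_truncation_le hK) ?_
    refine Set.indicator_apply_le' (fun hx => ?_) fun _ => zero_le
    exact ENNReal.ofReal_le_ofReal (Real.exp_le_exp.2 hx)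
  · rw [withDensity_smul _ (hm.indicator hB), withDensity_indicator hB, truncLaw,
      ProbabilityTheory.cond, expLaw_eq_withDensity_expLaw hp hq, restrict_withDensity hB]
    rw [hc, expLaw_eq_withDensity_expLaw hp hq]

lemma expInt_truncLaw_le
    (hK : ENNReal.ofReal (Real.exp (-(ρ / 2)))
      ≤ expLaw ν q₀ {x | q₀ x - p₀ x ≤ K}) (hq : Measurable q₀) {b : Ω → ℝ} (hb : Measurable b) :
    expInt (truncLaw ν p₀ q₀ K) b
      ≤ ENNReal.ofReal (Real.exp (ρ / 2)) * expInt ν (fun x => q₀ x + b x) := by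
  refine (lintegral_mono' (truncLaw_le hK) le_rfl).trans (le_of_eq ?_)
  rw [lintegral_smul_measure, lintegral_expLaw hq hb, smul_eq_mul]

/-- At order `1 - y` the moment is an affinity, at most `exp(-ρ)`, times the conditioning cost
`exp(ρ/2)`. Jensen's inequality passes to smaller orders `s`. -/
lemma expInt_truncLaw_competitor_le
    (hK : ENNReal.ofReal (Real.exp (-(ρ / 2)))
      ≤ expLaw ν q₀ {x | q₀ x - p₀ x ≤ K}) (h1 : expInt ν q₀ = 1) (hq : Measurable q₀)
    (hθ : Measurable pθ) {y s : ℝ} (hρ : 0 ≤ ρ) (hy0 : 0 ≤ y) (hs0 : 0 ≤ s) (hs : s ≤ 1 - y)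
    (hy1 : y < 1)
    (hyM : expInt ν (fun x => (1 - y) * pθ x + y * q₀ x) ≤ ENNReal.ofReal (Real.exp (-ρ))) :
    expInt (truncLaw ν p₀ q₀ K) (fun x => s * (pθ x - q₀ x))
      ≤ ENNReal.ofReal (Real.exp (-(s * (ρ / 2)))) := by
  have hpr := isProbabilityMeasure_truncLaw hK h1
  have hy1' : 0 < 1 - y := by linarith
  set t := s / (1 - y) with ht
  have ht0 : 0 ≤ t := by positivity
  have ht1 : t ≤ 1 := by rw [ht, div_le_one hy1']; exact hs
  have hty : t * (1 - y) = s := by rw [ht]; field_simp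
  have hbm : Measurable fun x => (1 - y) * (pθ x - q₀ x) := (hθ.sub hq).const_mul _
  have hfun : (fun x => s * (pθ x - q₀ x)) = fun x => t * ((1 - y) * (pθ x - q₀ x)) := by
    funext x; rw [← mul_assoc, hty]
  have hbase : expInt (truncLaw ν p₀ q₀ K) (fun x => (1 - y) * (pθ x - q₀ x))
      ≤ ENNReal.ofReal (Real.exp (-(ρ / 2))) := by
    refine (expInt_truncLaw_le hK hq hbm).trans ?_
    have : (fun x => q₀ x + (1 - y) * (pθ x - q₀ x)) = fun x => (1 - y) * pθ x + y * q₀ x := by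
      funext x; ring
    rw [this]
    refine (mul_le_mul_right hyM _).trans ?_
    rw [ofReal_exp_mul]
    apply ENNReal.ofReal_le_ofReal (Real.exp_le_exp.2 (by linarith))
  rw [hfun]
  refine (lintegral_exp_mul_le hbm ht0 ht1).trans ((ENNReal.rpow_le_rpow hbase ht0).trans ?_)
  rw [ofReal_exp_rpow]
  apply ENNReal.ofReal_le_ofReal (Real.exp_le_exp.2 _)
  have : s ≤ t := by nlinarith
  nlinarith

end TruncLaw

/-- A weighted geometric mean is at most the maximum, hence at most the sum. This transfers the tail
bounds for `S` from the two families to the tilted law. -/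
lemma tilt_le {ρ z : ℝ} (hp : Measurable p₀) (hz0 : 0 ≤ z) (hz1 : z ≤ 1) :
    expLaw ν (fun x => (1 - z) * p₀ x + z * q₀ x + ρ)
      ≤ ENNReal.ofReal (Real.exp ρ) • (expLaw ν p₀ + expLaw ν q₀) := by
  rw [expLaw, expLaw, expLaw, ← withDensity_add_left (measurable_ofReal_exp hp),
    ← withDensity_smul' _ _ ENNReal.ofReal_ne_top]
  refine withDensity_mono (Eventually.of_forall fun x => ?_)
  simp only [Pi.smul_apply, Pi.add_apply, smul_eq_mul]
  rw [← ENNReal.ofReal_add (Real.exp_pos _).le (Real.exp_pos _).le,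
    ← ENNReal.ofReal_mul (Real.exp_pos _).le]
  apply ENNReal.ofReal_le_ofReal
  rw [Real.exp_add, mul_comm]
  gcongr
  rcases le_total (p₀ x) (q₀ x) with h | h
  · have : (1 - z) * p₀ x + z * q₀ x ≤ q₀ x := by nlinarith
    linarith [Real.exp_le_exp.2 this, Real.exp_pos (p₀ x)]
  · have : (1 - z) * p₀ x + z * q₀ x ≤ p₀ x := by nlinarith
    linarith [Real.exp_le_exp.2 this, Real.exp_pos (q₀ x)]

/-- Exponential Markov inequality for a sample whose first `m` observations have law `Q` and whose
other observations have law `R`. -/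
lemma pi_block_sum_ge_le {Q R : Measure Ω} [IsProbabilityMeasure Q] [IsProbabilityMeasure R]
    {b₁ b₂ : Ω → ℝ} (hb₁ : Measurable b₁) (hb₂ : Measurable b₂) {β₁ β₂ : ℝ}
    (h₁ : expInt Q b₁ ≤ ENNReal.ofReal (Real.exp β₁))
    (h₂ : expInt R b₂ ≤ ENNReal.ofReal (Real.exp β₂)) {n m : ℕ} (hmn : m ≤ n)
    (P : Fin n → Measure Ω) (hP : ∀ i, P i = if (i : ℕ) < m then Q else R) (c : ℝ) :
    Measure.pi P {X | c ≤ ∑ i : Fin n, (if (i : ℕ) < m then b₁ else b₂) (X i)}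
      ≤ ENNReal.ofReal (Real.exp (-c + (m * β₁ + (n - m) * β₂))) := by
  have hpr : ∀ i, IsProbabilityMeasure (P i) := fun i => by
    rw [hP]; split_ifs <;> infer_instance
  refine (pi_sum_ge_le P (b := fun i => if (i : ℕ) < m then b₁ else b₂) (fun i => ?_) c).trans ?_
  · split_ifs <;> assumption
  rw [← ofReal_exp_mul]
  refine mul_le_mul_right ?_ _
  calc _ ≤ ∏ i : Fin n, ENNReal.ofReal (Real.exp (if (i : ℕ) < m then β₁ else β₂)) := by
        refine Finset.prod_le_prod' fun i _ => ?_
        rw [hP]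
        split_ifs
        · exact h₁
        · exact h₂
    _ = _ := by
        rw [← ENNReal.ofReal_prod_of_nonneg fun i _ => (Real.exp_pos _).le, ← Real.exp_sum]
        congr 2
        rw [Fin.sum_univ_eq_sum_range (fun i => if i < m then β₁ else β₂) n,
          ← Finset.sum_range_add_sum_Ico _ hmn,
          Finset.sum_congr rfl (g := fun _ => β₁) fun i hi => if_pos (Finset.mem_range.1 hi),
          Finset.sum_congr rfl (g := fun _ => β₂) fun i hi =>
            if_neg (not_lt.2 (Finset.mem_Ico.1 hi).1)]
        simp [Nat.cast_sub hmn]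

end Tilting

/-! ### Lower bounds by change of measure -/

section LowerBound

variable {dg dh : ℕ} {ν : Measure ℝ} {G : Set ℝ} {S : ℝ → ℝ≥0∞}
  {Θ : Set (Param dg)} {p : Param dg → ℝ → ℝ} {φ : Param dg → ℝ}
  {Γ : Set (Param dh)} {q : Param dh → ℝ → ℝ} {ψ : Param dh → ℝ}

set_option maxHeartbeats 2000000 in
/-- Lower bound for the probability of a wrong decision under the least favourable member of the
first family, by a change of measure to a law under which most observations are tilted half-way
between `p θ₀` and `q γ₀`, and a small proportion is drawn from a truncation of `q γ₀`. -/
lemma SmoothFamily.exists_error_ge_of_leastFavourable (hg : SmoothFamily ν G S Θ p φ)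
    (hh : SmoothFamily ν G S Γ q ψ) {θ₀ : Param dg} {γ₀ : Param dh} (hθ₀ : θ₀ ∈ Θ) (hγ₀ : γ₀ ∈ Γ)
    {ρ z : ℝ} (hρ : 0 < ρ) (hz0 : 0 ≤ z) (hz1 : z ≤ 1)
    (hM : expInt ν (fun x => (1 - z) * p θ₀ x + z * q γ₀ x) = ENNReal.ofReal (Real.exp (-ρ)))
    (hderiv : ∀ κ > 0, ∃ u₀ > 0, ∀ u, |u - z| ≤ u₀ →
      expInt ν (fun x => (1 - u) * p θ₀ x + u * q γ₀ x)
        ≤ ENNReal.ofReal (Real.exp (-ρ + κ * |u - z|)))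
    (hsep : ∃ κ > 0, ∀ θ ∈ Θ, ∃ y, 0 ≤ y ∧ y ≤ 1 - κ ∧
      expInt ν (fun x => (1 - y) * p θ x + y * q γ₀ x) ≤ ENNReal.ofReal (Real.exp (-ρ)))
    {τ : ℝ} (hτ : 0 < τ) :
    ∃ ε₀ > 0, ∀ ε₁, 0 < ε₁ → ε₁ ≤ ε₀ → ∀ᶠ n : ℕ in atTop,
      ENNReal.ofReal (Real.exp (-(n * (ρ + 2 * τ)))) ≤
        Measure.pi (fun _ : Fin n => expLaw ν (p θ₀))
          {X | GoodSample G S (Real.exp (ε₁ * n)) X ∧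
            logMarginal Θ φ p X < logMarginal Γ ψ q X} := by
  have hp₀ := hg.measurable θ₀ hθ₀
  have hq₀ := hh.measurable γ₀ hγ₀
  have hq1 := hh.expInt_eq_one γ₀ hγ₀
  have hprp := hg.isProbabilityMeasure hθ₀
  obtain ⟨κ, hκ, hsep⟩ := hsep
  have hκ1 : κ ≤ 1 := by
    obtain ⟨y, h1, h2, -⟩ := hsep θ₀ hθ₀
    linarith
  obtain ⟨K, hK, htr⟩ := exists_truncation (p₀ := p θ₀) hq1 hρ
  set K' : ℝ := K + ρ / 2 with hK'
  have hK'pos : 0 < K' := by positivity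
  -- `a` is the proportion of truncated observations. Each has likelihood ratio at most `exp K'`, so
  -- together they cost about `exp(τn/4)` at most.
  set a : ℝ := min (1 / 2) (τ / (4 * K')) with ha
  have hapos : 0 < a := lt_min (by norm_num) (by positivity)
  have ha1 : a ≤ 1 / 2 := min_le_left _ _
  have haK : a * K' ≤ τ / 4 := by
    have : a ≤ τ / (4 * K') := min_le_right _ _
    calc a * K' ≤ τ / (4 * K') * K' := by gcongr
      _ = τ / 4 := by field_simp
  -- The first bound limits the likelihood cost of the tilted block; the second keeps its drift
  -- below half of the gain `a ρ / 2` of the truncated block.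
  set κ' : ℝ := min (τ / 4) (κ * ρ * a / 4) with hκ'
  have hκ'pos : 0 < κ' := lt_min (by positivity) (by positivity)
  have hκ'τ : κ' ≤ τ / 4 := min_le_left _ _
  have hκ'κ : κ' / κ ≤ ρ * a / 4 := by
    rw [div_le_iff₀ hκ]
    exact (min_le_right _ _).trans (le_of_eq (by ring))
  obtain ⟨u₀, hu₀, hMu⟩ := hderiv κ' hκ'pos
  set s : ℝ := min (κ / 2) (κ * u₀ / 2) with hs
  have hspos : 0 < s := lt_min (by positivity) (by positivity)
  have hsκ : s ≤ κ / 2 := min_le_left _ _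
  have hsu : 2 * s ≤ κ * u₀ := by linarith [min_le_right (κ / 2) (κ * u₀ / 2)]
  have hs1 : s ≤ 1 := by linarith
  have hsu₀ : s ≤ u₀ := by nlinarith
  -- In the exponent, in units of `ε n`, the tilted block gives at most `4`, the truncated block at
  -- most `-8`, the threshold at most `1`. The total `-3` survives a union over `exp(ε n)` net
  -- points.
  set ε : ℝ := s * ρ * a / 16 with hε
  have hεpos : 0 < ε := by positivity
  -- The families are exchanged: the net lies in `Θ`, and the fixed `γ₀` has to beat all of it.
  obtain ⟨ε₀, hε₀, hnet⟩ := hh.exists_net_prob_le hg hεpos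
  refine ⟨ε₀, hε₀, fun ε₁ hε₁pos hε₁ => ?_⟩
  have hsτ : 0 < s * τ / 2 := by positivity
  have hsep8 : 0 < s * ρ * a / 8 := by positivity
  filter_upwards [hnet ε₁ hε₁, hg.tail ε₁ hε₁pos 1, hh.tail ε₁ hε₁pos 1,
    eventually_mul_le_exp (C := 16 * Real.exp ρ) one_pos, eventually_le_exp (C := 8) hsep8,
    eventually_le_exp (C := 4 * Real.exp (s * K')) hsτ, eventually_le_exp (C := 2) hτ]
    with n ⟨N, hN, hNc, hbd⟩ htg hth hn1 hn2 hn3 hn4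
  -- the twisted laws
  set tilt : ℝ → ℝ := fun x => (1 - z) * p θ₀ x + z * q γ₀ x + ρ with htilt
  have htiltm : Measurable tilt := ((hp₀.const_mul _).add (hq₀.const_mul _)).add_const _
  set Q := expLaw ν tilt with hQ
  set R := truncLaw ν (p θ₀) (q γ₀) K with hR
  have hQ1 : expInt ν tilt = 1 := by
    rw [htilt, expInt_add_const (a := fun x => (1 - z) * p θ₀ x + z * q γ₀ x), hM, ofReal_exp_mul]
    simp
  have hQpr : IsProbabilityMeasure Q := isProbabilityMeasure_expLaw hQ1
  have hRpr : IsProbabilityMeasure R := isProbabilityMeasure_truncLaw htr hq1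
  obtain ⟨FR, hFRm, hFRle, hFR⟩ := truncLaw_eq_withDensity htr hp₀ hq₀
  set FQ : ℝ → ℝ≥0∞ := fun x => ENNReal.ofReal (Real.exp (tilt x - p θ₀ x)) with hFQ
  have hFQm : Measurable FQ := measurable_ofReal_exp (htiltm.sub hp₀)
  set m : ℕ := ⌊(1 - a) * n⌋₊ with hm
  have hn0 : (0 : ℝ) ≤ n := n.cast_nonneg
  have hmle : (m : ℝ) ≤ (1 - a) * n := Nat.floor_le (mul_nonneg (by linarith) hn0)
  have hmge : (1 - a) * n < m + 1 := Nat.lt_floor_add_one _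
  have hm0 : (0 : ℝ) ≤ m := m.cast_nonneg
  have hmn : m ≤ n := by
    have : (m : ℝ) ≤ n := hmle.trans (by nlinarith)
    exact_mod_cast this
  have hmn' : (m : ℝ) ≤ n := by exact_mod_cast hmn
  set F : Fin n → ℝ → ℝ≥0∞ := fun i => if (i : ℕ) < m then FQ else FR with hF
  have hFm : ∀ i, Measurable (F i) := fun i => by
    rw [hF]; dsimp only; split_ifs <;> assumption
  set P : Fin n → Measure ℝ := fun i => (expLaw ν (p θ₀)).withDensity (F i) with hP
  have hPif : ∀ i, P i = if (i : ℕ) < m then Q else R := fun i => by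
    simp only [hP, hF]
    split_ifs
    · rw [hQ, expLaw_eq_withDensity_expLaw hp₀ htiltm]
    · rw [hR, hFR]
  have hPpr : ∀ i, IsProbabilityMeasure (P i) := fun i => by
    rw [hPif]; split_ifs <;> assumption
  have hPac : ∀ i, P i ≪ ν := fun i => by
    rw [hPif]; split_ifs
    · exact expLaw_absolutelyContinuous
    · exact truncLaw_absolutelyContinuous htr
  set A : Set (Fin n → ℝ) := {X | GoodSample G S (Real.exp (ε₁ * n)) X ∧
    logMarginal Θ φ p X < logMarginal Γ ψ q X} with hA
  set D : ℝ := n * (ρ + τ) with hD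
  -- the decision is wrong with large probability
  have hE1 : Measure.pi P Aᶜ ≤ ENNReal.ofReal (1 / 4) := by
    have hsub : Aᶜ ⊆ {X | ¬ GoodSample G S (Real.exp (ε₁ * n)) X ∨
        logMarginal Γ ψ q X ≤ logMarginal Θ φ p X} := by
      intro X hX
      rw [hA, Set.mem_compl_iff, Set.mem_ofPred_eq, not_and_or, not_lt] at hX
      exact hX
    have htail : ∀ i, P i {y | ENNReal.ofReal (Real.exp (ε₁ * n)) < S y}
        ≤ ENNReal.ofReal (2 * Real.exp ρ * Real.exp (-n)) := by
      intro i
      have h1 := htg θ₀ hθ₀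
      have h2 := hth γ₀ hγ₀
      rw [one_mul] at h1 h2
      rw [hPif]
      split_ifs
      · refine (tilt_le (ν := ν) (q₀ := q γ₀) (ρ := ρ) hp₀ hz0 hz1 _).trans ?_
        rw [Measure.smul_apply, Measure.add_apply, smul_eq_mul, mul_assoc, mul_comm (2 : ℝ),
          mul_assoc, ENNReal.ofReal_mul (Real.exp_pos _).le, mul_two,
          ENNReal.ofReal_add (Real.exp_pos _).le (Real.exp_pos _).le]
        gcongr
      · refine (truncLaw_le htr _).trans ?_
        rw [Measure.smul_apply, smul_eq_mul, ENNReal.ofReal_mul (by positivity)]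
        gcongr
        have : Real.exp (ρ / 2) ≤ Real.exp ρ := Real.exp_le_exp.2 (by linarith)
        linarith [Real.exp_pos ρ]
    refine (measure_mono hsub).trans ((hbd P hPpr hPac _ htail γ₀ hγ₀).trans ?_)
    have hterm : ∀ θ ∈ N, Measure.pi P {X | -(ε * n) ≤ ∑ i, (p θ (X i) - q γ₀ (X i))}
        ≤ ENNReal.ofReal (Real.exp (-(3 * ε * n))) := by
      intro θ hθN
      have hθ := hN hθN
      have hpθ := hg.measurable θ hθ
      obtain ⟨y, hy0, hy1, hyM⟩ := hsep θ hθ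
      have hbm : Measurable fun x => s * (p θ x - q γ₀ x) := (hpθ.sub hq₀).const_mul s
      have hA1 : expInt Q (fun x => s * (p θ x - q γ₀ x))
          ≤ ENNReal.ofReal (Real.exp (κ' * (s / κ))) := by
        rw [expInt, hQ, lintegral_expLaw htiltm hbm]
        exact expInt_tilt_le hp₀ hq₀ hpθ hz0 hz1 hκ hy1 hspos.le hsκ hsu hκ'pos.le hMu hyM
      have hA2 : expInt R (fun x => s * (p θ x - q γ₀ x))
          ≤ ENNReal.ofReal (Real.exp (-(s * (ρ / 2)))) :=
        expInt_truncLaw_competitor_le htr hq1 hq₀ hpθ hρ.le hy0 hspos.le (by linarith)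
          (by linarith) hyM
      have hblock := pi_block_sum_ge_le hbm hbm hA1 hA2 hmn P hPif (-(s * (ε * n)))
      simp only [ite_self] at hblock
      refine (measure_mono fun X hX => ?_).trans (hblock.trans
        (ENNReal.ofReal_le_ofReal (Real.exp_le_exp.2 ?_)))
      · rw [Set.mem_ofPred_eq] at hX ⊢
        rw [← Finset.mul_sum]
        linarith [mul_le_mul_of_nonneg_left hX hspos.le]
      · have hx1 : κ' * (s / κ) = s * (κ' / κ) := by ring
        have hx2 : (m : ℝ) * (s * (κ' / κ)) ≤ n * (s * (ρ * a / 4)) := by gcongr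
        have hx3 : a * n * (s * (ρ / 2)) ≤ (n - m) * (s * (ρ / 2)) := by
          gcongr; linarith
        have hx4 : s * (ε * n) ≤ ε * n := by
          have : 0 ≤ ε * n := by positivity
          exact mul_le_of_le_one_left this hs1
        have hx5 : s * ρ * a = 16 * ε := by rw [hε]; ring
        rw [hx1]
        have hx6 : (n : ℝ) * (s * (ρ * a / 4)) = 4 * ε * n := by linear_combination n / 4 * hx5
        have hx7 : a * n * (s * (ρ / 2)) = 8 * ε * n := by linear_combination n / 2 * hx5
        linarith
    calc _ ≤ n * ENNReal.ofReal (2 * Real.exp ρ * Real.exp (-n))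
          + N.card * ENNReal.ofReal (Real.exp (-(3 * ε * n))) := by
          gcongr
          rw [← nsmul_eq_mul]
          exact Finset.sum_le_card_nsmul _ _ _ hterm
      _ = ENNReal.ofReal (n * (2 * Real.exp ρ * Real.exp (-n))
            + N.card * Real.exp (-(3 * ε * n))) := by
          rw [ENNReal.ofReal_add (by positivity) (by positivity),
            ENNReal.ofReal_mul (p := (n : ℝ)) (by positivity), ENNReal.ofReal_mul (p := (N.card : ℝ))
            (by positivity), ENNReal.ofReal_natCast, ENNReal.ofReal_natCast]
      _ ≤ _ := by
          apply ENNReal.ofReal_le_ofReal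
          have e1 : n * (2 * Real.exp ρ * Real.exp (-n)) ≤ 1 / 8 := by
            rw [one_mul] at hn1
            rw [Real.exp_neg, ← mul_assoc, ← div_eq_mul_inv, div_le_iff₀ (Real.exp_pos _)]
            linarith
          have e2 : N.card * Real.exp (-(3 * ε * n)) ≤ 1 / 8 := by
            calc N.card * Real.exp (-(3 * ε * n)) ≤ Real.exp (ε * n) * Real.exp (-(3 * ε * n)) := by
                  gcongr
              _ = (Real.exp (s * ρ * a / 8 * n))⁻¹ := by
                  rw [← Real.exp_add, ← Real.exp_neg, hε]; congr 1; ring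
              _ ≤ 1 / 8 := by
                  rw [one_div]; exact inv_anti₀ (by norm_num) hn2
          linarith
  -- the likelihood ratio is not too large
  have hE2 : Measure.pi P {X | ∏ i, F i (X i) ≤ ENNReal.ofReal (Real.exp D)}ᶜ
      ≤ ENNReal.ofReal (1 / 4) := by
    -- Under the tilted law this moment is an affinity at `z + s z`, up to the normalisation `exp((1
    -- + s) ρ)`, so stationarity at `z` bounds it.
    set f₁ : ℝ → ℝ := fun x => s * (tilt x - p θ₀ x) with hf₁
    have hf₁m : Measurable f₁ := (htiltm.sub hp₀).const_mul s
    have hA1 : expInt Q f₁ ≤ ENNReal.ofReal (Real.exp (s * (ρ + κ'))) := by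
      rw [expInt, hQ, lintegral_expLaw htiltm hf₁m]
      have hfun : (fun x => tilt x + f₁ x) = fun x => ((1 - (z + s * z)) * p θ₀ x
          + (z + s * z) * q γ₀ x) + (1 + s) * ρ := by
        funext x; simp only [hf₁, htilt]; ring
      have hsz : |z + s * z - z| = s * z := by
        rw [add_sub_cancel_left, abs_of_nonneg (by positivity)]
      have hszs : s * z ≤ s := mul_le_of_le_one_right hspos.le hz1
      have hκsz := mul_le_mul_of_nonneg_left hszs hκ'pos.le
      rw [hfun, expInt_add_const]
      refine (mul_le_mul_right (hMu (z + s * z) (by rw [hsz]; linarith)) _).trans ?_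
      rw [ofReal_exp_mul, hsz]
      apply ENNReal.ofReal_le_ofReal (Real.exp_le_exp.2 _)
      linarith
    have hA2 : expInt R (fun _ => s * K') ≤ ENNReal.ofReal (Real.exp (s * K')) := by
      rw [expInt, lintegral_const, measure_univ, mul_one]
    have hblock := pi_block_sum_ge_le hf₁m measurable_const hA1 hA2 hmn P hPif (s * D)
    refine (measure_mono fun X hX => ?_).trans (hblock.trans (ENNReal.ofReal_le_ofReal ?_))
    · rw [Set.mem_compl_iff, Set.mem_ofPred_eq, not_le] at hX
      have hle : ∏ i, F i (X i) ≤ ∏ i : Fin n, ENNReal.ofReal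
          (Real.exp (if (i : ℕ) < m then tilt (X i) - p θ₀ (X i) else K')) := by
        refine Finset.prod_le_prod' fun i _ => ?_
        simp only [hF]
        split_ifs
        · exact le_rfl
        · exact hFRle _
      rw [← ENNReal.ofReal_prod_of_nonneg fun i _ => (Real.exp_pos _).le, ← Real.exp_sum] at hle
      have h3 := (ENNReal.ofReal_lt_ofReal_iff (Real.exp_pos _)).1 (hX.trans_le hle)
      rw [Real.exp_lt_exp] at h3
      rw [Set.mem_ofPred_eq]
      calc s * D ≤ s * ∑ i : Fin n, (if (i : ℕ) < m then tilt (X i) - p θ₀ (X i) else K') := by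
            gcongr
        _ = _ := by
            rw [Finset.mul_sum]
            refine Finset.sum_congr rfl fun i _ => ?_
            split_ifs <;> rfl
    -- Rounding in `m` may add one truncated observation beyond `a n`; its cost `K'` is absorbed for
    -- large `n`.
    · have hx : -(s * D) + (m * (s * (ρ + κ')) + (n - m) * (s * K')) ≤ s * K' - s * τ / 2 * n := by
        have h1 : (m : ℝ) * (ρ + κ') ≤ n * (ρ + τ / 4) := by gcongr
        have h2 : ((n : ℝ) - m) * K' ≤ (a * n + 1) * K' := by gcongr; linarith
        have h3 : (a * n + 1) * K' ≤ τ / 4 * n + K' := by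
          calc (a * n + 1) * K' = a * K' * n + K' := by ring
            _ ≤ _ := by gcongr
        have h4 : (m : ℝ) * (ρ + κ') + (n - m) * K' ≤ n * (ρ + τ) - τ / 2 * n + K' := by linarith
        calc _ = s * (-D + (m * (ρ + κ') + (n - m) * K')) := by ring
          _ ≤ s * (K' - τ / 2 * n) := by gcongr; rw [hD]; linarith
          _ = _ := by ring
      calc _ ≤ Real.exp (s * K' - s * τ / 2 * n) := Real.exp_le_exp.2 hx
        _ = Real.exp (s * K') / Real.exp (s * τ / 2 * n) := Real.exp_sub _ _
        _ ≤ 1 / 4 := by rw [div_le_iff₀ (Real.exp_pos _)]; linarith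
  have hhalf : ENNReal.ofReal (1 / 2) ≤
      Measure.pi P (A ∩ {X | ∏ i, F i (X i) ≤ ENNReal.ofReal (Real.exp D)}) := by
    set B := {X : Fin n → ℝ | ∏ i, F i (X i) ≤ ENNReal.ofReal (Real.exp D)}
    -- `A` is not known to be measurable, so subadditivity of the outer measure replaces taking
    -- complements.
    have hcov : Set.univ ⊆ A ∩ B ∪ (Aᶜ ∪ Bᶜ) := fun X _ => by
      by_cases h1 : X ∈ A <;> by_cases h2 : X ∈ B <;> simp [h1, h2]
    have h1 : (1 : ℝ≥0∞) ≤ Measure.pi P (A ∩ B) + ENNReal.ofReal (1 / 2) := by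
      calc (1 : ℝ≥0∞) = Measure.pi P Set.univ := measure_univ.symm
        _ ≤ Measure.pi P (A ∩ B) + (Measure.pi P Aᶜ + Measure.pi P Bᶜ) :=
            (measure_mono hcov).trans ((measure_union_le _ _).trans
              (add_le_add_right (measure_union_le _ _) _))
        _ ≤ Measure.pi P (A ∩ B) + (ENNReal.ofReal (1 / 4) + ENNReal.ofReal (1 / 4)) := by gcongr
        _ = _ := by rw [← ENNReal.ofReal_add (by norm_num) (by norm_num)]; norm_num
    have h2 := tsub_le_iff_right.2 h1
    rw [← ENNReal.ofReal_one, ← ENNReal.ofReal_sub _ (by norm_num)] at h2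
    norm_num at h2 ⊢
    exact h2
  have hchange := hhalf.trans (pi_withDensity_inter_le (fun _ : Fin n => expLaw ν (p θ₀)) hFm A
    (ENNReal.ofReal (Real.exp D)))
  calc ENNReal.ofReal (Real.exp (-(n * (ρ + 2 * τ))))
      ≤ ENNReal.ofReal (Real.exp (-D)) * ENNReal.ofReal (1 / 2) := by
        rw [← ENNReal.ofReal_mul (Real.exp_pos _).le]
        apply ENNReal.ofReal_le_ofReal
        have : Real.exp (-(n * (ρ + 2 * τ))) = Real.exp (-D) * (Real.exp (τ * n))⁻¹ := by
          rw [← Real.exp_neg, ← Real.exp_add, hD]; congr 1; ring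
        rw [this, one_div]
        gcongr
    _ ≤ ENNReal.ofReal (Real.exp (-D)) * (ENNReal.ofReal (Real.exp D) *
        Measure.pi (fun _ : Fin n => expLaw ν (p θ₀)) A) := by gcongr
    _ = _ := by rw [← mul_assoc, ofReal_exp_mul]; simp

/-- The error probabilities of the Bayes factor near a least favourable parameter decay at most at
the Chernoff rate. -/
theorem SmoothFamily.exists_ball_error_ge (hg : SmoothFamily ν G S Θ p φ)
    (hh : SmoothFamily ν G S Γ q ψ) {θ₀ : Param dg} {γ₀ : Param dh} (hθ₀ : θ₀ ∈ Θ) (hγ₀ : γ₀ ∈ Γ)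
    {ρ z : ℝ} (hρ : 0 < ρ) (hz0 : 0 ≤ z) (hz1 : z ≤ 1)
    (hM : expInt ν (fun x => (1 - z) * p θ₀ x + z * q γ₀ x) = ENNReal.ofReal (Real.exp (-ρ)))
    (hderiv : ∀ κ > 0, ∃ u₀ > 0, ∀ u, |u - z| ≤ u₀ →
      expInt ν (fun x => (1 - u) * p θ₀ x + u * q γ₀ x)
        ≤ ENNReal.ofReal (Real.exp (-ρ + κ * |u - z|)))
    (hsep : ∃ κ > 0, ∀ θ ∈ Θ, ∃ y, 0 ≤ y ∧ y ≤ 1 - κ ∧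
      expInt ν (fun x => (1 - y) * p θ x + y * q γ₀ x) ≤ ENNReal.ofReal (Real.exp (-ρ)))
    {τ : ℝ} (hτ : 0 < τ) :
    ∀ᶠ n : ℕ in atTop, ∃ r > 0,
      Real.exp (-(τ * n)) ≤ ∫ s in Θ ∩ Metric.closedBall θ₀ r, φ s ∧
      ∀ θ ∈ Θ, dist θ θ₀ ≤ r → ENNReal.ofReal (Real.exp (-(n * (ρ + τ)))) ≤
        Measure.pi (fun _ : Fin n => expLaw ν (p θ))
          {X | logMarginal Θ φ p X < logMarginal Γ ψ q X} := by
  have hτ4 : 0 < τ / 4 := by positivity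
  obtain ⟨ε₀, hε₀, hlow⟩ :=
    hg.exists_error_ge_of_leastFavourable hh hθ₀ hγ₀ hρ hz0 hz1 hM hderiv hsep hτ4
  obtain ⟨ε₂, hε₂, hscale⟩ := hg.exists_scale hτ
  filter_upwards [hlow (min ε₀ ε₂) (lt_min hε₀ hε₂) (min_le_left _ _), hscale,
    eventually_le_exp (C := Real.exp 1) (half_pos hτ)] with n hn ⟨r, hr, hclose, hmass, _⟩ hn2
  have hn0 : (0 : ℝ) ≤ n := n.cast_nonneg
  refine ⟨r, hr, hmass θ₀ hθ₀, fun θ hθ hd => ?_⟩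
  have hpr := hg.isProbabilityMeasure hθ
  have hpr₀ := hg.isProbabilityMeasure hθ₀
  have hpθ := hg.measurable θ hθ
  have hp₀ := hg.measurable θ₀ hθ₀
  have heq := expLaw_eq_withDensity_expLaw (ν := ν) hpθ hp₀
  set A : Set (Fin n → ℝ) := {X | GoodSample G S (Real.exp (min ε₀ ε₂ * n)) X ∧
    logMarginal Θ φ p X < logMarginal Γ ψ q X}
  have hprd : IsProbabilityMeasure ((expLaw ν (p θ)).withDensity
      fun x => ENNReal.ofReal (Real.exp (p θ₀ x - p θ x))) := heq ▸ hpr₀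
  have hch := pi_withDensity_inter_le (fun _ : Fin n => expLaw ν (p θ))
    (F := fun _ x => ENNReal.ofReal (Real.exp (p θ₀ x - p θ x)))
    (fun _ => measurable_ofReal_exp (hp₀.sub hpθ)) A (ENNReal.ofReal (Real.exp 1))
  -- On good samples the likelihoods at `θ` and `θ₀` differ by a factor of at most `exp 1`; this is
  -- why goodness was kept in the event `A`.
  have hAeq : A ∩ {X | ∏ i, ENNReal.ofReal (Real.exp (p θ₀ (X i) - p θ (X i)))
      ≤ ENNReal.ofReal (Real.exp 1)} = A := by
    refine Set.inter_eq_left.2 fun X hX => ?_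
    rw [Set.mem_ofPred_eq, ← ENNReal.ofReal_prod_of_nonneg fun i _ => (Real.exp_pos _).le,
      ← Real.exp_sum, Finset.sum_sub_distrib]
    apply ENNReal.ofReal_le_ofReal (Real.exp_le_exp.2 _)
    have := (abs_le.1 (hclose X (hX.1.mono (Real.exp_le_exp.2 (by
      gcongr; exact min_le_right _ _))) θ hθ θ₀ hθ₀ hd)).1
    simp only [logLik] at this
    linarith
  rw [hAeq] at hch
  simp only [← heq] at hch
  calc ENNReal.ofReal (Real.exp (-(n * (ρ + τ))))
      ≤ ENNReal.ofReal (Real.exp (-1)) *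
        ENNReal.ofReal (Real.exp (-(n * (ρ + 2 * (τ / 4))))) := by
        rw [ofReal_exp_mul]
        apply ENNReal.ofReal_le_ofReal (Real.exp_le_exp.2 _)
        have := Real.exp_le_exp.1 hn2
        linarith
    _ ≤ ENNReal.ofReal (Real.exp (-1)) * (ENNReal.ofReal (Real.exp 1) *
        Measure.pi (fun _ : Fin n => expLaw ν (p θ)) A) := by
        gcongr
        exact hn.trans hch
    _ = Measure.pi (fun _ : Fin n => expLaw ν (p θ)) A := by
        rw [← mul_assoc, ofReal_exp_mul]; simp
    _ ≤ _ := measure_mono fun X hX => hX.2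

end LowerBound

/-! ### Affinities: range, continuity, stationarity -/

section Affinity

variable {Ω : Type*} [MeasurableSpace Ω] {ν : Measure Ω}

/-- The affinity `∫ exp((1-z) a + z b) dν` of two log-densities. -/
def affinity (ν : Measure Ω) (a b : Ω → ℝ) (z : ℝ) : ℝ≥0∞ :=
  expInt ν (fun x => (1 - z) * a x + z * b x)

lemma affinity_symm (a b : Ω → ℝ) (z : ℝ) : affinity ν b a (1 - z) = affinity ν a b z := by
  unfold affinity; congr 1; funext x; ring

lemma affinity_zero (a b : Ω → ℝ) : affinity ν a b 0 = expInt ν a := by simp [affinity]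

lemma affinity_one (a b : Ω → ℝ) : affinity ν a b 1 = expInt ν b := by simp [affinity]

lemma affinity_eq_lintegral {a b : Ω → ℝ} (ha : Measurable a) (hb : Measurable b) (z : ℝ) :
    affinity ν a b z = ∫⁻ x, ENNReal.ofReal (Real.exp (z * (b x - a x))) ∂expLaw ν a := by
  rw [lintegral_expLaw (b := fun x => z * (b x - a x)) ha ((hb.sub ha).const_mul z), affinity]
  congr 1; funext x; ring

lemma affinity_le_one {a b : Ω → ℝ} (ha : Measurable a) (hb : Measurable b)
    (ha1 : expInt ν a = 1) (hb1 : expInt ν b = 1) {z : ℝ} (hz0 : 0 ≤ z) (hz1 : z ≤ 1) :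
    affinity ν a b z ≤ 1 := by
  have := expInt_convex (ν := ν) ha hb (sub_nonneg.2 hz1) hz0 (by ring)
  rwa [ha1, hb1, ENNReal.one_rpow, ENNReal.one_rpow, one_mul] at this

/-- Outside the unit interval, affinities of probability densities are at least one. -/
lemma one_le_affinity_of_one_lt {a b : Ω → ℝ} (ha : Measurable a) (hb : Measurable b)
    (ha1 : expInt ν a = 1) (hb1 : expInt ν b = 1) {z : ℝ} (hz : 1 < z) :
    1 ≤ affinity ν a b z := by
  have hz0 : 0 < z := by linarith
  -- For `z > 1`, `b` itself lies between `a` and `(1 - z) a + z b`, so log-convexity bounds the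
  -- affinity from below.
  have h := expInt_convex (ν := ν) (b := fun x => (1 - z) * a x + z * b x) (w := 1 - z⁻¹)
    (v := z⁻¹) ha ((ha.const_mul _).add (hb.const_mul _))
    (sub_nonneg.2 (inv_le_one_of_one_le₀ hz.le)) (by positivity) (by ring)
  have hfun : (fun x => (1 - z⁻¹) * a x + z⁻¹ * ((1 - z) * a x + z * b x)) = b := by
    funext x; field_simp; ring
  rw [hfun, ha1, hb1, ENNReal.one_rpow, one_mul] at h
  by_contra! hlt
  exact absurd h (not_le.2 (ENNReal.rpow_lt_one hlt (by positivity)))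

lemma one_le_affinity_of_neg {a b : Ω → ℝ} (ha : Measurable a) (hb : Measurable b)
    (ha1 : expInt ν a = 1) (hb1 : expInt ν b = 1) {z : ℝ} (hz : z < 0) :
    1 ≤ affinity ν a b z := by
  rw [← affinity_symm]
  exact one_le_affinity_of_one_lt hb ha hb1 ha1 (by linarith)

lemma affinity_pos [NeZero ν] {a b : Ω → ℝ} (ha : Measurable a) (hb : Measurable b) (z : ℝ) :
    0 < affinity ν a b z := by
  have hm : Measurable fun x => (1 - z) * a x + z * b x := (ha.const_mul _).add (hb.const_mul _)
  rw [affinity, expInt, lintegral_pos_iff_support (measurable_ofReal_exp hm)]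
  have : Function.support (fun x => ENNReal.ofReal (Real.exp ((1 - z) * a x + z * b x)))
      = Set.univ := by
    ext x; simp [Real.exp_pos]
  rw [this]
  exact Measure.measure_univ_pos.2 (NeZero.ne ν)

/-- A strict form of the arithmetic-geometric mean inequality for densities. -/
lemma affinity_half_lt_one {a b : Ω → ℝ} (ha : Measurable a) (hb : Measurable b)
    (ha1 : expInt ν a = 1) (hb1 : expInt ν b = 1) (hne : ¬ a =ᵐ[ν] b) :
    affinity ν a b (1 / 2) < 1 := by
  refine lt_of_le_of_ne (affinity_le_one ha hb ha1 hb1 (by norm_num) (by norm_num)) fun heq => ?_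
  apply hne
  have key : ∀ x, Real.exp ((1 - 1 / 2) * a x + 1 / 2 * b x)
      = Real.exp (a x / 2) * Real.exp (b x / 2) := fun x => by
    rw [← Real.exp_add]; congr 1; ring
  have hsq : ∀ y : ℝ, Real.exp y = Real.exp (y / 2) ^ 2 := fun y => by
    rw [← Real.exp_nat_mul]; congr 1; push_cast; ring
  have hle : ∀ x, Real.exp ((1 - 1 / 2) * a x + 1 / 2 * b x)
      ≤ 1 / 2 * Real.exp (a x) + 1 / 2 * Real.exp (b x) := fun x => by
    rw [key, hsq (a x), hsq (b x)]
    nlinarith [sq_nonneg (Real.exp (a x / 2) - Real.exp (b x / 2))]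
  have hmean : ∫⁻ x, ENNReal.ofReal (1 / 2 * Real.exp (a x) + 1 / 2 * Real.exp (b x)) ∂ν = 1 := by
    have h1 : ∀ x, ENNReal.ofReal (1 / 2 * Real.exp (a x) + 1 / 2 * Real.exp (b x))
        = ENNReal.ofReal (1 / 2) * ENNReal.ofReal (Real.exp (a x))
          + ENNReal.ofReal (1 / 2) * ENNReal.ofReal (Real.exp (b x)) := fun x => by
      rw [ENNReal.ofReal_add (by positivity) (by positivity), ENNReal.ofReal_mul (by norm_num),
        ENNReal.ofReal_mul (by norm_num)]
    simp_rw [h1]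
    rw [lintegral_add_left ((measurable_ofReal_exp ha).const_mul _),
      lintegral_const_mul _ (measurable_ofReal_exp ha),
      lintegral_const_mul _ (measurable_ofReal_exp hb)]
    rw [expInt] at ha1 hb1
    rw [ha1, hb1, mul_one, ← ENNReal.ofReal_add (by norm_num) (by norm_num)]
    norm_num
  -- The geometric mean is below the arithmetic mean and has the same finite integral, so they agree
  -- almost everywhere; equality in the inequality of means gives `a = b`.
  have hae := ae_eq_of_ae_le_of_lintegral_le (μ := ν)
    (f := fun x => ENNReal.ofReal (Real.exp ((1 - 1 / 2) * a x + 1 / 2 * b x)))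
    (g := fun x => ENNReal.ofReal (1 / 2 * Real.exp (a x) + 1 / 2 * Real.exp (b x)))
    (Eventually.of_forall fun x => ENNReal.ofReal_le_ofReal (hle x))
    (by rw [affinity, expInt] at heq; rw [heq]; exact ENNReal.one_ne_top)
    (((Real.measurable_exp.comp ha).const_mul _).add
      ((Real.measurable_exp.comp hb).const_mul _)).ennreal_ofReal.aemeasurable
    (by rw [affinity, expInt] at heq; rw [heq, hmean])
  filter_upwards [hae] with x hx
  have hx' := (ENNReal.ofReal_eq_ofReal_iff (by positivity) (by positivity)).1 hx
  rw [key, hsq (a x), hsq (b x)] at hx'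
  have h0 : (Real.exp (a x / 2) - Real.exp (b x / 2)) ^ 2 = 0 := by linarith
  have h1 := Real.exp_injective (sub_eq_zero.1 (pow_eq_zero_iff two_ne_zero |>.1 h0))
  linarith

/-- Affinities depend continuously on log-densities (pointwise a.e. convergence) and exponent,
since the integrands are dominated by sums of probability densities. -/
lemma continuous_affinity {E : Type*} [TopologicalSpace E] [FirstCountableTopology E]
    {a b : E → Ω → ℝ} {z : E → ℝ} (ha : ∀ e, Measurable (a e)) (hb : ∀ e, Measurable (b e))
    (ha1 : ∀ e, expInt ν (a e) = 1) (hb1 : ∀ e, expInt ν (b e) = 1)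
    (hz0 : ∀ e, 0 ≤ z e) (hz1 : ∀ e, z e ≤ 1) (hz : Continuous z)
    (hac : ∀ᵐ x ∂ν, Continuous fun e => a e x) (hbc : ∀ᵐ x ∂ν, Continuous fun e => b e x) :
    Continuous fun e => affinity ν (a e) (b e) (z e) := by
  set f : E → Ω → ℝ := fun e x => Real.exp ((1 - z e) * a e x + z e * b e x) with hf
  -- Dominated convergence with a moving majorant: Fatou for `f` gives lower semicontinuity, and
  -- Fatou for `g ≥ 0` gives upper semicontinuity because `∫ f + ∫ g = 2` for every `e`.
  set g : E → Ω → ℝ := fun e x => Real.exp (a e x) + Real.exp (b e x) - f e x with hg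
  have hfm : ∀ e, Measurable (f e) := fun e =>
    Real.measurable_exp.comp (((ha e).const_mul _).add ((hb e).const_mul _))
  have hgm : ∀ e, Measurable (g e) := fun e =>
    ((Real.measurable_exp.comp (ha e)).add (Real.measurable_exp.comp (hb e))).sub (hfm e)
  have hg0 : ∀ e x, 0 ≤ g e x := by
    intro e x
    rw [hg, sub_nonneg]
    rcases le_total (a e x) (b e x) with h | h
    · have : (1 - z e) * a e x + z e * b e x ≤ b e x := by nlinarith [hz0 e, hz1 e]
      linarith [Real.exp_le_exp.2 this, Real.exp_pos (a e x)]
    · have : (1 - z e) * a e x + z e * b e x ≤ a e x := by nlinarith [hz0 e, hz1 e]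
      linarith [Real.exp_le_exp.2 this, Real.exp_pos (b e x)]
  have hsum : ∀ e, ∫⁻ x, ENNReal.ofReal (f e x) ∂ν + ∫⁻ x, ENNReal.ofReal (g e x) ∂ν = 2 := by
    intro e
    rw [← lintegral_add_left (hfm e).ennreal_ofReal]
    have : ∀ x, ENNReal.ofReal (f e x) + ENNReal.ofReal (g e x)
        = ENNReal.ofReal (Real.exp (a e x)) + ENNReal.ofReal (Real.exp (b e x)) := fun x => by
      rw [← ENNReal.ofReal_add (Real.exp_pos _).le (hg0 e x),
        ← ENNReal.ofReal_add (Real.exp_pos _).le (Real.exp_pos _).le]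
      congr 1; rw [hg]; ring
    simp_rw [this]
    rw [lintegral_add_left (measurable_ofReal_exp (ha e))]
    have h1 := ha1 e
    have h2 := hb1 e
    rw [expInt] at h1 h2
    rw [h1, h2]; norm_num
  have hne : ∀ e, ∫⁻ x, ENNReal.ofReal (g e x) ∂ν ≠ ∞ := fun e h => by
    have := hsum e; rw [h] at this; simp at this
  have hfatou : ∀ k : E → Ω → ℝ, (∀ e, Measurable (k e)) →
      (∀ᵐ x ∂ν, Continuous fun e => k e x) → ∀ e₀,
      ∫⁻ x, ENNReal.ofReal (k e₀ x) ∂ν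
        ≤ liminf (fun e => ∫⁻ x, ENNReal.ofReal (k e x) ∂ν) (𝓝 e₀) := by
    intro k hk hkc e₀
    refine le_trans (le_of_eq (lintegral_congr_ae ?_))
      (lintegral_liminf_le fun e => (hk e).ennreal_ofReal)
    filter_upwards [hkc] with x hx
    exact ((ENNReal.continuous_ofReal.comp hx).tendsto e₀).liminf_eq.symm
  have hfc : ∀ᵐ x ∂ν, Continuous fun e => f e x := by
    filter_upwards [hac, hbc] with x h1 h2
    exact (((continuous_const.sub hz).mul h1).add (hz.mul h2)).rexp
  have hgc : ∀ᵐ x ∂ν, Continuous fun e => g e x := by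
    filter_upwards [hac, hbc, hfc] with x h1 h2 h3
    exact (h1.rexp.add h2.rexp).sub h3
  refine continuous_iff_continuousAt.2 fun e₀ => ?_
  refine tendsto_of_le_liminf_of_limsup_le (hfatou f hfm hfc e₀) ?_
  have heq : (fun e => affinity ν (a e) (b e) (z e))
      = fun e => 2 - ∫⁻ x, ENNReal.ofReal (g e x) ∂ν := by
    funext e
    rw [← hsum e, ENNReal.add_sub_cancel_right (hne e)]
    rfl
  have h2 : (2 : ℝ≥0∞) ≠ ∞ := by norm_num
  have hsub : 2 - liminf (fun e => ∫⁻ x, ENNReal.ofReal (g e x) ∂ν) (𝓝 e₀)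
      ≤ 2 - ∫⁻ x, ENNReal.ofReal (g e₀ x) ∂ν := tsub_le_tsub_left (hfatou g hgm hgc e₀) 2
  rw [heq, ENNReal.limsup_const_sub _ _ h2]
  exact hsub

/-- At an interior minimiser the affinity is stationary. -/
lemma exists_affinity_le_of_isMin {a b : Ω → ℝ} (ha : Measurable a) (hb : Measurable b)
    (ha1 : expInt ν a = 1) (hb1 : expInt ν b = 1) {z ρ : ℝ} (hz0 : 0 < z) (hz1 : z < 1)
    (hz : affinity ν a b z = ENNReal.ofReal (Real.exp (-ρ)))
    (hmin : ∀ u, affinity ν a b z ≤ affinity ν a b u) {κ : ℝ} (hκ : 0 < κ) :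
    ∃ u₀ > 0, ∀ u, |u - z| ≤ u₀ →
      affinity ν a b u ≤ ENNReal.ofReal (Real.exp (-ρ + κ * |u - z|)) := by
  have hpr := isProbabilityMeasure_expLaw ha1
  set P := expLaw ν a
  set l : Ω → ℝ := fun x => b x - a x with hl
  have hlm : Measurable l := hb.sub ha
  have hinteg : Set.Icc (0 : ℝ) 1 ⊆ ProbabilityTheory.integrableExpSet l P := by
    intro u hu
    refine (lintegral_ofReal_ne_top_iff_integrable
      (Real.measurable_exp.comp (hlm.const_mul u)).aestronglyMeasurable
      (Eventually.of_forall fun x => (Real.exp_pos _).le)).1 ?_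
    have := affinity_le_one ha hb ha1 hb1 hu.1 hu.2
    rw [affinity_eq_lintegral ha hb] at this
    exact ne_top_of_le_ne_top ENNReal.one_ne_top this
  have haff : ∀ u ∈ Set.Icc (0 : ℝ) 1,
      affinity ν a b u = ENNReal.ofReal (ProbabilityTheory.mgf l P u) := by
    intro u hu
    rw [affinity_eq_lintegral ha hb]
    exact (ofReal_integral_eq_lintegral_ofReal (hinteg hu)
      (Eventually.of_forall fun x => (Real.exp_pos _).le)).symm
  have hnhds : Set.Icc (0 : ℝ) 1 ∈ 𝓝 z := Icc_mem_nhds hz0 hz1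
  have hzI : z ∈ Set.Icc (0 : ℝ) 1 := ⟨hz0.le, hz1.le⟩
  have hmz : ProbabilityTheory.mgf l P z = Real.exp (-ρ) := by
    rw [haff z hzI] at hz
    exact (ENNReal.ofReal_eq_ofReal_iff ProbabilityTheory.mgf_nonneg (Real.exp_pos _).le).1 hz
  -- `z` is interior to the set of finite moments, so the moment generating function is
  -- differentiable there; its derivative vanishes at the minimum and the increment is `o(|u - z|)`.
  have hder := ProbabilityTheory.hasDerivAt_mgf (X := l) (μ := P)
    (mem_interior_iff_mem_nhds.2 (mem_of_superset hnhds hinteg))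
  have hloc : IsLocalMin (ProbabilityTheory.mgf l P) z := by
    filter_upwards [hnhds] with u hu
    have := hmin u
    rw [haff z hzI, haff u hu] at this
    exact (ENNReal.ofReal_le_ofReal_iff ProbabilityTheory.mgf_nonneg).1 this
  rw [hloc.hasDerivAt_eq_zero hder] at hder
  have ho := hder.isLittleO.bound (c := κ * Real.exp (-ρ)) (by positivity)
  obtain ⟨δ, hδ, hball⟩ := Metric.eventually_nhds_iff.1 (ho.and hnhds)
  refine ⟨δ / 2, half_pos hδ, fun u hu => ?_⟩
  obtain ⟨h1, h2⟩ := hball (y := u) (by rw [Real.dist_eq]; linarith)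
  rw [haff u h2]
  apply ENNReal.ofReal_le_ofReal
  simp only [smul_zero, sub_zero, Real.norm_eq_abs, hmz] at h1
  have h3 := (abs_le.1 h1).2
  rw [Real.exp_add]
  have h4 := Real.add_one_le_exp (κ * |u - z|)
  nlinarith [Real.exp_pos (-ρ)]

end Affinity

/-! ### The least favourable pair -/

section LeastFavourable

variable {dg dh : ℕ} {ν : Measure ℝ} {G : Set ℝ} {S : ℝ → ℝ≥0∞}
  {Θ : Set (Param dg)} {p : Param dg → ℝ → ℝ} {φ : Param dg → ℝ}
  {Γ : Set (Param dh)} {q : Param dh → ℝ → ℝ} {ψ : Param dh → ℝ}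

/-- The pair of parameters that is hardest to distinguish. -/
theorem SmoothFamily.exists_leastFavourable [NeZero ν] (hg : SmoothFamily ν G S Θ p φ)
    (hh : SmoothFamily ν G S Γ q ψ)
    (hne : ∀ θ ∈ Θ, ∀ γ ∈ Γ, affinity ν (p θ) (q γ) (1 / 2) < 1) :
    ∃ θ₀ ∈ Θ, ∃ γ₀ ∈ Γ, ∃ z ρ : ℝ, 0 < z ∧ z < 1 ∧ 0 < ρ ∧
      affinity ν (p θ₀) (q γ₀) z = ENNReal.ofReal (Real.exp (-ρ)) ∧
      (∀ u, affinity ν (p θ₀) (q γ₀) z ≤ affinity ν (p θ₀) (q γ₀) u) ∧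
      ∃ κ > 0, ∀ θ ∈ Θ, ∀ γ ∈ Γ, ∃ y, κ ≤ y ∧ y ≤ 1 - κ ∧
        affinity ν (p θ) (q γ) y ≤ ENNReal.ofReal (Real.exp (-ρ)) := by
  have hΘc := isCompact_iff_compactSpace.1 hg.isCompact
  have hΓc := isCompact_iff_compactSpace.1 hh.isCompact
  have hΘn := hg.nonempty.to_subtype
  have hΓn := hh.nonempty.to_subtype
  set aff : (Θ × Γ) × unitInterval → ℝ≥0∞ :=
    fun e => affinity ν (p e.1.1) (q e.1.2) e.2 with haff
  have hcont : Continuous aff := by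
    refine continuous_affinity (fun e => hg.measurable _ e.1.1.2)
      (fun e => hh.measurable _ e.1.2.2) (fun e => hg.expInt_eq_one _ e.1.1.2)
      (fun e => hh.expInt_eq_one _ e.1.2.2) (fun e => e.2.2.1) (fun e => e.2.2.2)
      (continuous_subtype_val.comp continuous_snd) ?_ ?_
    · filter_upwards [hg.ae_good] with x hx
      exact (continuousOn_iff_continuous_domRestrict.1 (hg.continuousOn x hx)).comp
        (continuous_fst.comp continuous_fst)
    · filter_upwards [hh.ae_good] with x hx
      exact (continuousOn_iff_continuous_domRestrict.1 (hh.continuousOn x hx)).comp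
        (continuous_snd.comp continuous_fst)
  -- An infimum of continuous functions is upper semicontinuous, which suffices for its maximum over
  -- pairs to be attained.
  have husc : UpperSemicontinuous fun x : Θ × Γ => ⨅ z, aff (x, z) :=
    upperSemicontinuous_iInf fun z =>
      (hcont.comp (Continuous.prodMk_left z)).upperSemicontinuous
  obtain ⟨⟨θ₀, γ₀⟩, -, hmax⟩ := (husc.upperSemicontinuousOn Set.univ).exists_isMaxOn
    Set.univ_nonempty isCompact_univ
  have hminz : ∀ x : Θ × Γ, ∃ z, ∀ u, aff (x, z) ≤ aff (x, u) := fun x => by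
    obtain ⟨z, -, hz⟩ := isCompact_univ.exists_isMinOn Set.univ_nonempty
      (hcont.comp (Continuous.prodMk_right x)).continuousOn
    exact ⟨z, fun u => hz (Set.mem_univ u)⟩
  obtain ⟨z, hz⟩ := hminz (θ₀, γ₀)
  have hpm := hg.measurable _ θ₀.2
  have hqm := hh.measurable _ γ₀.2
  have hp1 := hg.expInt_eq_one _ θ₀.2
  have hq1 := hh.expInt_eq_one _ γ₀.2
  have hlt1 : aff ((θ₀, γ₀), z) < 1 :=
    (hz ⟨1 / 2, by norm_num, by norm_num⟩).trans_lt (hne _ θ₀.2 _ γ₀.2)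
  have hpos : 0 < aff ((θ₀, γ₀), z) := affinity_pos hpm hqm _
  have hMz : aff ((θ₀, γ₀), z) = ENNReal.ofReal (aff ((θ₀, γ₀), z)).toReal :=
    (ENNReal.ofReal_toReal (hlt1.trans ENNReal.one_lt_top).ne).symm
  have hrpos : 0 < (aff ((θ₀, γ₀), z)).toReal :=
    ENNReal.toReal_pos hpos.ne' (hlt1.trans ENNReal.one_lt_top).ne
  have hr1 : (aff ((θ₀, γ₀), z)).toReal < 1 := by
    have := (ENNReal.toReal_lt_toReal (hlt1.trans ENNReal.one_lt_top).ne ENNReal.one_ne_top).2 hlt1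
    simpa using this
  set ρ : ℝ := -Real.log (aff ((θ₀, γ₀), z)).toReal with hρ
  have hexp : Real.exp (-ρ) = (aff ((θ₀, γ₀), z)).toReal := by
    rw [hρ, neg_neg, Real.exp_log hrpos]
  rw [← hexp] at hMz
  have hall : ∀ x : Θ × Γ, ∃ u, aff (x, u) ≤ ENNReal.ofReal (Real.exp (-ρ)) := by
    intro x
    obtain ⟨u, hu⟩ := hminz x
    refine ⟨u, ?_⟩
    rw [← hMz]
    calc aff (x, u) ≤ ⨅ u, aff (x, u) := le_iInf hu
      _ ≤ ⨅ u, aff ((θ₀, γ₀), u) := hmax (Set.mem_univ x)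
      _ ≤ _ := iInf_le _ _
  have hendpoint : ∀ (x : Θ × Γ) (u : unitInterval),
      aff (x, u) ≤ ENNReal.ofReal (Real.exp (-ρ)) → 0 < (u : ℝ) ∧ (u : ℝ) < 1 := by
    intro x u hu
    rw [← hMz] at hu
    have hu1 := (hu.trans_lt hlt1).ne
    constructor
    · refine lt_of_le_of_ne u.2.1 fun h0 => hu1 ?_
      simp only [haff]
      rw [← h0, affinity_zero, hg.expInt_eq_one _ x.1.2]
    · refine lt_of_le_of_ne u.2.2 fun h1 => hu1 ?_
      simp only [haff]
      rw [h1, affinity_one, hh.expInt_eq_one _ x.2.2]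
  obtain ⟨hz0, hz1⟩ := hendpoint (θ₀, γ₀) z hMz.le
  refine ⟨θ₀, θ₀.2, γ₀, γ₀.2, z, ρ, hz0, hz1, ?_, hMz, ?_, ?_⟩
  · rw [hρ, neg_pos]; exact Real.log_neg hrpos hr1
  · intro u
    rcases lt_or_ge u 0 with hu | hu
    · exact hlt1.le.trans (one_le_affinity_of_neg hpm hqm hp1 hq1 hu)
    rcases lt_or_ge 1 u with hu' | hu'
    · exact hlt1.le.trans (one_le_affinity_of_one_lt hpm hqm hp1 hq1 hu')
    exact hz ⟨u, hu, hu'⟩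
  -- Affinities equal one at `z = 0` and `z = 1`, so this compact sublevel set misses both
  -- endpoints, by a margin `κ` uniform in all pairs.
  · set C : Set ((Θ × Γ) × unitInterval) := {e | aff e ≤ ENNReal.ofReal (Real.exp (-ρ))}
    have hC : IsCompact C := (isClosed_le hcont continuous_const).isCompact
    have hCn : C.Nonempty := ⟨((θ₀, γ₀), z), hMz.le⟩
    have hsnd : Continuous fun e : (Θ × Γ) × unitInterval => (e.2 : ℝ) :=
      continuous_subtype_val.comp continuous_snd
    obtain ⟨e₁, he₁, hmin₁⟩ := hC.exists_isMinOn hCn hsnd.continuousOn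
    obtain ⟨e₂, he₂, hmax₂⟩ := hC.exists_isMaxOn hCn hsnd.continuousOn
    have h1 := (hendpoint e₁.1 e₁.2 he₁).1
    have h2 := (hendpoint e₂.1 e₂.2 he₂).2
    refine ⟨min (e₁.2 : ℝ) (1 - e₂.2), lt_min h1 (by linarith), fun θ hθ γ hγ => ?_⟩
    obtain ⟨u, hu⟩ := hall (⟨θ, hθ⟩, ⟨γ, hγ⟩)
    have g1 : (e₁.2 : ℝ) ≤ u := hmin₁ (a := ((⟨θ, hθ⟩, ⟨γ, hγ⟩), u)) hu
    have g2 : (u : ℝ) ≤ e₂.2 := hmax₂ (a := ((⟨θ, hθ⟩, ⟨γ, hγ⟩), u)) hu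
    refine ⟨u, (min_le_left _ _).trans g1, ?_, hu⟩
    linarith [min_le_right (e₁.2 : ℝ) (1 - e₂.2)]

end LeastFavourable

/-! ### Expectations with infinite values -/

section ExtendedExpectation

variable {P : Measure ℝ} {f : ℝ → ℝ}

/-- If some negative exponential moment of `f` is less than one, then `f` has positive
expectation. -/
lemma lintegral_neg_lt_of_lintegral_exp_lt_one [IsProbabilityMeasure P] (hf : Measurable f) {c : ℝ} (hc : 0 < c)
    (h : ∫⁻ x, ENNReal.ofReal (Real.exp (-(c * f x))) ∂P < 1) :
    ∫⁻ x, ENNReal.ofReal (-f x) ∂P < ∫⁻ x, ENNReal.ofReal (f x) ∂P := by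
  set M := ∫⁻ x, ENNReal.ofReal (Real.exp (-(c * f x))) ∂P
  set A := ∫⁻ x, ENNReal.ofReal (f x) ∂P
  set B := ∫⁻ x, ENNReal.ofReal (-f x) ∂P
  have hfn : Measurable fun x => ENNReal.ofReal (-f x) := hf.neg.ennreal_ofReal
  have hBM : ENNReal.ofReal c * B ≤ M := by
    rw [← lintegral_const_mul _ hfn]
    refine lintegral_mono fun x => ?_
    rw [← ENNReal.ofReal_mul hc.le]
    apply ENNReal.ofReal_le_ofReal
    linarith [Real.add_one_le_exp (-(c * f x))]
  have hBtop : ENNReal.ofReal c * B ≠ ∞ := ((hBM.trans_lt h).trans ENNReal.one_lt_top).ne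
  -- This integrates `1 ≤ c f + exp(-c f)` with the negative part moved to the left, so that nothing
  -- infinite is subtracted; finiteness of `c B` allows cancelling at the end.
  have hsum : 1 + ENNReal.ofReal c * B ≤ ENNReal.ofReal c * A + M := by
    rw [← lintegral_const_mul _ hf.ennreal_ofReal, ← lintegral_const_mul _ hfn,
      ← lintegral_add_left (hf.ennreal_ofReal.const_mul _)]
    have h1 : (1 : ℝ≥0∞) = ∫⁻ _, 1 ∂P := by simp
    rw [h1, ← lintegral_add_left measurable_const]
    refine lintegral_mono fun x => ?_
    dsimp only
    rw [← ENNReal.ofReal_mul hc.le, ← ENNReal.ofReal_mul hc.le, ← ENNReal.ofReal_one]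
    have hexp := Real.add_one_le_exp (-(c * f x))
    rcases le_total 0 (f x) with h0 | h0
    · have h2 : c * -f x ≤ 0 := by nlinarith
      rw [ENNReal.ofReal_of_nonpos h2, add_zero,
        ← ENNReal.ofReal_add (by positivity) (Real.exp_pos _).le]
      apply ENNReal.ofReal_le_ofReal
      linarith
    · have h2 : 0 ≤ c * -f x := by nlinarith
      rw [ENNReal.ofReal_of_nonpos (by nlinarith : c * f x ≤ 0), zero_add,
        ← ENNReal.ofReal_add zero_le_one h2]
      apply ENNReal.ofReal_le_ofReal
      linarith
  by_contra! hle
  have h3 : 1 + ENNReal.ofReal c * B ≤ M + ENNReal.ofReal c * B := by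
    refine hsum.trans ?_
    rw [add_comm]
    gcongr
  exact absurd ((ENNReal.add_le_add_iff_right hBtop).1 h3) (not_le.2 h)

lemma extExpect_pos_of_lintegral_exp_lt_one [IsProbabilityMeasure P] (hf : Measurable f) {c : ℝ} (hc : 0 < c)
    (h : ∫⁻ x, ENNReal.ofReal (Real.exp (-(c * f x))) ∂P < 1) : 0 < extExpect P f := by
  rw [extExpect, EReal.sub_pos, EReal.coe_ennreal_lt_coe_ennreal_iff]
  exact lintegral_neg_lt_of_lintegral_exp_lt_one hf hc h

/-- Negation may fail when both parts are infinite, as `⊤ - ⊤ = ⊥` in `EReal`. A strict lower bound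
on the expectation excludes an infinite negative part. -/
lemma extExpect_neg_lt {t : ℝ} (h : (t : EReal) < extExpect P f) :
    extExpect P (fun x => -f x) < ((-t : ℝ) : EReal) := by
  unfold extExpect at h ⊢
  simp only [neg_neg]
  set A := ∫⁻ x, ENNReal.ofReal (f x) ∂P
  set B := ∫⁻ x, ENNReal.ofReal (-f x) ∂P
  have htop : B ≠ ∞ := by
    intro hB
    rw [hB] at h
    simp at h
  have hswap : (B : EReal) - A = -((A : EReal) - B) := by
    rw [EReal.neg_sub (Or.inl (EReal.coe_ennreal_ne_bot _)) (Or.inr (by simpa using htop)),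
      add_comm, sub_eq_add_neg]
  rw [EReal.coe_neg, hswap]
  exact EReal.neg_lt_neg_iff.2 h

/-- Jensen's inequality for the exponential, allowing infinite expectations. -/
lemma ofReal_exp_le_lintegral_of_extExpect_lt [IsProbabilityMeasure P] (hf : Measurable f) {t z : ℝ} (hz : z < 0)
    (ht : extExpect P f < t) :
    ENNReal.ofReal (Real.exp (z * t)) ≤ ∫⁻ x, ENNReal.ofReal (Real.exp (z * f x)) ∂P := by
  by_cases hM : ∫⁻ x, ENNReal.ofReal (Real.exp (z * f x)) ∂P = ∞
  · rw [hM]; exact le_top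
  have hexpm : Measurable fun x => Real.exp (z * f x) := Real.measurable_exp.comp (hf.const_mul z)
  have hexpi : Integrable (fun x => Real.exp (z * f x)) P :=
    (lintegral_ofReal_ne_top_iff_integrable hexpm.aestronglyMeasurable
      (Eventually.of_forall fun x => (Real.exp_pos _).le)).1 hM
  have hfn : Measurable fun x => ENNReal.ofReal (-f x) := hf.neg.ennreal_ofReal
  -- A finite exponential moment controls the negative part, and then `ht` the positive part. This
  -- reduces the claim to integrable `f`, where the tangent to the exponential at `t` suffices.
  have hB : ∫⁻ x, ENNReal.ofReal (-f x) ∂P ≠ ∞ := by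
    have h1 : ENNReal.ofReal (-z) * ∫⁻ x, ENNReal.ofReal (-f x) ∂P ≠ ∞ := by
      refine ne_top_of_le_ne_top hM ?_
      rw [← lintegral_const_mul _ hfn]
      refine lintegral_mono fun x => ?_
      rw [← ENNReal.ofReal_mul (by linarith)]
      apply ENNReal.ofReal_le_ofReal
      linarith [Real.add_one_le_exp (z * f x)]
    intro h2
    rw [h2, ENNReal.mul_top (by simpa using hz)] at h1
    exact h1 rfl
  have hA : ∫⁻ x, ENNReal.ofReal (f x) ∂P ≠ ∞ := by
    intro h2
    rw [extExpect, h2, EReal.coe_ennreal_top, EReal.top_sub (by simpa using hB)] at ht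
    exact absurd ht (not_lt.2 le_top)
  have hfi : Integrable f P := by
    refine ⟨hf.aestronglyMeasurable, ?_⟩
    rw [hasFiniteIntegral_iff_norm]
    have : ∀ x, ENNReal.ofReal ‖f x‖ = ENNReal.ofReal (f x) + ENNReal.ofReal (-f x) := fun x => by
      rcases le_total 0 (f x) with h | h
      · rw [Real.norm_of_nonneg h, ENNReal.ofReal_of_nonpos (p := -f x) (by linarith), add_zero]
      · rw [Real.norm_of_nonpos h, ENNReal.ofReal_of_nonpos h, zero_add]
    simp_rw [this]
    rw [lintegral_add_left hf.ennreal_ofReal]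
    exact (ENNReal.add_lt_top.2 ⟨hA.lt_top, hB.lt_top⟩)
  have hmean : ∫ x, f x ∂P < t := by
    rw [integral_eq_lintegral_pos_part_sub_lintegral_neg_part hfi]
    rw [extExpect, ← ENNReal.ofReal_toReal hA, ← ENNReal.ofReal_toReal hB] at ht
    rw [EReal.coe_ennreal_ofReal, EReal.coe_ennreal_ofReal, max_eq_left ENNReal.toReal_nonneg,
      max_eq_left ENNReal.toReal_nonneg, ← EReal.coe_sub, EReal.coe_lt_coe_iff] at ht
    exact ht
  rw [← ofReal_integral_eq_lintegral_ofReal hexpi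
    (Eventually.of_forall fun x => (Real.exp_pos _).le)]
  apply ENNReal.ofReal_le_ofReal
  have hfti : Integrable (fun x => f x - t) P := hfi.sub (integrable_const _)
  have hlin : ∫ x, Real.exp (z * t) * (1 + z * (f x - t)) ∂P
      = Real.exp (z * t) * (1 + z * (∫ x, f x ∂P - t)) := by
    rw [integral_const_mul, integral_add (integrable_const _) (hfti.const_mul _), integral_const_mul,
      integral_sub hfi (integrable_const _)]
    simp
  calc Real.exp (z * t) ≤ Real.exp (z * t) * (1 + z * (∫ x, f x ∂P - t)) := by
        have : 0 ≤ z * (∫ x, f x ∂P - t) := by nlinarith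
        nlinarith [Real.exp_pos (z * t)]
    _ = ∫ x, Real.exp (z * t) * (1 + z * (f x - t)) ∂P := hlin.symm
    _ ≤ ∫ x, Real.exp (z * f x) ∂P := by
        refine integral_mono (((integrable_const _).add (hfti.const_mul _)).const_mul _) hexpi fun x => ?_
        have h1 : Real.exp (z * f x) = Real.exp (z * t) * Real.exp (z * (f x - t)) := by
          rw [← Real.exp_add]; congr 1; ring
        dsimp only [Pi.add_apply, Pi.sub_apply]
        rw [h1]
        gcongr
        linarith [Real.add_one_le_exp (z * (f x - t))]

end ExtendedExpectation

/-! ### The Chernoff index as a minimal affinity -/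

section ChernoffIndex

lemma measurable_logLR {g h : ℝ → ℝ} (hg : Measurable g) (hh : Measurable h) :
    Measurable (logLR g h) :=
  (Real.measurable_log.comp hh).sub (Real.measurable_log.comp hg)

lemma logLR_symm (g h : ℝ → ℝ) : logLR h g = fun x => -logLR g h x := by
  funext x; simp [logLR]

/-- For `z < 0` Jensen's inequality gives `M(z) ≥ exp(z t)`, so the term is nonpositive. For `z ≥ 0`
the part `z t` is nonpositive and the lower bound on `M` gives `ρ`. -/
lemma rate_le {μ : Measure ℝ} {g h : ℝ → ℝ} [IsProbabilityMeasure (law μ g)]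
    (hg : Measurable g) (hh : Measurable h) {t ρ : ℝ} (ht0 : t ≤ 0)
    (ht : extExpect (law μ g) (logLR g h) < t) (hρ : 0 ≤ ρ)
    (hM : ∀ z, ENNReal.ofReal (Real.exp (-ρ)) ≤ lrMgf μ g h z) : rate μ g h t ≤ ρ := by
  refine iSup_le fun z => ?_
  have key : ∀ a : ℝ, z * t - a ≤ ρ → ENNReal.ofReal (Real.exp a) ≤ lrMgf μ g h z →
      ((z * t : ℝ) : EReal) - ENNReal.log (lrMgf μ g h z) ≤ ρ := by
    intro a ha hle
    have h1 := ENNReal.log_le_log hle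
    rw [ENNReal.log_ofReal_of_pos (Real.exp_pos _), Real.log_exp] at h1
    refine (EReal.sub_le_sub le_rfl h1).trans ?_
    rw [← EReal.coe_sub]
    exact EReal.coe_le_coe_iff.2 ha
  rcases lt_or_ge z 0 with hz | hz
  · exact key (z * t) (by linarith)
      (ofReal_exp_le_lintegral_of_extExpect_lt (measurable_logLR hg hh) hz ht)
  · exact key (-ρ) (by nlinarith) (hM z)

lemma le_rate_zero {μ : Measure ℝ} {g h : ℝ → ℝ} {z ρ : ℝ}
    (hM : lrMgf μ g h z ≤ ENNReal.ofReal (Real.exp (-ρ))) : (ρ : EReal) ≤ rate μ g h 0 := by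
  refine le_iSup_of_le z ?_
  have h1 := ENNReal.log_le_log hM
  rw [ENNReal.log_ofReal_of_pos (Real.exp_pos _), Real.log_exp] at h1
  refine le_trans ?_ (EReal.sub_le_sub le_rfl h1)
  rw [← EReal.coe_sub]
  simp

variable {μ ν : Measure ℝ} {g h p q : ℝ → ℝ}

lemma lrMgf_eq_affinity (hp : Measurable p) (hq : Measurable q) (hgl : law μ g = expLaw ν p)
    (hlr : ∀ x, logLR g h x = q x - p x) (z : ℝ) : lrMgf μ g h z = affinity ν p q z := by
  rw [lrMgf, hgl, affinity_eq_lintegral hp hq]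
  simp_rw [hlr]

/-- The affinity at `1/2` is the moment of `exp(-l/2)` under `h`. With its mirror image this makes
`t = 0` admissible in the Chernoff index. -/
lemma extExpect_logLR_pos (hp : Measurable p) (hq : Measurable q)
    (hhl : law μ h = expLaw ν q) (hq1 : expInt ν q = 1)
    (hlr : ∀ x, logLR g h x = q x - p x) (hhalf : affinity ν p q (1 / 2) < 1) :
    0 < extExpect (law μ h) (logLR g h) := by
  have hpr : IsProbabilityMeasure (law μ h) := hhl ▸ isProbabilityMeasure_expLaw hq1
  refine extExpect_pos_of_lintegral_exp_lt_one (c := 1 / 2) ?_ (by norm_num) ?_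
  · rw [show logLR g h = fun x => q x - p x from funext hlr]; exact hq.sub hp
  · rw [hhl]
    rw [← affinity_symm, affinity_eq_lintegral hq hp] at hhalf
    refine lt_of_le_of_lt (le_of_eq (lintegral_congr fun x => ?_)) hhalf
    rw [hlr]; congr 2; ring

/-- Lower bound of the Chernoff index through the affinities. -/
lemma le_chernoffIndex (hp : Measurable p) (hq : Measurable q)
    (hgl : law μ g = expLaw ν p) (hhl : law μ h = expLaw ν q)
    (hp1 : expInt ν p = 1) (hq1 : expInt ν q = 1)
    (hlr : ∀ x, logLR g h x = q x - p x) (hhalf : affinity ν p q (1 / 2) < 1) {z ρ : ℝ}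
    (hz : affinity ν p q z ≤ ENNReal.ofReal (Real.exp (-ρ))) :
    (ρ : EReal) ≤ chernoffIndex μ g h := by
  have hlr' : ∀ x, logLR h g x = p x - q x := fun x => by
    have := hlr x
    simp only [logLR] at this ⊢
    linarith
  have hpos := extExpect_logLR_pos hp hq hhl hq1 hlr hhalf
  have hhalf' : affinity ν q p (1 / 2) < 1 := by
    rw [← affinity_symm] at hhalf; norm_num at hhalf ⊢; exact hhalf
  have hneg : extExpect (law μ g) (logLR g h) < ((0 : ℝ) : EReal) := by
    have h1 := extExpect_logLR_pos hq hp hgl hp1 hlr' hhalf'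
    have h2 := extExpect_neg_lt (t := 0) (by exact_mod_cast h1)
    rw [logLR_symm h g]
    simpa using h2
  -- At `t = 0` both rates are bounded by the same affinity, read at `z` and at `1 - z`.
  refine le_iSup₂_of_le 0 ⟨hneg, by exact_mod_cast hpos⟩ (le_min ?_ ?_)
  · exact le_rate_zero (z := z) (by rwa [lrMgf_eq_affinity hp hq hgl hlr])
  · rw [neg_zero]
    exact le_rate_zero (z := 1 - z) (by rwa [lrMgf_eq_affinity hq hp hhl hlr', affinity_symm])

/-- Upper bound of the Chernoff index through the affinities. -/
lemma chernoffIndex_le (hg : Measurable g) (hh : Measurable h) (hp : Measurable p)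
    (hq : Measurable q) (hgl : law μ g = expLaw ν p) (hhl : law μ h = expLaw ν q)
    (hp1 : expInt ν p = 1) (hq1 : expInt ν q = 1)
    (hlr : ∀ x, logLR g h x = q x - p x) {ρ : ℝ} (hρ : 0 ≤ ρ)
    (hz : ∀ z, ENNReal.ofReal (Real.exp (-ρ)) ≤ affinity ν p q z) :
    chernoffIndex μ g h ≤ ρ := by
  have hprg : IsProbabilityMeasure (law μ g) := hgl ▸ isProbabilityMeasure_expLaw hp1
  have hprh : IsProbabilityMeasure (law μ h) := hhl ▸ isProbabilityMeasure_expLaw hq1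
  have hlr' : ∀ x, logLR h g x = p x - q x := fun x => by
    have := hlr x
    simp only [logLR] at this ⊢
    linarith
  refine iSup₂_le fun t ht => ?_
  -- Only one of the two rates has to be at most `ρ`, and the sign of `t` decides which.
  rcases le_total t 0 with h0 | h0
  · refine (min_le_left _ _).trans (rate_le hg hh h0 ht.1 hρ fun z => ?_)
    rw [lrMgf_eq_affinity hp hq hgl hlr]
    exact hz z
  · refine (min_le_right _ _).trans (rate_le hh hg (by linarith) ?_ hρ fun z => ?_)
    · rw [logLR_symm g h]
      exact extExpect_neg_lt ht.2
    · rw [lrMgf_eq_affinity hq hp hhl hlr', ← sub_sub_cancel 1 z, affinity_symm]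
      exact hz _

end ChernoffIndex

/-! ### From exponential bounds to logarithmic equivalence -/

section LogarithmicAsymptotics

lemma isEquivalent_of_eventually_abs_add_le {u : ℕ → ℝ} {ρ : ℝ} (hρ : 0 < ρ)
    (h : ∀ ε > 0, ∀ᶠ n : ℕ in atTop, |u n + n * ρ| ≤ n * ε) :
    u ~[atTop] fun n : ℕ => -((n : ℝ) * ρ) := by
  refine isLittleO_iff.2 fun c hc => ?_
  filter_upwards [h (c * ρ) (by positivity)] with n hn
  rw [Pi.sub_apply, sub_neg_eq_add, Real.norm_eq_abs, Real.norm_eq_abs, abs_neg,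
    abs_of_nonneg (by positivity : (0 : ℝ) ≤ n * ρ)]
  exact hn.trans (le_of_eq (by ring))

lemma log_ofReal_exp (a : ℝ) : ENNReal.log (ENNReal.ofReal (Real.exp a)) = (a : EReal) := by
  rw [ENNReal.log_ofReal_of_pos (Real.exp_pos _), Real.log_exp]

lemma toReal_mem_Icc {x : EReal} {a b : ℝ} (ha : (a : EReal) ≤ x) (hb : x ≤ b) :
    a ≤ x.toReal ∧ x.toReal ≤ b := by
  lift x to ℝ using ⟨(hb.trans_lt (EReal.coe_lt_top b)).ne,
    ((EReal.bot_lt_coe a).trans_le ha).ne'⟩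
  exact ⟨EReal.coe_le_coe_iff.1 ha, EReal.coe_le_coe_iff.1 hb⟩

variable {d : ℕ} {T : Set (Param d)} {w : Param d → ℝ} {e : ℕ → Param d → ℝ≥0∞} {ρ : ℝ}

/-- Averaged and worst-case error probabilities have the same exponential rate as soon as the
errors obey a uniform upper bound, and a lower bound on sets of subexponential prior mass. -/
lemma logAverage_logWorst_isEquivalent (hT : MeasurableSet T) (hw0 : ∀ t ∈ T, 0 < w t)
    (hwi : IntegrableOn w T) (hw1 : ∫ t in T, w t = 1) (hρ : 0 < ρ)
    (hup : ∀ ε > 0, ∀ᶠ n : ℕ in atTop, ∀ t ∈ T,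
      e n t ≤ ENNReal.ofReal (Real.exp (-(n * (ρ - ε)))))
    {t₀ : Param d} (ht₀ : t₀ ∈ T)
    (hlow : ∀ τ > 0, ∀ᶠ n : ℕ in atTop, ∃ r > 0,
      Real.exp (-(τ * n)) ≤ ∫ s in T ∩ Metric.closedBall t₀ r, w s ∧
      ∀ t ∈ T, dist t t₀ ≤ r → ENNReal.ofReal (Real.exp (-(n * (ρ + τ)))) ≤ e n t) :
    ((fun n => logAverage T w (e n)) ~[atTop] fun n : ℕ => -((n : ℝ) * ρ)) ∧
    ((fun n => logWorst T (e n)) ~[atTop] fun n : ℕ => -((n : ℝ) * ρ)) := by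
  have hw_lint : ∀ V ⊆ T, MeasurableSet V →
      ∫⁻ t in V, ENNReal.ofReal (w t) = ENNReal.ofReal (∫ t in V, w t) := fun V hVT hV =>
    (ofReal_integral_eq_lintegral_ofReal (hwi.mono_set hVT)
      ((ae_restrict_iff' hV).2 (Eventually.of_forall fun t ht => (hw0 t (hVT ht)).le))).symm
  constructor
  · refine isEquivalent_of_eventually_abs_add_le hρ fun ε hε => ?_
    -- Half of `ε` goes to the error probability on the ball, half to the prior mass of the ball.
    filter_upwards [hup ε hε, hlow (ε / 2) (half_pos hε)] with n h1 ⟨r, hr, hmass, h2⟩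
    have hupper : ∫⁻ t in T, e n t * ENNReal.ofReal (w t)
        ≤ ENNReal.ofReal (Real.exp (-(n * (ρ - ε)))) := by
      calc _ ≤ ∫⁻ t in T, ENNReal.ofReal (Real.exp (-(n * (ρ - ε)))) * ENNReal.ofReal (w t) := by
            refine setLIntegral_mono' hT fun t ht => ?_
            gcongr
            exact h1 t ht
        _ = _ := by
            rw [lintegral_const_mul' _ _ ENNReal.ofReal_ne_top, hw_lint T subset_rfl hT, hw1,
              ENNReal.ofReal_one, mul_one]
    have hlower : ENNReal.ofReal (Real.exp (-(n * (ρ + ε))))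
        ≤ ∫⁻ t in T, e n t * ENNReal.ofReal (w t) := by
      set V := T ∩ Metric.closedBall t₀ r
      have hV : MeasurableSet V := hT.inter Metric.isClosed_closedBall.measurableSet
      calc ENNReal.ofReal (Real.exp (-(n * (ρ + ε))))
          = ENNReal.ofReal (Real.exp (-(n * (ρ + ε / 2)))) *
            ENNReal.ofReal (Real.exp (-(ε / 2 * n))) := by
            rw [ofReal_exp_mul]; congr 2; ring
        _ ≤ ENNReal.ofReal (Real.exp (-(n * (ρ + ε / 2)))) *
            ∫⁻ t in V, ENNReal.ofReal (w t) := by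
            rw [hw_lint V Set.inter_subset_left hV]
            gcongr
        _ = ∫⁻ t in V, ENNReal.ofReal (Real.exp (-(n * (ρ + ε / 2)))) * ENNReal.ofReal (w t) :=
            (lintegral_const_mul' _ _ ENNReal.ofReal_ne_top).symm
        _ ≤ ∫⁻ t in V, e n t * ENNReal.ofReal (w t) := by
            refine setLIntegral_mono' hV fun t ht => ?_
            gcongr
            exact h2 t ht.1 ht.2
        _ ≤ _ := lintegral_mono_set Set.inter_subset_left
    have a1 := ENNReal.log_le_log hlower
    have a2 := ENNReal.log_le_log hupper
    rw [log_ofReal_exp] at a1 a2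
    obtain ⟨b1, b2⟩ := toReal_mem_Icc a1 a2
    rw [logAverage, abs_le]
    constructor <;> linarith
  · refine isEquivalent_of_eventually_abs_add_le hρ fun ε hε => ?_
    filter_upwards [hup ε hε, hlow ε hε] with n h1 ⟨r, hr, hmass, h2⟩
    have a2 : ⨆ t ∈ T, ENNReal.log (e n t) ≤ ((-(n * (ρ - ε)) : ℝ) : EReal) := by
      refine iSup₂_le fun t ht => ?_
      rw [← log_ofReal_exp]
      exact ENNReal.log_le_log (h1 t ht)
    have a1 : ((-(n * (ρ + ε)) : ℝ) : EReal) ≤ ⨆ t ∈ T, ENNReal.log (e n t) := by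
      refine le_iSup₂_of_le t₀ ht₀ ?_
      rw [← log_ofReal_exp]
      exact ENNReal.log_le_log (h2 t₀ ht₀ (by simpa using hr.le))
    obtain ⟨b1, b2⟩ := toReal_mem_Icc a1 a2
    rw [logWorst, abs_le]
    constructor <;> linarith

end LogarithmicAsymptotics

/-! ### Reduction to log-densities under a reference law -/

section ReferenceMeasure

variable {μ : Measure ℝ} {f k : ℝ → ℝ}

/-- Mutual absolute continuity makes the two densities vanish together `μ`-almost everywhere. Where
they vanish, the value of `Real.log` is irrelevant, being multiplied by `k = 0`. -/
lemma law_eq_expLaw (hf : Measurable f) (hk : Measurable k) (hk0 : ∀ x, 0 ≤ k x)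
    (hfk : law μ f ≪ law μ k) (hkf : law μ k ≪ law μ f) :
    law μ f = expLaw (law μ k) (logLR k f) := by
  have hpos : ∀ u : ℝ → ℝ, Measurable u → ∀ᵐ x ∂law μ u, 0 < u x := fun u hu => by
    refine (ae_withDensity_iff hu.ennreal_ofReal).2 (Eventually.of_forall fun x hx => ?_)
    by_contra! h
    exact hx (ENNReal.ofReal_of_nonpos h)
  have h1 := (ae_withDensity_iff hf.ennreal_ofReal).1 (hfk.ae_le (hpos k hk))
  have h2 := (ae_withDensity_iff hk.ennreal_ofReal).1 (hkf.ae_le (hpos f hf))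
  refine Eq.trans (withDensity_congr_ae ?_) (withDensity_mul μ hk.ennreal_ofReal
    (measurable_ofReal_exp (measurable_logLR hk hf)))
  filter_upwards [h1, h2] with x hx1 hx2
  rw [Pi.mul_apply, ← ENNReal.ofReal_mul (hk0 x)]
  rcases (hk0 x).eq_or_lt with h0 | h0
  · rw [← h0, zero_mul, ENNReal.ofReal_zero]
    by_contra hne
    exact (hx1 hne).ne h0
  · have hfx : 0 < f x := hx2 (by simpa using h0)
    rw [logLR, Real.exp_sub, Real.exp_log hfx, Real.exp_log h0, mul_div_cancel₀ _ h0.ne']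

end ReferenceMeasure

/-- The product of reference densities is common to both families and cancels in the Bayes factor.
-/
lemma marginal_eq {d n : ℕ} {T : Set (Param d)} (hT : MeasurableSet T) (w : Param d → ℝ)
    {f : Param d → ℝ → ℝ} {k : ℝ → ℝ} {X : Fin n → ℝ} (hk : ∀ i, 0 < k (X i))
    (hf : ∀ i, ∀ t ∈ T, 0 < f t (X i)) :
    marginal T w f X = (∏ i, k (X i)) * logMarginal T w (fun t => logLR k (f t)) X := by
  rw [marginal, logMarginal, ← integral_const_mul]
  refine setIntegral_congr_fun hT fun t ht => ?_
  have : ∀ i, f t (X i) = k (X i) * Real.exp (logLR k (f t) (X i)) := fun i => by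
    rw [logLR, Real.exp_sub, Real.exp_log (hf i t ht), Real.exp_log (hk i),
      mul_div_cancel₀ _ (hk i).ne']
  rw [Finset.prod_congr rfl fun i _ => this i, Finset.prod_mul_distrib, ← Real.exp_sum, logLik]
  ring

lemma SmoothFamily.logMarginal_pos {d n : ℕ} {ν : Measure ℝ} {G : Set ℝ} {S : ℝ → ℝ≥0∞}
    {T : Set (Param d)} {p : Param d → ℝ → ℝ} {w : Param d → ℝ}
    (hF : SmoothFamily ν G S T p w) {X : Fin n → ℝ} (hX : ∀ i, X i ∈ G) :
    0 < logMarginal T w p X := by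
  obtain ⟨t, ht, hmin⟩ := hF.isCompact.exists_isMinOn hF.nonempty (hF.continuousOn_logLik hX)
  calc 0 < ∫ s in T, w s * Real.exp (logLik p X t) := by
        rw [integral_mul_const, hF.prior_integral]
        positivity
    _ ≤ logMarginal T w p X := by
        refine setIntegral_mono_on (hF.prior_integrableOn.mul_const _)
          (hF.integrableOn_likelihood hX) hF.isCompact.measurableSet fun s hs => ?_
        have := (hF.prior_pos s hs).le
        gcongr
        exact hmin hs

/-- A density family with a reference density yields a smooth family of log-densities. -/
lemma IsDensityFamily.smoothFamily {d : ℕ} {μ : Measure ℝ} {T : Set (Param d)}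
    {f : Param d → ℝ → ℝ} {w : Param d → ℝ} {k : ℝ → ℝ} {G : Set ℝ} {S : ℝ → ℝ≥0∞}
    (hf : IsDensityFamily μ T f) (hk : Measurable k) (hk0 : ∀ x, 0 ≤ k x) (hT : IsCompact T)
    (hb : HasC1Boundary T) (hw : IsPositiveLipschitzPrior T w)
    (hfk : ∀ t ∈ T, law μ (f t) ≪ law μ k) (hkf : ∀ t ∈ T, law μ k ≪ law μ (f t))
    (hG : ∀ᵐ x ∂law μ k, x ∈ G)
    (hdiff : ∀ x ∈ G, DifferentiableOn ℝ (fun t => Real.log (f t x)) T)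
    (hgrad : ∀ x, ∃ a c : ℝ, |a| = 1 ∧
      ∀ t ∈ T, ‖gradientWithin (fun t => a * Real.log (f t x) + c) T t‖ₑ ≤ S x)
    (htail : ∀ ε > 0, ∀ L : ℝ, ∀ᶠ n : ℕ in atTop, ∀ t ∈ T,
      law μ (f t) {y | ENNReal.ofReal (Real.exp (ε * n)) < S y}
        ≤ ENNReal.ofReal (Real.exp (-(L * n)))) :
    SmoothFamily (law μ k) G S T (fun t => logLR k (f t)) w := by
  have hlaw : ∀ t ∈ T, expLaw (law μ k) (logLR k (f t)) = law μ (f t) := fun t ht =>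
    (law_eq_expLaw (hf.measurable t ht) hk hk0 (hfk t ht) (hkf t ht)).symm
  obtain ⟨K, hK, δ, hδ, hcone⟩ := hb.exists_uniform_cone hT
  refine
    { isCompact := hT
      measurable := fun t ht => measurable_logLR hk (hf.measurable t ht)
      expInt_eq_one := fun t ht => ?_
      ae_good := hG
      continuousOn := fun x hx => (hdiff x hx).continuousOn.sub continuousOn_const
      lipschitz := ⟨1 + 2 * K ^ 2, by positivity, δ / (1 + K), by positivity, ?_⟩
      volume_ball := exists_volume_ge_of_cone hT hK hδ hcone
      tail := fun ε hε L => ?_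
      prior_pos := hw.pos
      prior_continuousOn := hw.lipschitz.choose_spec.continuousOn
      prior_integral := hw.integral_eq_one }
  · have h1 : expLaw (law μ k) (logLR k (f t)) Set.univ = law μ (f t) Set.univ := by
      rw [hlaw t ht]
    rw [expLaw, withDensity_apply _ MeasurableSet.univ, law, law,
      withDensity_apply _ MeasurableSet.univ, Measure.restrict_univ, Measure.restrict_univ,
      hf.lintegral_eq_one t ht] at h1
    exact h1
  · intro x hx B hB hS s hs t ht hst
    -- As a function of one parameter `l_{θγ}` is `±log f_t` plus a constant; the sign and the shift
    -- disappear from absolute differences.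
    obtain ⟨a, c, ha, hgr⟩ := hgrad x
    have h1 := abs_sub_le_of_cone hK hδ hcone (((hdiff x hx).const_mul a).add_const c) hB
      (fun t ht => ?_) hs ht hst
    · simpa [logLR, ← mul_sub, abs_mul, ha] using h1
    · have h2 := (hgr t ht).trans hS
      rwa [← ofReal_norm, ENNReal.ofReal_le_ofReal_iff hB] at h2
  · filter_upwards [htail ε hε L] with n hn t ht
    rw [hlaw t ht]
    exact hn t ht

/-! ### Consequences of the tail and separation conditions -/

section MainTheorem

variable {dg dh : ℕ} {μ : Measure ℝ} {Θ : Set (Param dg)} {Γ : Set (Param dh)}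
  {g : Param dg → ℝ → ℝ} {h : Param dh → ℝ → ℝ}

/-- At `x = exp(εn)` the assumed bound is `exp(-(εn)^(1+η))`, which beats `exp(-Ln)` for every `L`.
-/
lemma GradientTails.eventually_le (hA3 : GradientTails μ Θ Γ g h) {ε : ℝ} (hε : 0 < ε) (L : ℝ) :
    ∀ᶠ n : ℕ in atTop, ∀ θ ∈ Θ, ∀ γ ∈ Γ, ∀ f ∈ ({g θ, h γ} : Set (ℝ → ℝ)),
      law μ f {y | ENNReal.ofReal (Real.exp (ε * n))
        < max (supGradNull Θ Γ g h y) (supGradAlt Θ Γ g h y)}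
        ≤ ENNReal.ofReal (Real.exp (-(L * n))) := by
  obtain ⟨η, hη, x₀, hx₀, H⟩ := hA3
  have hlim : Tendsto (fun n : ℕ => (ε * n : ℝ) ^ η) atTop atTop :=
    (tendsto_rpow_atTop hη).comp (tendsto_natCast_atTop_atTop.const_mul_atTop hε)
  filter_upwards [hlim.eventually_ge_atTop ((|L| + 1) / ε),
    eventually_le_exp (C := x₀ + 1) hε, eventually_gt_atTop 0] with n hn1 hn2 hn3 θ hθ γ hγ f hf
  have hn : (1 : ℝ) ≤ n := by exact_mod_cast hn3
  have hεn : 0 < ε * n := by positivity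
  -- The extra `1` pays for the factor two in the union over the two suprema.
  have hpow : L * n + 1 ≤ (ε * n) ^ (1 + η) := by
    rw [Real.rpow_add hεn, Real.rpow_one]
    calc L * n + 1 ≤ |L| * n + n := by gcongr; exact le_abs_self L
      _ = ε * n * ((|L| + 1) / ε) := by field_simp
      _ ≤ _ := by gcongr
  have hS : ∀ S ∈ ({supGradNull Θ Γ g h, supGradAlt Θ Γ g h} : Set (ℝ → ℝ≥0∞)),
      law μ f {y | ENNReal.ofReal (Real.exp (ε * n)) < S y}
        ≤ ENNReal.ofReal (Real.exp (-(L * n + 1))) := by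
    intro S hS
    have h1 := H (Real.exp (ε * n)) (by linarith) θ hθ γ hγ S hS
    rw [Real.log_exp] at h1
    have h2 : ENNReal.ofReal (Real.exp (-(ε * n) ^ (1 + η)))
        ≤ ENNReal.ofReal (Real.exp (-(L * n + 1))) :=
      ENNReal.ofReal_le_ofReal (Real.exp_le_exp.2 (neg_le_neg hpow))
    rcases hf with rfl | rfl
    · exact ((le_max_left _ _).trans h1).trans h2
    · exact ((le_max_right _ _).trans h1).trans h2
  have hsub : {y | ENNReal.ofReal (Real.exp (ε * n))
      < max (supGradNull Θ Γ g h y) (supGradAlt Θ Γ g h y)}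
      ⊆ {y | ENNReal.ofReal (Real.exp (ε * n)) < supGradNull Θ Γ g h y}
        ∪ {y | ENNReal.ofReal (Real.exp (ε * n)) < supGradAlt Θ Γ g h y} := by
    intro y hy
    rw [Set.mem_ofPred_eq, lt_max_iff] at hy
    exact hy
  refine (measure_mono hsub).trans ((measure_union_le _ _).trans
    ((add_le_add (hS _ (Or.inl rfl)) (hS _ (Or.inr rfl))).trans ?_))
  rw [← ENNReal.ofReal_add (Real.exp_pos _).le (Real.exp_pos _).le]
  apply ENNReal.ofReal_le_ofReal
  have h2e : 2 * Real.exp (-1) ≤ 1 := by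
    have := Real.add_one_le_exp (1 : ℝ)
    rw [Real.exp_neg, ← div_eq_mul_inv, div_le_one (Real.exp_pos _)]
    linarith
  rw [neg_add, Real.exp_add]
  nlinarith [Real.exp_pos (-(L * n))]

/-- Equal log-densities would make the divergence zero. Compactness later turns this qualitative
separation into a uniform one. -/
lemma CompletelySeparated.not_ae_eq (hA1 : CompletelySeparated μ Θ Γ g h) {θ : Param dg}
    (hθ : θ ∈ Θ) {γ : Param dh} (hγ : γ ∈ Γ) {k : ℝ → ℝ} (hgk : law μ (g θ) ≪ law μ k) :
    ¬ logLR k (g θ) =ᵐ[law μ k] logLR k (h γ) := by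
  intro hae
  have hpos : 0 < extExpect (law μ (g θ)) (fun x => Real.log (g θ x) - Real.log (h γ x)) :=
    hA1.trans_le ((iInf₂_le θ hθ).trans (iInf₂_le γ hγ))
  have hz : ∀ᵐ x ∂law μ (g θ), Real.log (g θ x) - Real.log (h γ x) = 0 := by
    filter_upwards [hgk.ae_le hae] with x hx
    simp only [logLR] at hx
    linarith
  have h1 : ∫⁻ x, ENNReal.ofReal (Real.log (g θ x) - Real.log (h γ x)) ∂law μ (g θ) = 0 := by
    rw [lintegral_congr_ae (g := fun _ => 0) (hz.mono fun x hx => by simp [hx]), lintegral_zero]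
  rw [extExpect, h1] at hpos
  have h2 : ∫⁻ x, ENNReal.ofReal (-(Real.log (g θ x) - Real.log (h γ x))) ∂law μ (g θ) = 0 := by
    rw [lintegral_congr_ae (g := fun _ => 0) (hz.mono fun x hx => by simp [hx]), lintegral_zero]
  rw [h2] at hpos
  simp at hpos

end MainTheorem

end SeparateFamilies

end

/-! ### The theorem -/

open SeparateFamilies in
theorem theorem2 {dg dh : ℕ} (μ : Measure ℝ)
    (Θ : Set (Param dg)) (Γ : Set (Param dh))
    (g : Param dg → ℝ → ℝ) (h : Param dh → ℝ → ℝ)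
    (hg : IsDensityFamily μ Θ g) (hh : IsDensityFamily μ Γ h)
    (hac : MutuallyAC μ Θ Γ g h)
    (hA1 : CompletelySeparated μ Θ Γ g h)
    (hΘ : IsCompact Θ) (hΓ : IsCompact Γ)
    (hΘb : HasC1Boundary Θ) (hΓb : HasC1Boundary Γ)
    (hgs : HasScore μ Θ g) (hhs : HasScore μ Γ h)
    (hA3 : GradientTails μ Θ Γ g h)
    (φ : Param dg → ℝ) (ψ : Param dh → ℝ)
    (hφ : IsPositiveLipschitzPrior Θ φ) (hψ : IsPositiveLipschitzPrior Γ ψ) :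
    ∃ ρ : ℝ, 0 < ρ ∧
      IsLeast {r : EReal | ∃ θ ∈ Θ, ∃ γ ∈ Γ, r = chernoffIndex μ (g θ) (h γ)} (ρ : EReal) ∧
      (fun n : ℕ => logAverage Θ φ (errNull μ Θ Γ g h φ ψ n))
        ~[atTop] (fun n : ℕ => -((n : ℝ) * ρ)) ∧
      (fun n : ℕ => logWorst Θ (errNull μ Θ Γ g h φ ψ n))
        ~[atTop] (fun n : ℕ => -((n : ℝ) * ρ)) ∧
      (fun n : ℕ => logAverage Γ ψ (errAlt μ Θ Γ g h φ ψ n))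
        ~[atTop] (fun n : ℕ => -((n : ℝ) * ρ)) ∧
      (fun n : ℕ => logWorst Γ (errAlt μ Θ Γ g h φ ψ n))
        ~[atTop] (fun n : ℕ => -((n : ℝ) * ρ)) := by
  have hnonempty : ∀ {d : ℕ} {T : Set (Param d)} {w : Param d → ℝ},
      IsPositiveLipschitzPrior T w → T.Nonempty := fun {d T w} hw => by
    by_contra hT
    have := hw.integral_eq_one
    simp [Set.not_nonempty_iff_eq_empty.1 hT] at this
  obtain ⟨θ₁, hθ₁⟩ := hnonempty hφ
  obtain ⟨γ₁, hγ₁⟩ := hnonempty hψ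
  set k := g θ₁ with hk
  set ν := law μ k with hν
  have hkm : Measurable k := hg.measurable θ₁ hθ₁
  have hk0 : ∀ x, 0 ≤ k x := hg.nonneg θ₁ hθ₁
  -- Absolute continuity is assumed across the families only, so two members of the `g`-family are
  -- compared through `γ₁`.
  have hgk : ∀ θ ∈ Θ, law μ (g θ) ≪ ν := fun θ hθ =>
    (hac θ hθ γ₁ hγ₁).1.trans (hac θ₁ hθ₁ γ₁ hγ₁).2
  have hkg : ∀ θ ∈ Θ, ν ≪ law μ (g θ) := fun θ hθ =>
    (hac θ₁ hθ₁ γ₁ hγ₁).1.trans (hac θ hθ γ₁ hγ₁).2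
  have hhk : ∀ γ ∈ Γ, law μ (h γ) ≪ ν := fun γ hγ => (hac θ₁ hθ₁ γ hγ).2
  have hkh : ∀ γ ∈ Γ, ν ≪ law μ (h γ) := fun γ hγ => (hac θ₁ hθ₁ γ hγ).1
  set G : Set ℝ := {x | ((∀ t ∈ Θ, 0 < g t x) ∧ DifferentiableOn ℝ (fun t => Real.log (g t x)) Θ) ∧
    ((∀ t ∈ Γ, 0 < h t x) ∧ DifferentiableOn ℝ (fun t => Real.log (h t x)) Γ)} with hG
  have hGae : ∀ᵐ x ∂ν, x ∈ G := by
    filter_upwards [hgs θ₁ hθ₁, (hkh γ₁ hγ₁).ae_le (hhs γ₁ hγ₁)] with x h1 h2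
    exact ⟨h1, h2⟩
  set S : ℝ → ℝ≥0∞ := fun x => max (supGradNull Θ Γ g h x) (supGradAlt Θ Γ g h x) with hS
  set p : Param dg → ℝ → ℝ := fun θ => logLR k (g θ) with hp
  set q : Param dh → ℝ → ℝ := fun γ => logLR k (h γ) with hq
  have Fg : SmoothFamily ν G S Θ p φ := by
    refine hg.smoothFamily hkm hk0 hΘ hΘb hφ hgk hkg hGae (fun x hx => hx.1.2) ?_ ?_
    · refine fun x => ⟨-1, Real.log (h γ₁ x), by norm_num, fun t ht => ?_⟩
      have hfun : (fun t => -1 * Real.log (g t x) + Real.log (h γ₁ x))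
          = fun t => logLR (g t) (h γ₁) x := by funext t; simp only [logLR]; ring
      rw [hfun]
      refine le_trans ?_ (le_max_left _ _)
      exact le_iSup₂_of_le t ht (le_iSup₂_of_le γ₁ hγ₁ le_rfl)
    · intro ε hε L
      filter_upwards [hA3.eventually_le hε L] with n hn t ht
      exact hn t ht γ₁ hγ₁ _ (Or.inl rfl)
  have Fh : SmoothFamily ν G S Γ q ψ := by
    refine hh.smoothFamily hkm hk0 hΓ hΓb hψ hhk hkh hGae (fun x hx => hx.2.2) ?_ ?_
    · refine fun x => ⟨1, -Real.log (g θ₁ x), by norm_num, fun t ht => ?_⟩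
      have hfun : (fun t => 1 * Real.log (h t x) + -Real.log (g θ₁ x))
          = fun t => logLR (g θ₁) (h t) x := by funext t; simp only [logLR]; ring
      rw [hfun]
      refine le_trans ?_ (le_max_right _ _)
      exact le_iSup₂_of_le θ₁ hθ₁ (le_iSup₂_of_le t ht le_rfl)
    · intro ε hε L
      filter_upwards [hA3.eventually_le hε L] with n hn t ht
      exact hn θ₁ hθ₁ t ht _ (Or.inr rfl)
  have hlawg : ∀ θ ∈ Θ, law μ (g θ) = expLaw ν (p θ) := fun θ hθ =>
    law_eq_expLaw (hg.measurable θ hθ) hkm hk0 (hgk θ hθ) (hkg θ hθ)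
  have hlawh : ∀ γ ∈ Γ, law μ (h γ) = expLaw ν (q γ) := fun γ hγ =>
    law_eq_expLaw (hh.measurable γ hγ) hkm hk0 (hhk γ hγ) (hkh γ hγ)
  have hlr : ∀ θ γ x, logLR (g θ) (h γ) x = q γ x - p θ x := fun θ γ x => by
    simp only [hp, hq, logLR]; ring
  have hνpr : IsProbabilityMeasure ν := by
    rw [hν, hk, hlawg θ₁ hθ₁]; exact Fg.isProbabilityMeasure hθ₁
  have hhalf : ∀ θ ∈ Θ, ∀ γ ∈ Γ, affinity ν (p θ) (q γ) (1 / 2) < 1 := fun θ hθ γ hγ =>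
    affinity_half_lt_one (Fg.measurable θ hθ) (Fh.measurable γ hγ) (Fg.expInt_eq_one θ hθ)
      (Fh.expInt_eq_one γ hγ) (hA1.not_ae_eq hθ hγ (hgk θ hθ))
  obtain ⟨θ₀, hθ₀, γ₀, hγ₀, z, ρ, hz0, hz1, hρ, hM, hmin, κ, hκ, hsep⟩ :=
    Fg.exists_leastFavourable Fh hhalf
  have hp₀ := Fg.measurable θ₀ hθ₀
  have hq₀ := Fh.measurable γ₀ hγ₀
  have hp1 := Fg.expInt_eq_one θ₀ hθ₀
  have hq1 := Fh.expInt_eq_one γ₀ hγ₀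
  have hBF : ∀ {n : ℕ} {X : Fin n → ℝ}, (∀ i, X i ∈ G) → bayesFactor Θ Γ g h φ ψ X
      = logMarginal Γ ψ q X / logMarginal Θ φ p X := fun {n X} hX => by
    have hkX : ∀ i, 0 < k (X i) := fun i => (hX i).1.1 θ₁ hθ₁
    rw [bayesFactor, marginal_eq hΘ.measurableSet φ hkX fun i => (hX i).1.1,
      marginal_eq hΓ.measurableSet ψ hkX fun i => (hX i).2.1,
      mul_div_mul_left _ _ (Finset.prod_pos fun i _ => hkX i).ne']
  have hgood : ∀ {n : ℕ} {P : Measure ℝ}, IsProbabilityMeasure P → P ≪ ν →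
      ∀ᵐ X ∂Measure.pi (fun _ : Fin n => P), ∀ i, X i ∈ G := fun {n P} _ hP =>
    ae_all_iff.2 fun i => Measure.tendsto_eval_ae_ae.eventually (hP.ae_le hGae)
  have hNull : ∀ n : ℕ, ∀ θ ∈ Θ, errNull μ Θ Γ g h φ ψ n θ
      = Measure.pi (fun _ : Fin n => expLaw ν (p θ))
        {X | logMarginal Θ φ p X < logMarginal Γ ψ q X} := fun n θ hθ => by
    rw [errNull, sampleLaw, hlawg θ hθ]
    refine measure_congr ?_
    filter_upwards [hgood (n := n) (Fg.isProbabilityMeasure hθ) expLaw_absolutelyContinuous]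
      with X hX
    refine propext ?_
    change 1 < bayesFactor Θ Γ g h φ ψ X ↔ _
    rw [hBF hX, one_lt_div (Fg.logMarginal_pos hX)]
    rfl
  have hAlt : ∀ n : ℕ, ∀ γ ∈ Γ, errAlt μ Θ Γ g h φ ψ n γ
      = Measure.pi (fun _ : Fin n => expLaw ν (q γ))
        {X | logMarginal Γ ψ q X ≤ logMarginal Θ φ p X} := fun n γ hγ => by
    rw [errAlt, sampleLaw, hlawh γ hγ]
    refine measure_congr ?_
    filter_upwards [hgood (n := n) (Fh.isProbabilityMeasure hγ) expLaw_absolutelyContinuous]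
      with X hX
    refine propext ?_
    change bayesFactor Θ Γ g h φ ψ X ≤ 1 ↔ _
    rw [hBF hX, div_le_one (Fg.logMarginal_pos hX)]
    rfl
  have hM' : affinity ν (q γ₀) (p θ₀) (1 - z) = ENNReal.ofReal (Real.exp (-ρ)) := by
    rw [affinity_symm, hM]
  have hmin' : ∀ u, affinity ν (q γ₀) (p θ₀) (1 - z) ≤ affinity ν (q γ₀) (p θ₀) u := fun u => by
    rw [affinity_symm, ← sub_sub_cancel 1 u, affinity_symm]
    exact hmin _
  have hsep1 : ∀ θ ∈ Θ, ∀ γ ∈ Γ, ∃ y, 0 ≤ y ∧ y ≤ 1 ∧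
      affinity ν (p θ) (q γ) y ≤ ENNReal.ofReal (Real.exp (-ρ)) := fun θ hθ γ hγ => by
    obtain ⟨y, h1, h2, h3⟩ := hsep θ hθ γ hγ
    exact ⟨y, by linarith, by linarith, h3⟩
  refine ⟨ρ, hρ, ⟨⟨θ₀, hθ₀, γ₀, hγ₀, le_antisymm ?_ ?_⟩, ?_⟩, ?_⟩
  · exact le_chernoffIndex hp₀ hq₀ (hlawg θ₀ hθ₀) (hlawh γ₀ hγ₀) hp1 hq1 (hlr θ₀ γ₀)
      (hhalf θ₀ hθ₀ γ₀ hγ₀) hM.le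
  · exact chernoffIndex_le (hg.measurable θ₀ hθ₀) (hh.measurable γ₀ hγ₀) hp₀ hq₀ (hlawg θ₀ hθ₀)
      (hlawh γ₀ hγ₀) hp1 hq1 (hlr θ₀ γ₀) hρ.le fun u => hM ▸ hmin u
  · rintro r ⟨θ, hθ, γ, hγ, rfl⟩
    obtain ⟨y, -, -, hy⟩ := hsep θ hθ γ hγ
    exact le_chernoffIndex (Fg.measurable θ hθ) (Fh.measurable γ hγ) (hlawg θ hθ) (hlawh γ hγ)
      (Fg.expInt_eq_one θ hθ) (Fh.expInt_eq_one γ hγ) (hlr θ γ) (hhalf θ hθ γ hγ) hy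
  -- The upper estimate covers `BF ≥ 1` and the lower one needs only strict inequality, so the
  -- treatment of ties does not matter for either error.
  have hNullRate := logAverage_logWorst_isEquivalent (e := errNull μ Θ Γ g h φ ψ)
    hΘ.measurableSet hφ.pos Fg.prior_integrableOn hφ.integral_eq_one hρ
    (fun ε hε => by
      filter_upwards [Fg.error_le Fh hsep1 hε] with n hn θ hθ
      rw [hNull n θ hθ]
      exact (measure_mono (Set.ofPred_subset_ofPred.2 fun X hX => le_of_lt hX)).trans (hn θ hθ)) hθ₀
    (fun τ hτ => by
      filter_upwards [Fg.exists_ball_error_ge Fh hθ₀ hγ₀ hρ hz0.le hz1.le hM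
        (fun c hc => exists_affinity_le_of_isMin hp₀ hq₀ hp1 hq1 hz0 hz1 hM hmin hc)
        ⟨κ, hκ, fun θ hθ => by
          obtain ⟨y, h1, h2, h3⟩ := hsep θ hθ γ₀ hγ₀
          exact ⟨y, by linarith, h2, h3⟩⟩ hτ] with n ⟨r, hr, hmass, hn⟩
      refine ⟨r, hr, hmass, fun θ hθ hd => ?_⟩
      rw [hNull n θ hθ]
      exact hn θ hθ hd)
  -- Exchanging the families reflects every exponent to `1 - z`; the margin `κ` at both endpoints
  -- makes the separation available here too.
  have hAltRate := logAverage_logWorst_isEquivalent (e := errAlt μ Θ Γ g h φ ψ)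
    hΓ.measurableSet hψ.pos Fh.prior_integrableOn hψ.integral_eq_one hρ
    (fun ε hε => by
      filter_upwards [Fh.error_le Fg (ρ := ρ) (fun γ hγ θ hθ => by
        obtain ⟨y, h1, h2, h3⟩ := hsep1 θ hθ γ hγ
        refine ⟨1 - y, by linarith, by linarith, ?_⟩
        rw [← affinity_symm] at h3
        exact h3) hε] with n hn γ hγ
      rw [hAlt n γ hγ]
      exact hn γ hγ) hγ₀
    (fun τ hτ => by
      filter_upwards [Fh.exists_ball_error_ge Fg hγ₀ hθ₀ hρ (sub_nonneg.2 hz1.le)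
        (by linarith : 1 - z ≤ 1) hM'
        (fun c hc => exists_affinity_le_of_isMin hq₀ hp₀ hq1 hp1 (sub_pos.2 hz1)
          (by linarith : 1 - z < 1) hM' hmin' hc)
        ⟨κ, hκ, fun γ hγ => by
          obtain ⟨y, h1, h2, h3⟩ := hsep θ₀ hθ₀ γ hγ
          refine ⟨1 - y, by linarith, by linarith, ?_⟩
          rw [← affinity_symm] at h3
          exact h3⟩ hτ] with n ⟨r, hr, hmass, hn⟩
      refine ⟨r, hr, hmass, fun γ hγ hd => ?_⟩
      rw [hAlt n γ hγ]
      exact (hn γ hγ hd).trans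
        (measure_mono (Set.ofPred_subset_ofPred.2 fun X hX => le_of_lt hX)))
  exact ⟨hNullRate.1, hNullRate.2, hAltRate.1, hAltRate.2⟩
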